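/- Let $K$ be a field of characteristic $0$ (e.g. $K=\mathbb C$). **Conventions.** For a finite dimensional Lie bialgebra $(\mathfrak h,\delta)$ over $K$, the dual $\mathfrak h^*$ is a Lie algebra by $[\xi,\eta]=(\xi\otimes\eta)\circ\delta$, the double is the Lie algebra $\mathfrak d(\mathfrak h)=\mathfrak h\oplus\mathfrak h^*$ whose canonical pairing $\langle-,-\rangle$ is invariant, and $H^*$ denotes the formal group of $\mathfrak h^*$, with function ring $K[[H^*]]=U(\mathfrak h^*)^*$. For $\xi\in\mathfrak h^*$ let $(\mathbf L_\xi f)(x)=\frac{d}{d\varepsilon}|_{\varepsilon=0}f(e^{-\varepsilon\xi}x)$ and $(\mathbf R_\xi f)(x)=\frac{d}{d\varepsilon}|_{\varepsilon=0}f(xe^{\varepsilon\xi})$; for $a\in\mathfrak h$ let $(\mathrm{dress}^L_af)(x)=-(\mathbf R_{(\mathrm{Ad}(x^{-1})a)_{\mathfrak h^*}}f)(x)$, where $(-)_{\mathfrak h^*}$ is the projection of $\mathfrak d(\mathfrak h)$ parallel to $\mathfrak h$; and let $\mathrm d^Lf=-\sum_ie_i\otimes\mathbf L_{\varepsilon^i}f$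 for dual bases $(e_i),(\varepsilon^i)$ of $\mathfrak h,\mathfrak h^*$. These derivations are extended to localizations $K[[H^*]][1/P]$, $P\ne0$. $\wedge^k(V)$ is the space of totally antisymmetric tensors in $V^{\otimes k}$, $\mathrm{Alt}$ is the sum over cyclic permutations of three tensor factors, and $\mathrm{CYB}(\rho)=[\rho^{1,2},\rho^{1,3}]+[\rho^{1,2},\rho^{2,3}]+[\rho^{1,3},\rho^{2,3}]$. Let $(\mathfrak a,\delta)$ be a Lie bialgebra, $\mathfrak h\subset\mathfrak a$ a finite dimensional Lie subbialgebra and $Z\in\wedge^3(\mathfrak a)^{\mathfrak a}$. A *Poisson–Lie (PL) dynamical $r$-matrix for $(H^*,\mathfrak a,Z)$* is an element $\rho\in\wedge^2(\mathfrak a)\otimes K[[H^*]][1/P]$, for some nonzero $P\in K[[H^*]]$, such that (a) $\mathrm{dress}^L_a(\rho)+[a\otimes1+1\otimes a,\rho]=0$ for all $a\in\mathfrak h$, and (b) $\mathrm{CYB}(\rho)+\mathrm{Alt}(\mathrm d^L\rho)+\mathrm{Alt}((\delta\otimes\mathrm{id})(\rho))=Z$. Let $(\mathfrak g,\delta)$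 be a finite dimensional Lie bialgebra with a splitting $\mathfrak g=\mathfrak l\oplus\mathfrak u$: $\mathfrak l$ is a Lie subbialgebra, $[\mathfrak l,\mathfrak u]\subset\mathfrak u$ and $\delta(\mathfrak u)\subset(\mathfrak l\otimes\mathfrak u)\oplus(\mathfrak u\otimes\mathfrak l)\oplus(\mathfrak u\otimes\mathfrak u)$. Assume that it is nondegenerate: for generic $\lambda\in\mathfrak l^*$ the form $(u,v)\mapsto\lambda([u,v]_{\mathfrak l})$ on $\mathfrak u$ is nondegenerate, where $(-)_{\mathfrak l}$ is the projection parallel to $\mathfrak u$. Extension of linear forms by $0$ on $\mathfrak u$ makes $\mathfrak l^*$ a Lie subalgebra of $\mathfrak g^*$ and gives a restriction map $K[[G^*]]\to K[[L^*]]$, $f\mapsto f_{|L^*}$. For $x\in L^*$ and $u,v\in\mathfrak u$ put $\omega_x(u,v)=\langle(\mathrm{Ad}(x^{-1})u)_{\mathfrak g},(\mathrm{Ad}(x^{-1})v)_{\mathfrak g^*}\rangle$, let $P_{\mathfrak l}^{\mathfrak g}\in K[[L^*]]$ be the determinant of $\omega_x$ in a basis of $\mathfrak u$, and let $\sigma_{\mathfrak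 l}^{\mathfrak g}=\sum_\alpha a_\alpha\otimes b_\alpha\otimes\ell_\alpha\in\wedge^2(\mathfrak u)\otimes K[[L^*]][1/P_{\mathfrak l}^{\mathfrak g}]$ be the inverse of $\omega_x$, i.e. $\sum_\alpha\omega_x(v,b_\alpha)\,\ell_\alpha(x)\,a_\alpha=v$ for all $v\in\mathfrak u$. **Theorem.** Let $\mathfrak g\subset\mathfrak a$ be an inclusion of Lie bialgebras and let $Z\in\wedge^3(\mathfrak a)^{\mathfrak a}$. Let $\rho\in\wedge^2(\mathfrak a)\otimes K[[G^*]][1/P]$ be a PL dynamical $r$-matrix for $(G^*,\mathfrak a,Z)$ whose denominator satisfies $P_{|L^*}\neq0$, so that $\rho_{|L^*}$ is defined. Then $P_{|L^*}P_{\mathfrak l}^{\mathfrak g}\ne0$ and $\rho_{|L^*}+\sigma_{\mathfrak l}^{\mathfrak g}\in\wedge^2(\mathfrak a)\otimes K[[L^*]][1/(P_{|L^*}P_{\mathfrak l}^{\mathfrak g})]$ is a PL dynamical $r$-matrix for $(L^*,\mathfrak a,Z)$. -/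

import Mathlib

open scoped TensorProduct

set_option maxSynthPendingDepth 3

section Envelope

attribute [local instance] LieRing.ofAssociativeRing

namespace UEnv

variable (K : Type*) [Field K] (L : Type*) [LieRing L] [LieAlgebra K L]


variable {K L} in
theorem algHom_ext {A : Type*} [Ring A] [Algebra K A]
    {F G : UniversalEnvelopingAlgebra K L →ₐ[K] A}
    (h : ∀ x : L, F (UniversalEnvelopingAlgebra.ι K x) = G (UniversalEnvelopingAlgebra.ι K x)) :
    F = G :=
  UniversalEnvelopingAlgebra.hom_ext K (LieHom.ext h)

/-- The coproduct of the enveloping algebra: `x ↦ x ⊗ 1 + 1 ⊗ x` on `L`. -/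
noncomputable def comulHom : (UniversalEnvelopingAlgebra K L) →ₐ[K] (UniversalEnvelopingAlgebra K L) ⊗[K] (UniversalEnvelopingAlgebra K L) :=
  UniversalEnvelopingAlgebra.lift K
    { toFun := fun x => (UniversalEnvelopingAlgebra.ι K x : (UniversalEnvelopingAlgebra K L)) ⊗ₜ[K] (1 : (UniversalEnvelopingAlgebra K L)) + (1 : (UniversalEnvelopingAlgebra K L)) ⊗ₜ[K] (UniversalEnvelopingAlgebra.ι K x : (UniversalEnvelopingAlgebra K L))
      map_add' := by
        intro x y
        simp only [map_add, TensorProduct.add_tmul, TensorProduct.tmul_add]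
        abel
      map_smul' := by
        intro c x
        simp only [map_smul, TensorProduct.smul_tmul', TensorProduct.tmul_smul, smul_add,
          RingHom.id_apply]
      map_lie' := by
        intro x y
        simp only [LieHom.map_lie, LieRing.of_associative_ring_bracket, mul_add, add_mul,
          Algebra.TensorProduct.tmul_mul_tmul, mul_one, one_mul, TensorProduct.sub_tmul,
          TensorProduct.tmul_sub]
        abel }

/-- The counit of the enveloping algebra: zero on `L`. -/
noncomputable def counitHom : (UniversalEnvelopingAlgebra K L) →ₐ[K] K :=
  UniversalEnvelopingAlgebra.lift K 0

variable {L}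

theorem comulHom_ι (x : L) :
    comulHom K L (UniversalEnvelopingAlgebra.ι K x) = (UniversalEnvelopingAlgebra.ι K x : (UniversalEnvelopingAlgebra K L)) ⊗ₜ[K] (1 : (UniversalEnvelopingAlgebra K L)) + (1 : (UniversalEnvelopingAlgebra K L)) ⊗ₜ[K] (UniversalEnvelopingAlgebra.ι K x : (UniversalEnvelopingAlgebra K L)) :=
  UniversalEnvelopingAlgebra.lift_ι_apply K _ x

theorem counitHom_ι (x : L) : counitHom K L (UniversalEnvelopingAlgebra.ι K x) = 0 :=
  UniversalEnvelopingAlgebra.lift_ι_apply K _ x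

variable (L)

/-- The standard bialgebra structure of the enveloping algebra. -/
noncomputable instance instBialgebra : Bialgebra K (UniversalEnvelopingAlgebra K L) :=
  Bialgebra.ofAlgHom (comulHom K L) (counitHom K L)
    (by
      apply algHom_ext
      intro x
      simp only [AlgHom.comp_apply, comulHom_ι, map_add,
        Algebra.TensorProduct.map_tmul, map_one, AlgHom.coe_id, id_eq, TensorProduct.add_tmul,
        TensorProduct.tmul_add, Algebra.TensorProduct.one_def]
      simp [Algebra.TensorProduct.assoc_tmul, add_assoc])
    (by
      apply algHom_ext
      intro x
      simp [-UniversalEnvelopingAlgebra.ι_apply, comulHom_ι, counitHom_ι])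
    (by
      apply algHom_ext
      intro x
      simp [-UniversalEnvelopingAlgebra.ι_apply, comulHom_ι, counitHom_ι])

variable {L}

theorem comul_ι (x : L) : Coalgebra.comul (R := K) (UniversalEnvelopingAlgebra.ι K x : (UniversalEnvelopingAlgebra K L)) =
    (UniversalEnvelopingAlgebra.ι K x : (UniversalEnvelopingAlgebra K L)) ⊗ₜ[K] (1 : (UniversalEnvelopingAlgebra K L)) + (1 : (UniversalEnvelopingAlgebra K L)) ⊗ₜ[K] (UniversalEnvelopingAlgebra.ι K x : (UniversalEnvelopingAlgebra K L)) :=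
  comulHom_ι K x

theorem counit_ι (x : L) : Coalgebra.counit (R := K) (UniversalEnvelopingAlgebra.ι K x : (UniversalEnvelopingAlgebra K L)) = 0 :=
  counitHom_ι K x

variable (L)

noncomputable instance instIsCocomm : Coalgebra.IsCocomm K (UniversalEnvelopingAlgebra K L) where
  comm_comp_comul := by
    have h : (Algebra.TensorProduct.comm K (UniversalEnvelopingAlgebra K L) (UniversalEnvelopingAlgebra K L)).toAlgHom.comp (comulHom K L) = comulHom K L := by
      apply algHom_ext
      intro x
      simp [-UniversalEnvelopingAlgebra.ι_apply, comulHom_ι, add_comm]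
    exact congrArg AlgHom.toLinearMap h

variable {K L} {L' : Type*} [LieRing L'] [LieAlgebra K L']

/-- Functoriality of the enveloping algebra. -/
noncomputable def map (f : L →ₗ⁅K⁆ L') :
    UniversalEnvelopingAlgebra K L →ₐ[K] UniversalEnvelopingAlgebra K L' :=
  UniversalEnvelopingAlgebra.lift K ((UniversalEnvelopingAlgebra.ι K).comp f)

theorem map_ι (f : L →ₗ⁅K⁆ L') (x : L) :
    map f (UniversalEnvelopingAlgebra.ι K x) = UniversalEnvelopingAlgebra.ι K (f x) :=
  UniversalEnvelopingAlgebra.lift_ι_apply K _ x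

theorem comul_map (f : L →ₗ⁅K⁆ L') (y : UniversalEnvelopingAlgebra K L) :
    Coalgebra.comul (R := K) (map f y) =
      TensorProduct.map (map f).toLinearMap (map f).toLinearMap (Coalgebra.comul (R := K) y) := by
  have h : (comulHom K L').comp (map f) =
      (Algebra.TensorProduct.map (map f) (map f)).comp (comulHom K L) := by
    apply algHom_ext
    intro x
    simp [-UniversalEnvelopingAlgebra.ι_apply, comulHom_ι, map_ι]
  exact congrArg (fun F => F y) h

theorem counit_map (f : L →ₗ⁅K⁆ L') (y : UniversalEnvelopingAlgebra K L) :
    Coalgebra.counit (R := K) (map f y) = Coalgebra.counit (R := K) y := by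
  have h : (counitHom K L').comp (map f) = counitHom K L := by
    apply algHom_ext
    intro x
    simp [-UniversalEnvelopingAlgebra.ι_apply, counitHom_ι, map_ι]
  exact congrArg (fun F => F y) h

end UEnv

end Envelope

/-- The cyclic permutation `x ⊗ y ⊗ z ↦ y ⊗ z ⊗ x`. -/
noncomputable def cyc (K : Type*) [Field K] (V : Type*) [AddCommGroup V] [Module K V] :
    (V ⊗[K] V) ⊗[K] V →ₗ[K] (V ⊗[K] V) ⊗[K] V :=
  (TensorProduct.comm K V (V ⊗[K] V)).toLinearMap ∘ₗ (TensorProduct.assoc K V V V).toLinearMap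

/-- The sum of the cyclic permutations. -/
noncomputable def Alt (K : Type*) [Field K] (V : Type*) [AddCommGroup V] [Module K V] :
    (V ⊗[K] V) ⊗[K] V →ₗ[K] (V ⊗[K] V) ⊗[K] V :=
  LinearMap.id + cyc K V + cyc K V ∘ₗ cyc K V

/-- A Lie bialgebra structure on a Lie algebra: an antisymmetric cobracket which satisfies the
co-Jacobi identity and is a 1-cocycle for the adjoint action on `𝔤 ⊗ 𝔤`. -/
class LieBialgebra (K : Type*) [Field K] (𝔤 : Type*) [LieRing 𝔤] [LieAlgebra K 𝔤] where
  δ : 𝔤 →ₗ[K] 𝔤 ⊗[K] 𝔤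
  antisymm : ∀ x, TensorProduct.comm K 𝔤 𝔤 (δ x) = -δ x
  coJacobi : ∀ x, Alt K 𝔤 (δ.rTensor 𝔤 (δ x)) = 0
  cocycle : ∀ x y, δ ⁅x, y⁆ = ⁅x, δ y⁆ - ⁅y, δ x⁆

namespace LieBialgebra

variable {K : Type*} [Field K] [CharZero K] {𝔤 : Type*} [LieRing 𝔤] [LieAlgebra K 𝔤]

/-- The pairing of `ξ ⊗ η` with a tensor in `𝔤 ⊗ 𝔤`. -/
noncomputable def pair (ξ η : Module.Dual K 𝔤) : 𝔤 ⊗[K] 𝔤 →ₗ[K] K :=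
  LinearMap.mul' K K ∘ₗ TensorProduct.map ξ η

/-- The contraction `ξ ⊗ id : 𝔤 ⊗ 𝔤 → 𝔤`. -/
noncomputable def contract (ξ : Module.Dual K 𝔤) : 𝔤 ⊗[K] 𝔤 →ₗ[K] 𝔤 :=
  (TensorProduct.lid K 𝔤).toLinearMap ∘ₗ ξ.rTensor 𝔤

@[simp] theorem pair_tmul (ξ η : Module.Dual K 𝔤) (x y : 𝔤) :
    pair ξ η (x ⊗ₜ[K] y) = ξ x * η y := rfl

@[simp] theorem contract_tmul (ξ : Module.Dual K 𝔤) (x y : 𝔤) :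
    contract ξ (x ⊗ₜ[K] y) = ξ x • y := rfl

theorem pair_eq_contract (ξ η : Module.Dual K 𝔤) (t : 𝔤 ⊗[K] 𝔤) :
    pair ξ η t = η (contract ξ t) := by
  induction t with
  | zero => simp
  | tmul x y => simp
  | add s t hs ht => simp [hs, ht]

theorem pair_comm (ξ η : Module.Dual K 𝔤) (t : 𝔤 ⊗[K] 𝔤) :
    pair ξ η (TensorProduct.comm K 𝔤 𝔤 t) = pair η ξ t := by
  induction t with
  | zero => simp
  | tmul x y => simp [mul_comm]
  | add s t hs ht => simp [hs, ht]

theorem pair_add_left (ξ ξ' η : Module.Dual K 𝔤) (t : 𝔤 ⊗[K] 𝔤) :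
    pair (ξ + ξ') η t = pair ξ η t + pair ξ' η t := by
  simp [pair, TensorProduct.map_add_left]

theorem pair_add_right (ξ η η' : Module.Dual K 𝔤) (t : 𝔤 ⊗[K] 𝔤) :
    pair ξ (η + η') t = pair ξ η t + pair ξ η' t := by
  simp [pair, TensorProduct.map_add_right]

theorem pair_smul_right (c : K) (ξ η : Module.Dual K 𝔤) (t : 𝔤 ⊗[K] 𝔤) :
    pair ξ (c • η) t = c * pair ξ η t := by
  simp [pair, TensorProduct.map_smul_right]

theorem contract_add (ξ ξ' : Module.Dual K 𝔤) (t : 𝔤 ⊗[K] 𝔤) :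
    contract (ξ + ξ') t = contract ξ t + contract ξ' t := by
  simp [contract, LinearMap.rTensor_add]

theorem contract_smul (c : K) (ξ : Module.Dual K 𝔤) (t : 𝔤 ⊗[K] 𝔤) :
    contract (c • ξ) t = c • contract ξ t := by
  simp [contract, LinearMap.rTensor_smul]

variable [LieBialgebra K 𝔤]

/-- The bracket of the dual Lie algebra: `⟨[ξ, η], x⟩ = ⟨ξ ⊗ η, δ x⟩`. -/
noncomputable def dualBracket (ξ η : Module.Dual K 𝔤) : Module.Dual K 𝔤 := pair ξ η ∘ₗ δ

theorem dualBracket_apply (ξ η : Module.Dual K 𝔤) (x : 𝔤) :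
    dualBracket ξ η x = pair ξ η (δ x) := rfl

theorem pair_δ_swap (ξ η : Module.Dual K 𝔤) (x : 𝔤) :
    pair ξ η (δ (K := K) x) = -pair η ξ (δ (K := K) x) := by
  rw [← pair_comm, antisymm, map_neg]

/-- The pairing of `ξ ⊗ η ⊗ ζ` with a tensor in `𝔤 ⊗ 𝔤 ⊗ 𝔤`. -/
noncomputable def pair₃ (ξ η ζ : Module.Dual K 𝔤) : (𝔤 ⊗[K] 𝔤) ⊗[K] 𝔤 →ₗ[K] K :=
  LinearMap.mul' K K ∘ₗ TensorProduct.map (pair ξ η) ζ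

theorem pair₃_cyc (ξ η ζ : Module.Dual K 𝔤) (t : (𝔤 ⊗[K] 𝔤) ⊗[K] 𝔤) :
    pair₃ ξ η ζ (cyc K 𝔤 t) = pair₃ ζ ξ η t := by
  have h : pair₃ ξ η ζ ∘ₗ cyc K 𝔤 = pair₃ ζ ξ η := by
    apply TensorProduct.ext_threefold
    intro x y z
    simp [pair₃, cyc]
    ring
  exact LinearMap.congr_fun h t

theorem pair_dualBracket_left (ξ η ζ : Module.Dual K 𝔤) (t : 𝔤 ⊗[K] 𝔤) :
    pair (dualBracket ξ η) ζ t = pair₃ ξ η ζ ((δ (K := K)).rTensor 𝔤 t) := by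
  induction t with
  | zero => simp
  | tmul x y => simp [pair₃, dualBracket_apply]
  | add s t hs ht => simp [hs, ht]

theorem dual_jacobi (ξ η ζ : Module.Dual K 𝔤) (x : 𝔤) :
    pair (dualBracket ξ η) ζ (δ (K := K) x) + pair (dualBracket ζ ξ) η (δ (K := K) x) +
      pair (dualBracket η ζ) ξ (δ (K := K) x) = 0 := by
  have h := congrArg (pair₃ ξ η ζ) (coJacobi (K := K) x)
  simpa [Alt, pair₃_cyc, ← pair_dualBracket_left] using h

theorem dualBracket_swap (ξ η : Module.Dual K 𝔤) : dualBracket ξ η = -dualBracket η ξ := by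
  ext x
  exact pair_δ_swap ξ η x

theorem pair_neg_left (ξ η : Module.Dual K 𝔤) (t : 𝔤 ⊗[K] 𝔤) :
    pair (-ξ) η t = -pair ξ η t := by
  have := pair_add_left ξ (-ξ) η t
  simp only [add_neg_cancel] at this
  have h0 : pair (0 : Module.Dual K 𝔤) η t = 0 := by simp [pair]
  rw [h0] at this
  exact (neg_eq_of_add_eq_zero_right this.symm).symm

/-- The dual Lie algebra `𝔤*`. -/
noncomputable instance dualLieRing : LieRing (Module.Dual K 𝔤) where
  bracket := dualBracket
  add_lie ξ η ζ := by
    ext x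
    exact pair_add_left ξ η ζ (δ x)
  lie_add ξ η ζ := by
    ext x
    exact pair_add_right ξ η ζ (δ x)
  lie_self ξ := by
    ext x
    exact self_eq_neg.mp (pair_δ_swap ξ ξ x)
  leibniz_lie ξ η ζ := by
    ext x
    change pair ξ (dualBracket η ζ) (δ (K := K) x) =
      pair (dualBracket ξ η) ζ (δ (K := K) x) + pair η (dualBracket ξ ζ) (δ (K := K) x)
    have h := dual_jacobi ξ η ζ x
    rw [dualBracket_swap ζ ξ, pair_neg_left, pair_δ_swap (dualBracket ξ ζ) η,
      pair_δ_swap (dualBracket η ζ) ξ] at h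
    linear_combination -h

theorem dual_lie_apply (ξ η : Module.Dual K 𝔤) (x : 𝔤) :
    ⁅ξ, η⁆ x = pair ξ η (δ (K := K) x) := rfl

noncomputable instance dualLieAlgebra : LieAlgebra K (Module.Dual K 𝔤) where
  lie_smul c ξ η := by
    ext x
    exact pair_smul_right c ξ η (δ x)

/-- `ξ ↦ ξ ∘ ad x`. -/
noncomputable def compAd (x : 𝔤) (ξ : Module.Dual K 𝔤) : Module.Dual K 𝔤 :=
  ξ ∘ₗ (LieModule.toEnd K 𝔤 𝔤 x : 𝔤 →ₗ[K] 𝔤)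

@[simp] theorem compAd_apply (x y : 𝔤) (ξ : Module.Dual K 𝔤) : compAd x ξ y = ξ ⁅x, y⁆ := rfl

theorem contract_lie (ξ : Module.Dual K 𝔤) (x : 𝔤) (t : 𝔤 ⊗[K] 𝔤) :
    contract ξ ⁅x, t⁆ = ⁅x, contract ξ t⁆ + contract (compAd x ξ) t := by
  induction t with
  | zero => simp
  | tmul a b => simp [TensorProduct.LieModule.lie_tmul_right, add_comm]
  | add s t hs ht =>
    simp only [lie_add, map_add, hs, ht]
    abel

theorem apply_contract_δ (ξ η : Module.Dual K 𝔤) (x : 𝔤) :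
    η (contract ξ (δ (K := K) x)) = ⁅ξ, η⁆ x := (pair_eq_contract ξ η (δ x)).symm

theorem contract_δ_lie (ξ : Module.Dual K 𝔤) (x y : 𝔤) :
    contract ξ (δ (K := K) ⁅x, y⁆) =
      ⁅x, contract ξ (δ (K := K) y)⁆ + contract (compAd x ξ) (δ (K := K) y)
        - ⁅y, contract ξ (δ (K := K) x)⁆ - contract (compAd y ξ) (δ (K := K) x) := by
  rw [cocycle, map_sub, contract_lie, contract_lie]
  abel

theorem contract_lie_δ (ξ η : Module.Dual K 𝔤) (x : 𝔤) :
    contract ⁅ξ, η⁆ (δ (K := K) x) =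
      contract η (δ (K := K) (contract ξ (δ (K := K) x)))
        - contract ξ (δ (K := K) (contract η (δ (K := K) x))) := by
  rw [← sub_eq_zero, ← Module.forall_dual_apply_eq_zero_iff K]
  intro ζ
  simp only [map_sub, apply_contract_δ]
  have h := LinearMap.congr_fun (leibniz_lie ξ η ζ) x
  simp only [LinearMap.add_apply] at h
  rw [h]
  ring

theorem lie_compAd (ξ η : Module.Dual K 𝔤) (x : 𝔤) :
    compAd x ⁅ξ, η⁆ = ⁅compAd x ξ, η⁆ + ⁅ξ, compAd x η⁆
      + compAd (contract ξ (δ (K := K) x)) η - compAd (contract η (δ (K := K) x)) ξ := by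
  ext w
  have e : ⁅ξ, η⁆ ⁅x, w⁆ = η (contract ξ (δ (K := K) ⁅x, w⁆)) := (apply_contract_δ ξ η _).symm
  have e1 : η ⁅x, contract ξ (δ (K := K) w)⁆ = ⁅ξ, compAd x η⁆ w :=
    apply_contract_δ ξ (compAd x η) w
  have e2 : η (contract (compAd w ξ) (δ (K := K) x)) = -ξ ⁅w, contract η (δ (K := K) x)⁆ := by
    rw [apply_contract_δ, ← lie_skew, LinearMap.neg_apply, ← apply_contract_δ]
    rfl
  simp only [compAd_apply, LinearMap.sub_apply, LinearMap.add_apply]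
  rw [e, contract_δ_lie]
  simp only [map_sub, map_add]
  rw [e1, apply_contract_δ (compAd x ξ) η w, e2, ← lie_skew w (contract ξ _),
    ← lie_skew w (contract η _)]
  simp only [map_neg]
  ring

variable (K 𝔤) in
/-- The underlying space `𝔤 ⊕ 𝔤*` of the Drinfeld double. -/
def Double : Type _ := 𝔤 × Module.Dual K 𝔤

noncomputable instance doubleAddCommGroup : AddCommGroup (Double K 𝔤) :=
  inferInstanceAs (AddCommGroup (𝔤 × Module.Dual K 𝔤))

noncomputable instance doubleModule : Module K (Double K 𝔤) :=
  inferInstanceAs (Module K (𝔤 × Module.Dual K 𝔤))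

namespace Double

variable (K 𝔤) in
/-- The projection `𝔤 ⊕ 𝔤* → 𝔤`. -/
def fst : Double K 𝔤 →ₗ[K] 𝔤 := LinearMap.fst K 𝔤 (Module.Dual K 𝔤)

variable (K 𝔤) in
/-- The projection `𝔤 ⊕ 𝔤* → 𝔤*`. -/
def snd : Double K 𝔤 →ₗ[K] Module.Dual K 𝔤 := LinearMap.snd K 𝔤 (Module.Dual K 𝔤)

variable (K 𝔤) in
/-- The inclusion of `𝔤`. -/
def inl : 𝔤 →ₗ[K] Double K 𝔤 := LinearMap.inl K 𝔤 (Module.Dual K 𝔤)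

variable (K 𝔤) in
/-- The inclusion of `𝔤*`. -/
def inr : Module.Dual K 𝔤 →ₗ[K] Double K 𝔤 := LinearMap.inr K 𝔤 (Module.Dual K 𝔤)

@[ext] theorem ext' {a b : Double K 𝔤} (h₁ : fst K 𝔤 a = fst K 𝔤 b)
    (h₂ : snd K 𝔤 a = snd K 𝔤 b) : a = b := Prod.ext h₁ h₂

@[simp] theorem fst_inl (x : 𝔤) : fst K 𝔤 (inl K 𝔤 x) = x := rfl
@[simp] theorem snd_inl (x : 𝔤) : snd K 𝔤 (inl K 𝔤 x) = 0 := rfl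
@[simp] theorem fst_inr (ξ : Module.Dual K 𝔤) : fst K 𝔤 (inr K 𝔤 ξ) = 0 := rfl
@[simp] theorem snd_inr (ξ : Module.Dual K 𝔤) : snd K 𝔤 (inr K 𝔤 ξ) = ξ := rfl

/-- The bracket of the Drinfeld double: `𝔤` and `𝔤*` are subalgebras and
`[x, η] = (η ⊗ id)(δ x) - η ∘ ad x`, which is the bracket that makes the canonical form
invariant. -/
noncomputable instance instBracket : Bracket (Double K 𝔤) (Double K 𝔤) where
  bracket a b :=
    ((⁅fst K 𝔤 a, fst K 𝔤 b⁆ + contract (snd K 𝔤 b) (δ (K := K) (fst K 𝔤 a))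
        - contract (snd K 𝔤 a) (δ (K := K) (fst K 𝔤 b)),
      ⁅snd K 𝔤 a, snd K 𝔤 b⁆ - compAd (fst K 𝔤 a) (snd K 𝔤 b)
        + compAd (fst K 𝔤 b) (snd K 𝔤 a)) : 𝔤 × Module.Dual K 𝔤)

theorem fst_lie (a b : Double K 𝔤) : fst K 𝔤 ⁅a, b⁆ =
    ⁅fst K 𝔤 a, fst K 𝔤 b⁆ + contract (snd K 𝔤 b) (δ (K := K) (fst K 𝔤 a))
      - contract (snd K 𝔤 a) (δ (K := K) (fst K 𝔤 b)) := rfl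

theorem snd_lie (a b : Double K 𝔤) : snd K 𝔤 ⁅a, b⁆ =
    ⁅snd K 𝔤 a, snd K 𝔤 b⁆ - compAd (fst K 𝔤 a) (snd K 𝔤 b)
      + compAd (fst K 𝔤 b) (snd K 𝔤 a) := rfl

theorem compAd_add_left (x y : 𝔤) (ξ : Module.Dual K 𝔤) :
    compAd (x + y) ξ = compAd x ξ + compAd y ξ := by ext; simp
theorem compAd_sub_left (x y : 𝔤) (ξ : Module.Dual K 𝔤) :
    compAd (x - y) ξ = compAd x ξ - compAd y ξ := by ext; simp
theorem compAd_add_right (x : 𝔤) (ξ η : Module.Dual K 𝔤) :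
    compAd x (ξ + η) = compAd x ξ + compAd x η := by ext; simp
theorem compAd_sub_right (x : 𝔤) (ξ η : Module.Dual K 𝔤) :
    compAd x (ξ - η) = compAd x ξ - compAd x η := by ext; simp
theorem compAd_smul_left (c : K) (x : 𝔤) (ξ : Module.Dual K 𝔤) :
    compAd (c • x) ξ = c • compAd x ξ := by ext; simp
theorem compAd_smul_right (c : K) (x : 𝔤) (ξ : Module.Dual K 𝔤) :
    compAd x (c • ξ) = c • compAd x ξ := by ext; simp
theorem compAd_lie (x y : 𝔤) (ξ : Module.Dual K 𝔤) :
    compAd ⁅x, y⁆ ξ = compAd y (compAd x ξ) - compAd x (compAd y ξ) := by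
  ext; simp
theorem contract_sub (ξ η : Module.Dual K 𝔤) (t : 𝔤 ⊗[K] 𝔤) :
    contract (ξ - η) t = contract ξ t - contract η t := by
  simp [contract, LinearMap.rTensor_sub]

/-- The Drinfeld double `𝔡(𝔤) = 𝔤 ⊕ 𝔤*` as a Lie algebra. -/
noncomputable instance instLieRing : LieRing (Double K 𝔤) where
  add_lie a b c := by
    ext1
    · simp only [fst_lie, map_add, add_lie, contract_add]
      abel
    · simp only [snd_lie, map_add, add_lie, compAd_add_left, compAd_add_right]
      abel
  lie_add a b c := by
    ext1
    · simp only [fst_lie, map_add, lie_add, contract_add]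
      abel
    · simp only [snd_lie, map_add, lie_add, compAd_add_left, compAd_add_right]
      abel
  lie_self a := by
    ext1
    · simp [fst_lie]
    · simp [snd_lie]
  leibniz_lie a b c := by
    ext1
    · simp only [fst_lie, snd_lie, map_add, map_sub, lie_add, add_lie, lie_sub, sub_lie,
        contract_add, contract_sub, contract_δ_lie, contract_lie_δ]
      rw [leibniz_lie (fst K 𝔤 a)]
      simp only [← lie_skew (fst K 𝔤 b) (contract _ _), ← lie_skew (fst K 𝔤 c) (contract _ _),
        ← lie_skew (fst K 𝔤 a) (contract _ _)]
      abel
    · simp only [fst_lie, snd_lie, map_add, lie_add, add_lie, lie_sub, sub_lie,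
        compAd_add_left, compAd_add_right, compAd_sub_left, compAd_sub_right, compAd_lie,
        lie_compAd]
      rw [leibniz_lie (snd K 𝔤 a)]
      simp only [← lie_skew (snd K 𝔤 b) (compAd _ (snd K 𝔤 a))]
      abel

noncomputable instance instLieAlgebra : LieAlgebra K (Double K 𝔤) where
  lie_smul c a b := by
    ext1
    · simp only [fst_lie, map_smul, lie_smul, contract_smul, smul_add, smul_sub]
    · simp only [snd_lie, map_smul, lie_smul, compAd_smul_left, compAd_smul_right, smul_add,
        smul_sub]

theorem inr_lie (ξ η : Module.Dual K 𝔤) :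
    inr K 𝔤 ⁅ξ, η⁆ = ⁅inr K 𝔤 ξ, inr K 𝔤 η⁆ := by
  ext1
  · simp [fst_lie]
  · simp [snd_lie, compAd]

end Double

end LieBialgebra

section FormalGroup

attribute [local instance] LieRing.ofAssociativeRing

open LieBialgebra

/-- The function ring `K[[H*]] = U(𝔥*)*` of the formal group `H*` with Lie algebra `𝔥*`. -/
def FormalFun (K : Type*) [Field K] [CharZero K] (𝔥 : Type*) [LieRing 𝔥] [LieAlgebra K 𝔥]
    [LieBialgebra K 𝔥] : Type _ :=
  WithConv (UniversalEnvelopingAlgebra K (Module.Dual K 𝔥) →ₗ[K] K)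

namespace FormalFun

variable {K : Type*} [Field K] [CharZero K] {𝔥 : Type*} [LieRing 𝔥] [LieAlgebra K 𝔥]
  [LieBialgebra K 𝔥]

/-- The product of `K[[H*]]` is the convolution product, dual to the coproduct of `U(𝔥*)`. -/
noncomputable instance instCommRing : CommRing (FormalFun K 𝔥) :=
  inferInstanceAs
    (CommRing (WithConv (UniversalEnvelopingAlgebra K (Module.Dual K 𝔥) →ₗ[K] K)))

noncomputable instance instAlgebra : Algebra K (FormalFun K 𝔥) :=
  inferInstanceAs
    (Algebra K (WithConv (UniversalEnvelopingAlgebra K (Module.Dual K 𝔥) →ₗ[K] K)))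

/-- The function on `H*` given by a linear form on `U(𝔥*)`. -/
def mk (φ : UniversalEnvelopingAlgebra K (Module.Dual K 𝔥) →ₗ[K] K) : FormalFun K 𝔥 :=
  WithConv.toConv φ

/-- The linear form on `U(𝔥*)` given by a function on `H*`. -/
def eval (f : FormalFun K 𝔥) : UniversalEnvelopingAlgebra K (Module.Dual K 𝔥) →ₗ[K] K :=
  WithConv.ofConv f

@[ext] theorem ext' {f g : FormalFun K 𝔥} (h : ∀ y, f.eval y = g.eval y) : f = g :=
  WithConv.ofConv_injective (LinearMap.ext h)

@[simp] theorem eval_mk (φ : UniversalEnvelopingAlgebra K (Module.Dual K 𝔥) →ₗ[K] K) :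
    (mk φ).eval = φ := rfl
@[simp] theorem eval_add (f g : FormalFun K 𝔥) : (f + g).eval = f.eval + g.eval := rfl
@[simp] theorem eval_zero : (0 : FormalFun K 𝔥).eval = 0 := rfl
@[simp] theorem eval_smul (c : K) (f : FormalFun K 𝔥) : (c • f).eval = c • f.eval := rfl

theorem eval_one (y : UniversalEnvelopingAlgebra K (Module.Dual K 𝔥)) :
    (1 : FormalFun K 𝔥).eval y = Coalgebra.counit (R := K) y := rfl

theorem eval_mul (f g : FormalFun K 𝔥) (y : UniversalEnvelopingAlgebra K (Module.Dual K 𝔥)) :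
    (f * g).eval y =
      LinearMap.mul' K K (TensorProduct.map f.eval g.eval (Coalgebra.comul (R := K) y)) := rfl

theorem eval_algebraMap (c : K) (y : UniversalEnvelopingAlgebra K (Module.Dual K 𝔥)) :
    (algebraMap K (FormalFun K 𝔥) c).eval y = c * Coalgebra.counit (R := K) y := rfl

theorem pairing_left (f g : UniversalEnvelopingAlgebra K (Module.Dual K 𝔥) →ₗ[K] K)
    (a : UniversalEnvelopingAlgebra K (Module.Dual K 𝔥))
    (t : UniversalEnvelopingAlgebra K (Module.Dual K 𝔥) ⊗[K]
      UniversalEnvelopingAlgebra K (Module.Dual K 𝔥)) :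
    LinearMap.mul' K K (TensorProduct.map f g ((a ⊗ₜ[K] 1 + 1 ⊗ₜ[K] a) * t)) =
      LinearMap.mul' K K (TensorProduct.map (f ∘ₗ LinearMap.mulLeft K a) g t) +
        LinearMap.mul' K K (TensorProduct.map f (g ∘ₗ LinearMap.mulLeft K a) t) := by
  induction t with
  | zero => simp
  | tmul x y => simp [add_mul]
  | add s t hs ht =>
    simp only [mul_add, map_add, hs, ht]
    ring

theorem pairing_right (f g : UniversalEnvelopingAlgebra K (Module.Dual K 𝔥) →ₗ[K] K)
    (a : UniversalEnvelopingAlgebra K (Module.Dual K 𝔥))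
    (t : UniversalEnvelopingAlgebra K (Module.Dual K 𝔥) ⊗[K]
      UniversalEnvelopingAlgebra K (Module.Dual K 𝔥)) :
    LinearMap.mul' K K (TensorProduct.map f g (t * (a ⊗ₜ[K] 1 + 1 ⊗ₜ[K] a))) =
      LinearMap.mul' K K (TensorProduct.map (f ∘ₗ LinearMap.mulRight K a) g t) +
        LinearMap.mul' K K (TensorProduct.map f (g ∘ₗ LinearMap.mulRight K a) t) := by
  induction t with
  | zero => simp
  | tmul x y => simp [mul_add]
  | add s t hs ht =>
    simp only [add_mul, map_add, hs, ht]
    ring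

/-- The left translation `(L_ξ f)(x) = d/dε f(e^{-εξ} x)`, that is `(L_ξ f)(y) = f(-ξ y)` for
`y ∈ U(𝔥*)`. -/
noncomputable def leftDer (ξ : Module.Dual K 𝔥) :
    Derivation K (FormalFun K 𝔥) (FormalFun K 𝔥) :=
  Derivation.mk'
    { toFun := fun f => mk
        (-(f.eval ∘ₗ LinearMap.mulLeft K (UniversalEnvelopingAlgebra.ι K ξ)))
      map_add' := by
        intro f g
        ext y
        simp [add_comm]
      map_smul' := by
        intro c f
        ext y
        simp }
    (by
      intro f g
      ext y
      have h := pairing_left f.eval g.eval (UniversalEnvelopingAlgebra.ι K ξ)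
        (Coalgebra.comul (R := K) y)
      rw [← UEnv.comul_ι, ← Bialgebra.comul_mul] at h
      rw [smul_eq_mul, smul_eq_mul, mul_comm g, eval_add, LinearMap.add_apply, eval_mul, eval_mul]
      change -(f * g).eval (UniversalEnvelopingAlgebra.ι K ξ * y) =
        LinearMap.mul' K K (TensorProduct.map f.eval
          (-(g.eval ∘ₗ LinearMap.mulLeft K (UniversalEnvelopingAlgebra.ι K ξ)))
          (Coalgebra.comul (R := K) y)) +
        LinearMap.mul' K K (TensorProduct.map
          (-(f.eval ∘ₗ LinearMap.mulLeft K (UniversalEnvelopingAlgebra.ι K ξ))) g.eval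
          (Coalgebra.comul (R := K) y))
      rw [eval_mul]
      rw [h, ← neg_one_smul K (g.eval ∘ₗ _), ← neg_one_smul K (f.eval ∘ₗ _),
        TensorProduct.map_smul_left, TensorProduct.map_smul_right]
      simp only [LinearMap.smul_apply, map_smul, smul_eq_mul]
      ring)

theorem leftDer_apply (ξ : Module.Dual K 𝔥) (f : FormalFun K 𝔥)
    (y : UniversalEnvelopingAlgebra K (Module.Dual K 𝔥)) :
    (leftDer ξ f).eval y = -f.eval (UniversalEnvelopingAlgebra.ι K ξ * y) := rfl

/-- The right translation `(R_ξ f)(x) = d/dε f(x e^{εξ})`, that is `(R_ξ f)(y) = f(y ξ)` for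
`y ∈ U(𝔥*)`. -/
noncomputable def rightDer (ξ : Module.Dual K 𝔥) :
    Derivation K (FormalFun K 𝔥) (FormalFun K 𝔥) :=
  Derivation.mk'
    { toFun := fun f => mk
        (f.eval ∘ₗ LinearMap.mulRight K (UniversalEnvelopingAlgebra.ι K ξ))
      map_add' := by
        intro f g
        ext y
        simp
      map_smul' := by
        intro c f
        ext y
        simp }
    (by
      intro f g
      ext y
      have h := pairing_right f.eval g.eval (UniversalEnvelopingAlgebra.ι K ξ)
        (Coalgebra.comul (R := K) y)
      rw [← UEnv.comul_ι, ← Bialgebra.comul_mul] at h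
      rw [smul_eq_mul, smul_eq_mul, mul_comm g, add_comm]
      exact h)

theorem rightDer_apply (ξ : Module.Dual K 𝔥) (f : FormalFun K 𝔥)
    (y : UniversalEnvelopingAlgebra K (Module.Dual K 𝔥)) :
    (rightDer ξ f).eval y = f.eval (y * UniversalEnvelopingAlgebra.ι K ξ) := rfl

variable (K 𝔥) in
/-- The action `x ↦ Ad(x⁻¹)` of `H*` on `𝔡(𝔥)`, as the antihomomorphism
`U(𝔥*) → End(𝔡(𝔥))` that extends `ξ ↦ -ad ξ`. -/
noncomputable def adInv :
    UniversalEnvelopingAlgebra K (Module.Dual K 𝔥) →ₐ[K] (Module.End K (Double K 𝔥))ᵐᵒᵖ :=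
  UniversalEnvelopingAlgebra.lift K
    { toFun := fun ξ =>
        -MulOpposite.op (LieModule.toEnd K (Double K 𝔥) (Double K 𝔥) (Double.inr K 𝔥 ξ))
      map_add' := by
        intro ξ η
        simp only [map_add, MulOpposite.op_add, neg_add]
      map_smul' := by
        intro c ξ
        simp only [map_smul, MulOpposite.op_smul, smul_neg, RingHom.id_apply]
      map_lie' := by
        intro ξ η
        rw [Double.inr_lie, LieHom.map_lie]
        apply MulOpposite.unop_injective
        simp [LieRing.of_associative_ring_bracket] }

/-- The function `x ↦ φ(Ad(x⁻¹) v)` on `H*`. -/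
noncomputable def adInvCoeff (φ : Module.Dual K (Double K 𝔥)) (v : Double K 𝔥) :
    FormalFun K 𝔥 :=
  mk
    { toFun := fun y => φ ((adInv K 𝔥 y).unop v)
      map_add' := by
        intro y z
        simp
      map_smul' := by
        intro c y
        simp }

section Finite

variable [FiniteDimensional K 𝔥]

/-- The left dressing action of `𝔡(𝔥)`:
`(dress_a f)(x) = -(R_{(Ad(x⁻¹) a)_{𝔥*}} f)(x)`. The `𝔥*`-component is expanded in the basis dual
to a basis `e` of `𝔥`. -/
noncomputable def dress (a : Double K 𝔥) : Derivation K (FormalFun K 𝔥) (FormalFun K 𝔥) :=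
  -∑ i, adInvCoeff (Module.Dual.eval K 𝔥 (Module.finBasis K 𝔥 i) ∘ₗ Double.snd K 𝔥) a •
    rightDer ((Module.finBasis K 𝔥).coord i)

/-- The function `x ↦ ⟨(Ad(x⁻¹) u)_𝔥, (Ad(x⁻¹) v)_{𝔥*}⟩` on `H*`. -/
noncomputable def omega (u v : Double K 𝔥) : FormalFun K 𝔥 :=
  ∑ i, adInvCoeff ((Module.finBasis K 𝔥).coord i ∘ₗ Double.fst K 𝔥) u *
    adInvCoeff (Module.Dual.eval K 𝔥 (Module.finBasis K 𝔥 i) ∘ₗ Double.snd K 𝔥) v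

end Finite

variable {𝔩 : Type*} [LieRing 𝔩] [LieAlgebra K 𝔩] [LieBialgebra K 𝔩]

/-- The restriction `K[[G*]] → K[[L*]]` along a morphism of Lie algebras `𝔩* → 𝔤*`. -/
noncomputable def comap (f : Module.Dual K 𝔩 →ₗ⁅K⁆ Module.Dual K 𝔥) :
    FormalFun K 𝔥 →ₐ[K] FormalFun K 𝔩 where
  toFun F := mk (F.eval ∘ₗ (UEnv.map f).toLinearMap)
  map_one' := by
    ext y
    exact UEnv.counit_map f y
  map_mul' F G := by
    ext y
    rw [eval_mul, eval_mk, LinearMap.comp_apply, AlgHom.toLinearMap_apply, eval_mul]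
    rw [UEnv.comul_map, eval_mk, eval_mk, TensorProduct.map_comp, LinearMap.comp_apply]
  map_zero' := by
    ext y
    simp
  map_add' F G := by
    ext y
    simp
  commutes' c := by
    ext y
    exact congrArg (c * ·) (UEnv.counit_map f y)

end FormalFun

end FormalGroup

section Localizations

variable {K : Type*} [Field K] {R : Type*} [CommRing R] [Algebra K R]

/-- The ring homomorphism `f ↦ f + ε D f` from `R` to the dual numbers over `R[1/P]`. -/
noncomputable def awayDual (D : Derivation K R R) (P : R) :
    R →+* TrivSqZeroExt (Localization.Away P) (Localization.Away P) where
  toFun f := ((algebraMap R (Localization.Away P) f, algebraMap R (Localization.Away P) (D f)) :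
    Localization.Away P × Localization.Away P)
  map_one' := Prod.ext (map_one _) (by simp; rfl)
  map_mul' f g := Prod.ext (map_mul _ _ _) (by
    change algebraMap R (Localization.Away P) (D (f * g)) =
      algebraMap R (Localization.Away P) f • algebraMap R (Localization.Away P) (D g) +
        MulOpposite.op (algebraMap R (Localization.Away P) g) •
          algebraMap R (Localization.Away P) (D f)
    rw [D.leibniz, map_add, smul_eq_mul, smul_eq_mul, map_mul, map_mul, op_smul_eq_smul,
      smul_eq_mul, smul_eq_mul])
  map_zero' := Prod.ext (map_zero _) (by simp; rfl)
  map_add' f g := Prod.ext (map_add _ _ _) (by simp; rfl)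

theorem fst_awayDual (D : Derivation K R R) (P f : R) :
    (awayDual D P f).fst = algebraMap R (Localization.Away P) f := rfl

theorem snd_awayDual (D : Derivation K R R) (P f : R) :
    (awayDual D P f).snd = algebraMap R (Localization.Away P) (D f) := rfl

theorem awayDual_isUnit (D : Derivation K R R) (P : R) : IsUnit (awayDual D P P) := by
  rw [TrivSqZeroExt.isUnit_iff_isUnit_fst]
  simpa [fst_awayDual] using IsLocalization.Away.algebraMap_isUnit (S := Localization.Away P) P

/-- The lift of `awayDual` to `R[1/P]`. -/
noncomputable def awayDualLift (D : Derivation K R R) (P : R) :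
    Localization.Away P →+* TrivSqZeroExt (Localization.Away P) (Localization.Away P) :=
  IsLocalization.Away.lift P (awayDual_isUnit D P)

theorem awayDualLift_algebraMap (D : Derivation K R R) (P f : R) :
    awayDualLift D P (algebraMap R (Localization.Away P) f) = awayDual D P f :=
  IsLocalization.Away.lift_eq P (awayDual_isUnit D P) f

theorem fst_awayDualLift (D : Derivation K R R) (P : R) (f : Localization.Away P) :
    (awayDualLift D P f).fst = f := by
  have h : (TrivSqZeroExt.fstHom (Localization.Away P) (Localization.Away P)
      (Localization.Away P)).toRingHom.comp (awayDualLift D P) = RingHom.id _ := by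
    apply IsLocalization.ringHom_ext (Submonoid.powers P)
    ext f
    simp [awayDualLift_algebraMap, fst_awayDual]
  exact RingHom.congr_fun h f

/-- The extension of a derivation of `R` to the localization `R[1/P]`. -/
noncomputable def awayDer (D : Derivation K R R) (P : R) :
    Derivation K (Localization.Away P) (Localization.Away P) :=
  Derivation.mk'
    { toFun := fun f => (awayDualLift D P f).snd
      map_add' := by
        intro f g
        simp
      map_smul' := by
        intro c f
        rw [Algebra.smul_def, map_mul, TrivSqZeroExt.snd_mul, fst_awayDualLift, fst_awayDualLift,
          IsScalarTower.algebraMap_apply K R (Localization.Away P), awayDualLift_algebraMap]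
        simp [snd_awayDual, Algebra.smul_def,
          IsScalarTower.algebraMap_apply K R (Localization.Away P)] }
    (by
      intro f g
      change (awayDualLift D P (f * g)).snd = f • (awayDualLift D P g).snd +
        g • (awayDualLift D P f).snd
      rw [map_mul, TrivSqZeroExt.snd_mul, fst_awayDualLift, fst_awayDualLift]
      simp [mul_comm])

theorem awayDer_algebraMap (D : Derivation K R R) (P f : R) :
    awayDer D P (algebraMap R (Localization.Away P) f) =
      algebraMap R (Localization.Away P) (D f) := by
  change (awayDualLift D P _).snd = _
  rw [awayDualLift_algebraMap, snd_awayDual]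

/-- The homomorphism `R[1/P] → S[1/Q]` induced by `φ : R → S` when `φ P` divides `Q`. -/
noncomputable def awayHom {S : Type*} [CommRing S] [Algebra K S] (φ : R →ₐ[K] S) (P : R) (Q : S)
    (h : φ P ∣ Q) : Localization.Away P →ₐ[K] Localization.Away Q :=
  IsLocalization.Away.liftAlgHom P (A := K) (S := Localization.Away P)
    (f := (IsScalarTower.toAlgHom K S (Localization.Away Q)).comp φ)
    (isUnit_of_dvd_unit (map_dvd (algebraMap S (Localization.Away Q)) h)
      (IsLocalization.Away.algebraMap_isUnit Q))

end Localizations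

section RMatrices

open LieBialgebra

variable {K : Type*} [Field K] [CharZero K]

section Tensors

variable (K) (𝔤 : Type*) [LieRing 𝔤] [LieAlgebra K 𝔤]

/-- The bracket as a map `𝔤 ⊗ 𝔤 → 𝔤`. -/
noncomputable def bracketMap : 𝔤 ⊗[K] 𝔤 →ₗ[K] 𝔤 :=
  TensorProduct.lift (LieModule.toEnd K 𝔤 𝔤 : 𝔤 →ₗ[K] 𝔤 →ₗ[K] 𝔤)

/-- `(s, t) ↦ [s^{1,2}, t^{1,3}]`, i.e. `(x ⊗ y, x' ⊗ y') ↦ [x, x'] ⊗ y ⊗ y'`. -/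
noncomputable def lie₁₂₁₃ : 𝔤 ⊗[K] 𝔤 →ₗ[K] 𝔤 ⊗[K] 𝔤 →ₗ[K] (𝔤 ⊗[K] 𝔤) ⊗[K] 𝔤 :=
  (TensorProduct.map₂ (LieModule.toEnd K 𝔤 𝔤 : 𝔤 →ₗ[K] 𝔤 →ₗ[K] 𝔤)
    (TensorProduct.mk K 𝔤 𝔤)).compr₂ (TensorProduct.assoc K 𝔤 𝔤 𝔤).symm.toLinearMap

/-- `(s, t) ↦ [s^{1,2}, t^{2,3}]`, i.e. `(x ⊗ y, x' ⊗ y') ↦ x ⊗ [y, x'] ⊗ y'`. -/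
noncomputable def lie₁₂₂₃ : 𝔤 ⊗[K] 𝔤 →ₗ[K] 𝔤 ⊗[K] 𝔤 →ₗ[K] (𝔤 ⊗[K] 𝔤) ⊗[K] 𝔤 :=
  (TensorProduct.mk K (𝔤 ⊗[K] 𝔤) (𝔤 ⊗[K] 𝔤)).compr₂
    (((bracketMap K 𝔤).lTensor 𝔤 ∘ₗ (TensorProduct.assoc K 𝔤 𝔤 𝔤).toLinearMap).rTensor 𝔤 ∘ₗ
      (TensorProduct.assoc K (𝔤 ⊗[K] 𝔤) 𝔤 𝔤).symm.toLinearMap)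

/-- `(s, t) ↦ [s^{1,3}, t^{2,3}]`, i.e. `(x ⊗ y, x' ⊗ y') ↦ x ⊗ x' ⊗ [y, y']`. -/
noncomputable def lie₁₃₂₃ : 𝔤 ⊗[K] 𝔤 →ₗ[K] 𝔤 ⊗[K] 𝔤 →ₗ[K] (𝔤 ⊗[K] 𝔤) ⊗[K] 𝔤 :=
  TensorProduct.map₂ (TensorProduct.mk K 𝔤 𝔤)
    (LieModule.toEnd K 𝔤 𝔤 : 𝔤 →ₗ[K] 𝔤 →ₗ[K] 𝔤)

variable {K 𝔤}

@[simp] theorem lie₁₂₁₃_tmul (x y x' y' : 𝔤) :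
    lie₁₂₁₃ K 𝔤 (x ⊗ₜ[K] y) (x' ⊗ₜ[K] y') = (⁅x, x'⁆ ⊗ₜ[K] y) ⊗ₜ[K] y' := rfl

@[simp] theorem lie₁₂₂₃_tmul (x y x' y' : 𝔤) :
    lie₁₂₂₃ K 𝔤 (x ⊗ₜ[K] y) (x' ⊗ₜ[K] y') = (x ⊗ₜ[K] ⁅y, x'⁆) ⊗ₜ[K] y' := rfl

@[simp] theorem lie₁₃₂₃_tmul (x y x' y' : 𝔤) :
    lie₁₃₂₃ K 𝔤 (x ⊗ₜ[K] y) (x' ⊗ₜ[K] y') = (x ⊗ₜ[K] x') ⊗ₜ[K] ⁅y, y'⁆ := rfl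

/-- `CYB(ρ) = [ρ^{1,2}, ρ^{1,3}] + [ρ^{1,2}, ρ^{2,3}] + [ρ^{1,3}, ρ^{2,3}]` for
`ρ ∈ 𝔤 ⊗ 𝔤 ⊗ A`, with `A` a commutative algebra. -/
noncomputable def CYB {A : Type*} [CommRing A] [Algebra K A] (ρ : (𝔤 ⊗[K] 𝔤) ⊗[K] A) :
    ((𝔤 ⊗[K] 𝔤) ⊗[K] 𝔤) ⊗[K] A :=
  TensorProduct.map₂ (lie₁₂₁₃ K 𝔤 + lie₁₂₂₃ K 𝔤 + lie₁₃₂₃ K 𝔤) (LinearMap.mul K A) ρ ρ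

/-- `a ⊗ b ⊗ f ↦ a ⊗ b ⊗ e ⊗ D f`. -/
noncomputable def insertThird {A : Type*} [CommRing A] [Algebra K A] (e : 𝔤) (D : A →ₗ[K] A) :
    (𝔤 ⊗[K] 𝔤) ⊗[K] A →ₗ[K] ((𝔤 ⊗[K] 𝔤) ⊗[K] 𝔤) ⊗[K] A :=
  TensorProduct.map ((TensorProduct.mk K (𝔤 ⊗[K] 𝔤) 𝔤).flip e) D

/-- `Z ∈ ∧³(𝔤)^𝔤`: a totally antisymmetric tensor that is invariant under `𝔤`. -/
structure IsInvariantTrivector (Z : (𝔤 ⊗[K] 𝔤) ⊗[K] 𝔤) : Prop where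
  antisymm : (TensorProduct.comm K 𝔤 𝔤).toLinearMap.rTensor 𝔤 Z = -Z
  cyclic : cyc K 𝔤 Z = Z
  invariant : ∀ x : 𝔤, ⁅x, Z⁆ = 0

end Tensors

/-- An inclusion of Lie bialgebras. -/
structure IsLieBialgebraInclusion {𝔥 𝔤 : Type*} [LieRing 𝔥] [LieAlgebra K 𝔥] [LieBialgebra K 𝔥]
    [LieRing 𝔤] [LieAlgebra K 𝔤] [LieBialgebra K 𝔤] (j : 𝔥 →ₗ⁅K⁆ 𝔤) : Prop where
  injective : Function.Injective j
  map_δ : ∀ x, δ (K := K) (j x) =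
    TensorProduct.map (j : 𝔥 →ₗ[K] 𝔤) (j : 𝔥 →ₗ[K] 𝔤) (δ (K := K) x)

section Dynamical

variable {𝔥 𝔤 : Type*} [LieRing 𝔥] [LieAlgebra K 𝔥] [LieBialgebra K 𝔥] [FiniteDimensional K 𝔥]
  [LieRing 𝔤] [LieAlgebra K 𝔤] [LieBialgebra K 𝔤]

/-- `d^L : 𝔤 ⊗ 𝔤 ⊗ K[[H*]][1/P] → 𝔤 ⊗ 𝔤 ⊗ 𝔤 ⊗ K[[H*]][1/P]`,
`d^L(a ⊗ b ⊗ f) = -∑ᵢ a ⊗ b ⊗ j(eᵢ) ⊗ L_{εⁱ} f` for dual bases `eᵢ`, `εⁱ` of `𝔥`, `𝔥*`. -/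
noncomputable def dL (j : 𝔥 →ₗ⁅K⁆ 𝔤) (P : FormalFun K 𝔥)
    (ρ : (𝔤 ⊗[K] 𝔤) ⊗[K] Localization.Away P) :
    ((𝔤 ⊗[K] 𝔤) ⊗[K] 𝔤) ⊗[K] Localization.Away P :=
  -∑ i, insertThird (j (Module.finBasis K 𝔥 i))
    (awayDer (FormalFun.leftDer ((Module.finBasis K 𝔥).coord i)) P :
      Localization.Away P →ₗ[K] Localization.Away P) ρ

/-- `ρ ∈ ∧²(𝔤) ⊗ K[[H*]][1/P]` is a Poisson-Lie dynamical `r`-matrix for `(H*, 𝔤, Z)`, where `H*`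
is the formal group of `𝔥*` and `j : 𝔥 → 𝔤` is the inclusion of a Lie subbialgebra. -/
structure IsPLDynamicalRMatrix (j : 𝔥 →ₗ⁅K⁆ 𝔤) (Z : (𝔤 ⊗[K] 𝔤) ⊗[K] 𝔤) (P : FormalFun K 𝔥)
    (ρ : (𝔤 ⊗[K] 𝔤) ⊗[K] Localization.Away P) : Prop where
  denominator_ne_zero : P ≠ 0
  antisymm : (TensorProduct.comm K 𝔤 𝔤).toLinearMap.rTensor (Localization.Away P) ρ = -ρ
  /-- `dress_a(ρ) + [a ⊗ 1 + 1 ⊗ a, ρ] = 0`. -/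
  equivariant : ∀ a : 𝔥,
    (awayDer (FormalFun.dress (Double.inl K 𝔥 a)) P :
        Localization.Away P →ₗ[K] Localization.Away P).lTensor (𝔤 ⊗[K] 𝔤) ρ +
      (LieModule.toEnd K 𝔤 (𝔤 ⊗[K] 𝔤) (j a)).rTensor (Localization.Away P) ρ = 0
  /-- `CYB(ρ) + Alt(d^L ρ) + Alt((δ ⊗ id) ρ) = Z`. -/
  dynamical_yang_baxter :
    CYB ρ + (Alt K 𝔤).rTensor (Localization.Away P) (dL j P ρ) +
      (Alt K 𝔤 ∘ₗ (δ (K := K)).rTensor 𝔤).rTensor (Localization.Away P) ρ =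
        Z ⊗ₜ[K] (1 : Localization.Away P)

end Dynamical

section Splitting

variable {𝔩 𝔤 : Type*} [LieRing 𝔩] [LieAlgebra K 𝔩] [LieBialgebra K 𝔩]
  [LieRing 𝔤] [LieAlgebra K 𝔤] [LieBialgebra K 𝔤]

/-- A Lie bialgebra with a splitting `𝔤 = 𝔩 ⊕ 𝔲`, where `i : 𝔩 → 𝔤` is the inclusion of a Lie
subbialgebra. -/
structure IsSplitting (i : 𝔩 →ₗ⁅K⁆ 𝔤) (𝔲 : Submodule K 𝔤) : Prop where
  inclusion : IsLieBialgebraInclusion i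
  isCompl : IsCompl (LinearMap.range (i : 𝔩 →ₗ[K] 𝔤)) 𝔲
  lie_mem : ∀ x : 𝔩, ∀ v ∈ 𝔲, ⁅i x, v⁆ ∈ 𝔲
  δ_mem : ∀ v ∈ 𝔲, δ (K := K) v ∈
    LinearMap.range (TensorProduct.mapIncl (LinearMap.range (i : 𝔩 →ₗ[K] 𝔤)) 𝔲) ⊔
      LinearMap.range (TensorProduct.mapIncl 𝔲 (LinearMap.range (i : 𝔩 →ₗ[K] 𝔤))) ⊔
        LinearMap.range (TensorProduct.mapIncl 𝔲 𝔲)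

namespace IsSplitting

variable {i : 𝔩 →ₗ⁅K⁆ 𝔤} {𝔲 : Submodule K 𝔤} (h : IsSplitting i 𝔲)

/-- The projection `𝔤 → 𝔩` parallel to `𝔲`. -/
noncomputable def proj : 𝔤 →ₗ[K] 𝔩 :=
  LinearMap.linearProjOfIsCompl 𝔲 (i : 𝔩 →ₗ[K] 𝔤) h.inclusion.injective h.isCompl

theorem proj_incl (x : 𝔩) : h.proj (i x) = x :=
  LinearMap.linearProjOfIsCompl_apply_left 𝔲 (i : 𝔩 →ₗ[K] 𝔤) h.inclusion.injective h.isCompl x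

theorem proj_of_mem {v : 𝔤} (hv : v ∈ 𝔲) : h.proj v = 0 :=
  LinearMap.linearProjOfIsCompl_apply_right' 𝔲 (i : 𝔩 →ₗ[K] 𝔤) h.inclusion.injective h.isCompl v hv

theorem pair_proj_eq_zero (ξ η : Module.Dual K 𝔩) {v : 𝔤} (hv : v ∈ 𝔲) :
    pair (ξ ∘ₗ h.proj) (η ∘ₗ h.proj) (δ (K := K) v) = 0 := by
  have key : ∀ (p q : Submodule K 𝔤), p = 𝔲 ∨ q = 𝔲 →
      LinearMap.range (TensorProduct.mapIncl p q) ≤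
        LinearMap.ker (pair (ξ ∘ₗ h.proj) (η ∘ₗ h.proj)) := by
    rintro p q hpq _ ⟨t, rfl⟩
    rw [LinearMap.mem_ker]
    induction t with
    | zero => simp
    | tmul a b =>
      rcases hpq with rfl | rfl
      · simp [TensorProduct.mapIncl, h.proj_of_mem a.2]
      · simp [TensorProduct.mapIncl, h.proj_of_mem b.2]
    | add s t hs ht => simp [hs, ht]
  exact (sup_le (sup_le (key _ _ (.inr rfl)) (key _ _ (.inl rfl))) (key _ _ (.inl rfl)))
    (h.δ_mem v hv)

theorem pair_proj_incl (ξ η : Module.Dual K 𝔩) (t : 𝔩 ⊗[K] 𝔩) :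
    pair (ξ ∘ₗ h.proj) (η ∘ₗ h.proj)
      (TensorProduct.map (i : 𝔩 →ₗ[K] 𝔤) (i : 𝔩 →ₗ[K] 𝔤) t) = pair ξ η t := by
  induction t with
  | zero => simp
  | tmul a b => simp [h.proj_incl]
  | add s t hs ht => simp [hs, ht]

/-- The inclusion of Lie algebras `𝔩* → 𝔤*`: extension of linear forms by zero on `𝔲`. -/
noncomputable def dualIncl : Module.Dual K 𝔩 →ₗ⁅K⁆ Module.Dual K 𝔤 where
  toFun ξ := ξ ∘ₗ h.proj
  map_add' ξ η := LinearMap.add_comp _ _ _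
  map_smul' c ξ := LinearMap.smul_comp _ _ _
  map_lie' := by
    intro ξ η
    ext x
    obtain ⟨_, ⟨a, rfl⟩, v, hv, rfl⟩ :=
      Submodule.mem_sup.mp (h.isCompl.sup_eq_top ▸ Submodule.mem_top : x ∈ _ ⊔ 𝔲)
    change ⁅ξ, η⁆ (h.proj (i a + v)) =
      pair (ξ ∘ₗ h.proj) (η ∘ₗ h.proj) (δ (K := K) (i a + v))
    rw [map_add, map_add, map_add, h.proj_incl, h.proj_of_mem hv, map_add, map_zero, add_zero,
      h.pair_proj_eq_zero ξ η hv, add_zero, h.inclusion.map_δ, h.pair_proj_incl]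
    rfl

/-- The restriction `K[[G*]] → K[[L*]]`. -/
noncomputable def res : FormalFun K 𝔤 →ₐ[K] FormalFun K 𝔩 := FormalFun.comap h.dualIncl

/-- The form `ω₀(ξ)(u, v) = ξ([u, v]_𝔩)` on `𝔲`, for `ξ ∈ 𝔩*`. -/
noncomputable def omegaZero (ξ : Module.Dual K 𝔩) : LinearMap.BilinForm K 𝔲 :=
  ((LieModule.toEnd K 𝔤 𝔤 : 𝔤 →ₗ[K] 𝔤 →ₗ[K] 𝔤).compr₂ (ξ ∘ₗ h.proj)).domRestrict₁₂ 𝔲 𝔲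

theorem omegaZero_apply (ξ : Module.Dual K 𝔩) (u v : 𝔲) :
    h.omegaZero ξ u v = ξ (h.proj ⁅(u : 𝔤), (v : 𝔤)⁆) := rfl

/-- The splitting is nondegenerate: `ω₀(ξ)` is nondegenerate for generic `ξ ∈ 𝔩*`. As the
determinant of `ω₀(ξ)` is polynomial in `ξ` and `K` is infinite, this holds on a nonempty Zariski
open set as soon as it holds for one `ξ`. -/
def Nondegenerate : Prop := ∃ ξ : Module.Dual K 𝔩, (h.omegaZero ξ).Nondegenerate

variable [FiniteDimensional K 𝔤]

/-- The matrix over `K[[L*]]` of the form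
`ω_x(u, v) = ⟨(Ad(x⁻¹) u)_𝔤, (Ad(x⁻¹) v)_{𝔤*}⟩`, `x ∈ L*`, in a basis of `𝔲`. -/
noncomputable def omegaMatrix :
    Matrix (Fin (Module.finrank K 𝔲)) (Fin (Module.finrank K 𝔲)) (FormalFun K 𝔩) :=
  Matrix.of fun s t => h.res (FormalFun.omega
    (Double.inl K 𝔤 (Module.finBasis K 𝔲 s : 𝔤)) (Double.inl K 𝔤 (Module.finBasis K 𝔲 t : 𝔤)))

/-- The function `P_𝔩^𝔤 ∈ K[[L*]]`, the determinant of `ω_x`. -/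
noncomputable def detP : FormalFun K 𝔩 := h.omegaMatrix.det

/-- The coefficients `s_{kl}` of `σ_𝔩^𝔤 = ∑ s_{kl} u_k ⊗ u_l` in `K[[L*]][1/P_𝔩^𝔤]`: the inverse of
the transposed matrix of `ω_x`, so that `∑ s_{kl} ω_x(v, u_l) u_k = v` for all `v ∈ 𝔲`. -/
noncomputable def sigmaMatrix :
    Matrix (Fin (Module.finrank K 𝔲)) (Fin (Module.finrank K 𝔲)) (Localization.Away h.detP) :=
  ((h.omegaMatrix.map (algebraMap (FormalFun K 𝔩) (Localization.Away h.detP))).transpose)⁻¹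

/-- The element `σ_𝔩^𝔤 = ω⁻¹` of `∧²(𝔲) ⊗ K[[L*]][1/P_𝔩^𝔤]`, viewed in
`𝔤 ⊗ 𝔤 ⊗ K[[L*]][1/P_𝔩^𝔤]`. -/
noncomputable def sigma : (𝔤 ⊗[K] 𝔤) ⊗[K] Localization.Away h.detP :=
  ∑ s, ∑ t, ((Module.finBasis K 𝔲 s : 𝔤) ⊗ₜ[K] (Module.finBasis K 𝔲 t : 𝔤)) ⊗ₜ[K]
    h.sigmaMatrix s t

variable {𝔞 : Type*} [LieRing 𝔞] [LieAlgebra K 𝔞] [LieBialgebra K 𝔞]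

/-- The restriction `ρ_{|L*}` of `ρ ∈ 𝔞 ⊗ 𝔞 ⊗ K[[G*]][1/P]`, with values in
`𝔞 ⊗ 𝔞 ⊗ K[[L*]][1/(P_{|L*} P_𝔩^𝔤)]`. -/
noncomputable def restrict (P : FormalFun K 𝔤) :
    (𝔞 ⊗[K] 𝔞) ⊗[K] Localization.Away P →ₗ[K]
      (𝔞 ⊗[K] 𝔞) ⊗[K] Localization.Away (h.res P * h.detP) :=
  (awayHom h.res P (h.res P * h.detP) (dvd_mul_right _ _)).toLinearMap.lTensor (𝔞 ⊗[K] 𝔞)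

/-- The image of `σ_𝔩^𝔤` in `𝔞 ⊗ 𝔞 ⊗ K[[L*]][1/(P_{|L*} P_𝔩^𝔤)]`, for `j : 𝔤 → 𝔞`. -/
noncomputable def sigmaIn (j : 𝔤 →ₗ⁅K⁆ 𝔞) (P : FormalFun K 𝔤) :
    (𝔞 ⊗[K] 𝔞) ⊗[K] Localization.Away (h.res P * h.detP) :=
  TensorProduct.map (TensorProduct.map (j : 𝔤 →ₗ[K] 𝔞) (j : 𝔤 →ₗ[K] 𝔞))
    (awayHom (AlgHom.id K _) h.detP (h.res P * h.detP) (dvd_mul_left _ _)).toLinearMap h.sigma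

end IsSplitting

end Splitting

end RMatrices

/-!
A function on a formal group is determined by its value at `1` and its derivatives along left
translations, so a system of functions which vanish at `1` and which the left translations send to
combinations of one another vanishes. This gives the identities for `ω`: it is skew-symmetric on
`𝔤`, it satisfies a cyclic identity, it vanishes on `L*` when one argument lies in `𝔩` and the other
in `𝔲`, and the dressing action of `a` is the left translation along the form `ω(-, a)`.
Restriction to the lines `exp(tξ)` shows that `K[[L*]]` is a domain and that `det ω ≠ 0`, because
the leading coefficient of `det ω` along such a line is `det ω₀(ξ)`.

The element `σ = ω⁻¹` converts the form `ω(-, u)`, `u ∈ 𝔲`, into the vector `u` and kills the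
extensions by zero of the forms on `𝔩`. These forms separate tensors, so the dynamical Yang-Baxter
equation for `σ` may be tested on them, where it is the cyclic identity for `ω`. In `ρ_{|L*} + σ`
the cross terms are brackets of `ρ` with `𝔲`; the equivariance of `ρ` under `𝔲` turns them into left
translations of `ρ` transverse to `L*`, which are exactly those by which the restriction of `d^L ρ`
differs from `d^L(ρ_{|L*})`.
-/

section EnvelopeInduction

attribute [local instance] LieRing.ofAssociativeRing

namespace UEnv

variable {K : Type*} [Field K] {L : Type*} [LieRing L] [LieAlgebra K L]

theorem adjoin_range_ι :
    Algebra.adjoin K (Set.range (UniversalEnvelopingAlgebra.ι K (L := L))) = ⊤ := by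
  let S := Algebra.adjoin K (Set.range (UniversalEnvelopingAlgebra.ι K (L := L)))
  let toAdjoin : L →ₗ⁅K⁆ S :=
    { toFun := fun x => ⟨UniversalEnvelopingAlgebra.ι K x, Algebra.subset_adjoin ⟨x, rfl⟩⟩
      map_add' := fun x y => Subtype.ext (map_add _ x y)
      map_smul' := fun c x => Subtype.ext (map_smul _ c x)
      map_lie' := fun {x y} => Subtype.ext ((UniversalEnvelopingAlgebra.ι K).map_lie x y) }
  have retract : S.val.comp (UniversalEnvelopingAlgebra.lift K toAdjoin) = AlgHom.id K _ :=
    algHom_ext fun x => congrArg S.val (UniversalEnvelopingAlgebra.lift_ι_apply K toAdjoin x)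
  refine eq_top_iff.2 fun y _ => ?_
  rw [← AlgHom.id_apply (R := K) y, ← retract]
  exact (UniversalEnvelopingAlgebra.lift K toAdjoin y).2

theorem mem_of_ι_mul_mem (W : Submodule K (UniversalEnvelopingAlgebra K L)) (one_mem : 1 ∈ W)
    (ι_mul_mem : ∀ x : L, ∀ y ∈ W, UniversalEnvelopingAlgebra.ι K x * y ∈ W)
    (y : UniversalEnvelopingAlgebra K L) : y ∈ W := by
  have mul_mem : ∀ a ∈ Algebra.adjoin K (Set.range (UniversalEnvelopingAlgebra.ι K (L := L))),
      ∀ y ∈ W, a * y ∈ W := by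
    intro a ha
    induction ha using Algebra.adjoin_induction with
    | mem a ha =>
      obtain ⟨x, rfl⟩ := ha
      exact ι_mul_mem x
    | algebraMap c => exact fun y hy => Algebra.smul_def c y ▸ W.smul_mem c hy
    | add a b _ _ ha hb => exact fun y hy => (add_mul a b y).symm ▸ W.add_mem (ha y hy) (hb y hy)
    | mul a b _ _ ha hb => exact fun y hy => (mul_assoc a b y).symm ▸ ha _ (hb y hy)
  simpa using mul_mem y (by rw [adjoin_range_ι]; exact Algebra.mem_top) 1 one_mem

end UEnv

end EnvelopeInduction

section Bases

variable {R V W X ι κ : Type*} [CommRing R] [AddCommGroup V] [Module R V] [AddCommGroup W]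
  [Module R W] [AddCommGroup X] [Module R X] [Fintype ι] [Fintype κ]

theorem sum_map_basis_coord (b : Module.Basis ι R V) (c : Module.Basis κ R W) (T : V →ₗ[R] W)
    (B : W →ₗ[R] Module.Dual R V →ₗ[R] X) :
    ∑ s, B (T (b s)) (b.coord s) = ∑ t, B (c t) (c.coord t ∘ₗ T) := by
  calc ∑ s, B (T (b s)) (b.coord s)
      = ∑ s, ∑ t, c.coord t (T (b s)) • B (c t) (b.coord s) := by
        refine Finset.sum_congr rfl fun s _ => ?_
        conv_lhs => rw [← c.sum_repr (T (b s))]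
        simp only [map_sum, map_smul, LinearMap.sum_apply, LinearMap.smul_apply,
          Module.Basis.coord_apply]
    _ = ∑ t, B (c t) (∑ s, (c.coord t ∘ₗ T) (b s) • b.coord s) := by
        rw [Finset.sum_comm]
        simp
    _ = ∑ t, B (c t) (c.coord t ∘ₗ T) := by
        simp only [Module.Basis.sum_dual_apply_smul_coord]

theorem sum_coord_smul_map_basis (b : Module.Basis ι R V) (φ : V →ₗ[R] X) (z : V) :
    ∑ s, b.coord s z • φ (b s) = φ z := by
  conv_rhs => rw [← b.sum_repr z, map_sum]
  simp

end Bases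

section PairInto

variable {K V W A : Type*} [CommRing K] [AddCommGroup V] [Module K V] [AddCommGroup W]
  [Module K W] [CommRing A] [Algebra K A]

/-- The map `V ⊗ W → A`, `x ⊗ y ↦ φ(x) ψ(y)`, as a bilinear function of the `A`-valued linear
forms `φ` and `ψ`. For `A = K` it is the pairing of `ξ ⊗ η` with `V ⊗ V`. -/
noncomputable def pairInto : (V →ₗ[K] A) →ₗ[K] (W →ₗ[K] A) →ₗ[K] V ⊗[K] W →ₗ[K] A :=
  (TensorProduct.mapBilinear (RingHom.id K) V W A A).compr₂ ((LinearMap.mul' K A).compRight K)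

@[simp]
theorem pairInto_tmul (φ : V →ₗ[K] A) (ψ : W →ₗ[K] A) (x : V) (y : W) :
    pairInto φ ψ (x ⊗ₜ[K] y) = φ x * ψ y := rfl

theorem pairInto_comm (φ : V →ₗ[K] A) (ψ : W →ₗ[K] A) (t : W ⊗[K] V) :
    pairInto φ ψ (TensorProduct.comm K W V t) = pairInto ψ φ t := by
  induction t with
  | zero => simp
  | tmul x y => simp [mul_comm]
  | add s t hs ht => simp [hs, ht]

theorem pairInto_comp_left (φ : V →ₗ[K] A) (ψ : W →ₗ[K] A) (T : V →ₗ[K] V) :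
    pairInto (φ ∘ₗ T) ψ = pairInto φ ψ ∘ₗ T.rTensor W :=
  TensorProduct.ext' fun _ _ => rfl

theorem pairInto_comp_right (φ : V →ₗ[K] A) (ψ : W →ₗ[K] A) (T : W →ₗ[K] W) :
    pairInto φ (ψ ∘ₗ T) = pairInto φ ψ ∘ₗ T.lTensor V :=
  TensorProduct.ext' fun _ _ => rfl

theorem derivation_pairInto (D : Derivation K A A) (φ : V →ₗ[K] A) (ψ : W →ₗ[K] A)
    (t : V ⊗[K] W) :
    D (pairInto φ ψ t) =
      pairInto ((D : A →ₗ[K] A) ∘ₗ φ) ψ t + pairInto φ ((D : A →ₗ[K] A) ∘ₗ ψ) t := by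
  induction t with
  | zero => simp
  | tmul x y => simp [mul_comm, add_comm]
  | add s t hs ht =>
    simp only [map_add, hs, ht]
    abel

theorem map_pairInto {B : Type*} [CommRing B] [Algebra K B] (F : A →ₐ[K] B) (φ : V →ₗ[K] A)
    (ψ : W →ₗ[K] A) (t : V ⊗[K] W) :
    F (pairInto φ ψ t) = pairInto (F.toLinearMap ∘ₗ φ) (F.toLinearMap ∘ₗ ψ) t := by
  induction t with
  | zero => simp
  | tmul x y => simp
  | add s t hs ht => simp only [map_add, hs, ht]

theorem eq_zero_of_pairInto_eq_zero {K V W : Type*} [Field K] [AddCommGroup V] [Module K V]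
    [AddCommGroup W] [Module K W] (t : V ⊗[K] W)
    (h : ∀ (ξ : Module.Dual K V) (η : Module.Dual K W), pairInto ξ η t = 0) : t = 0 := by
  let b := Module.Basis.ofVectorSpace K V
  let c := Module.Basis.ofVectorSpace K W
  have repr_eq : ∀ s r (t : V ⊗[K] W),
      (b.tensorProduct c).repr t (s, r) = pairInto (b.coord s) (c.coord r) t := by
    intro s r t
    induction t with
    | zero => simp
    | tmul x y => simp [mul_comm]
    | add s t hs ht => simp [hs, ht]
  refine (b.tensorProduct c).ext_elem fun p => ?_
  rw [repr_eq, h, map_zero, Finsupp.zero_apply]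

end PairInto

namespace LieBialgebra

variable {K : Type*} [Field K] {𝔥 : Type*} [LieRing 𝔥] [LieAlgebra K 𝔥]

theorem pair_eq_pairInto (ξ η : Module.Dual K 𝔥) : pair ξ η = pairInto ξ η := rfl

theorem sum_mul_contract {A ι : Type*} [CommRing A] [Algebra K A] [Fintype ι]
    (b : Module.Basis ι K 𝔥) (φ ψ : 𝔥 →ₗ[K] A) (t : 𝔥 ⊗[K] 𝔥) :
    ∑ s, φ (b s) * ψ (contract (b.coord s) t) = pairInto φ ψ t := by
  induction t with
  | zero => simp
  | tmul x y =>
    rw [pairInto_tmul, ← sum_coord_smul_map_basis b φ x, Finset.sum_mul]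
    exact Finset.sum_congr rfl fun s _ => by simp [contract]
  | add s t hs ht => simp only [map_add, mul_add, Finset.sum_add_distrib, hs, ht]

namespace Double

variable (K 𝔥) in
/-- The canonical symmetric pairing `⟨x + ξ, y + η⟩ = η(x) + ξ(y)` of the double. -/
noncomputable def pairing : Double K 𝔥 →ₗ[K] Double K 𝔥 →ₗ[K] K :=
  (Module.Dual.eval K 𝔥 ∘ₗ fst K 𝔥).compl₂ (snd K 𝔥) +
    ((Module.Dual.eval K 𝔥 ∘ₗ fst K 𝔥).compl₂ (snd K 𝔥)).flip

theorem pairing_apply (a b : Double K 𝔥) :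
    pairing K 𝔥 a b = snd K 𝔥 b (fst K 𝔥 a) + snd K 𝔥 a (fst K 𝔥 b) := rfl

end Double

variable [LieBialgebra K 𝔥]

theorem pairInto_δ_swap {A : Type*} [CommRing A] [Algebra K A] (φ ψ : 𝔥 →ₗ[K] A) (x : 𝔥) :
    pairInto φ ψ (δ (K := K) x) = -pairInto ψ φ (δ (K := K) x) := by
  rw [← pairInto_comm, LieBialgebra.antisymm, map_neg]

/-- The operator `x ↦ (ξ ⊗ id)(δ x)` on `𝔥`, the transpose of `ad ξ` on `𝔥*`. -/
noncomputable def coact (ξ : Module.Dual K 𝔥) : 𝔥 →ₗ[K] 𝔥 := contract ξ ∘ₗ δ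

theorem coact_apply (ξ : Module.Dual K 𝔥) (x : 𝔥) : coact ξ x = contract ξ (δ (K := K) x) := rfl

variable [CharZero K]

theorem apply_contract_δ_swap (ξ η : Module.Dual K 𝔥) (x : 𝔥) :
    η (contract ξ (δ (K := K) x)) = -ξ (contract η (δ (K := K) x)) := by
  rw [apply_contract_δ, apply_contract_δ, ← lie_skew, LinearMap.neg_apply]

theorem comp_coact (ξ η : Module.Dual K 𝔥) : η ∘ₗ coact ξ = ⁅ξ, η⁆ :=
  LinearMap.ext fun x => apply_contract_δ ξ η x

theorem pair_rTensor_coact (ξ η ζ : Module.Dual K 𝔥) (t : 𝔥 ⊗[K] 𝔥) :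
    pair η ζ ((coact ξ).rTensor 𝔥 t) = pair ⁅ξ, η⁆ ζ t := by
  rw [pair_eq_pairInto, pair_eq_pairInto, ← comp_coact, pairInto_comp_left, LinearMap.comp_apply]

theorem pair_lTensor_coact (ξ η ζ : Module.Dual K 𝔥) (t : 𝔥 ⊗[K] 𝔥) :
    pair η ζ ((coact ξ).lTensor 𝔥 t) = pair η ⁅ξ, ζ⁆ t := by
  rw [pair_eq_pairInto, pair_eq_pairInto, ← comp_coact, pairInto_comp_right, LinearMap.comp_apply]

theorem δ_coact (ξ : Module.Dual K 𝔥) (x : 𝔥) :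
    δ (K := K) (coact ξ x) =
      (coact ξ).rTensor 𝔥 (δ (K := K) x) + (coact ξ).lTensor 𝔥 (δ (K := K) x) := by
  rw [← sub_eq_zero]
  refine eq_zero_of_pairInto_eq_zero _ fun η ζ => ?_
  rw [← pair_eq_pairInto, map_sub, map_add, pair_rTensor_coact, pair_lTensor_coact,
    ← dual_lie_apply, ← dual_lie_apply, ← dual_lie_apply, ← LinearMap.add_apply, ← leibniz_lie,
    ← comp_coact ξ ⁅η, ζ⁆, LinearMap.comp_apply, sub_self]

namespace Double

theorem inl_lie (a b : 𝔥) : Double.inl K 𝔥 ⁅a, b⁆ = ⁅Double.inl K 𝔥 a, Double.inl K 𝔥 b⁆ := by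
  ext1
  · simp [fst_lie, contract]
  · ext
    simp [snd_lie]

theorem inr_lie_inl (ξ : Module.Dual K 𝔥) (u : 𝔥) :
    ⁅inr K 𝔥 ξ, inl K 𝔥 u⁆ = inl K 𝔥 (-coact ξ u) + inr K 𝔥 (compAd u ξ) := by
  ext1
  · simp [fst_lie, contract, coact_apply]
  · simp only [snd_lie, map_add, snd_inr, snd_inl, fst_inr, fst_inl]
    ext
    simp

theorem fst_inr_lie (ξ : Module.Dual K 𝔥) (w : Double K 𝔥) :
    fst K 𝔥 ⁅inr K 𝔥 ξ, w⁆ = -coact ξ (fst K 𝔥 w) := by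
  simp [fst_lie, coact_apply]

theorem pairing_lie (a b c : Double K 𝔥) :
    pairing K 𝔥 ⁅a, b⁆ c = pairing K 𝔥 a ⁅b, c⁆ := by
  simp only [pairing_apply, fst_lie, snd_lie, map_add, map_sub, LinearMap.add_apply,
    LinearMap.sub_apply, compAd_apply]
  rw [apply_contract_δ_swap (snd K 𝔥 b) (snd K 𝔥 c), ← apply_contract_δ (snd K 𝔥 a) (snd K 𝔥 b),
    ← apply_contract_δ (snd K 𝔥 b) (snd K 𝔥 c),
    apply_contract_δ_swap (snd K 𝔥 b) (snd K 𝔥 a), apply_contract_δ_swap (snd K 𝔥 c) (snd K 𝔥 a),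
    ← lie_skew (fst K 𝔥 b) (fst K 𝔥 a), ← lie_skew (fst K 𝔥 c) (fst K 𝔥 a), map_neg, map_neg,
    apply_contract_δ_swap (snd K 𝔥 c) (snd K 𝔥 b)]
  ring

theorem pairing_lie_add_pairing_lie (z a b : Double K 𝔥) :
    pairing K 𝔥 ⁅z, a⁆ b + pairing K 𝔥 a ⁅z, b⁆ = 0 := by
  rw [← pairing_lie, ← lie_skew a z, map_neg, LinearMap.neg_apply, add_neg_cancel]

theorem cyclic_snd_fst_lie (u v w : Double K 𝔥) :
    snd K 𝔥 w (fst K 𝔥 ⁅u, v⁆) + snd K 𝔥 u (fst K 𝔥 ⁅v, w⁆) + snd K 𝔥 v (fst K 𝔥 ⁅w, u⁆) =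
      snd K 𝔥 v (contract (snd K 𝔥 u) (δ (K := K) (fst K 𝔥 w))) +
        snd K 𝔥 w (contract (snd K 𝔥 v) (δ (K := K) (fst K 𝔥 u))) +
        snd K 𝔥 u (contract (snd K 𝔥 w) (δ (K := K) (fst K 𝔥 v))) + pairing K 𝔥 ⁅u, v⁆ w := by
  simp only [pairing_apply, fst_lie, snd_lie, map_add, map_sub, LinearMap.add_apply,
    LinearMap.sub_apply, compAd_apply, ← apply_contract_δ]
  rw [← lie_skew (fst K 𝔥 w) (fst K 𝔥 u), map_neg,
    apply_contract_δ_swap (snd K 𝔥 u) (snd K 𝔥 w),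
    apply_contract_δ_swap (snd K 𝔥 v) (snd K 𝔥 u),
    apply_contract_δ_swap (snd K 𝔥 w) (snd K 𝔥 v)]
  ring

end Double

end LieBialgebra

section FormalFunctions

attribute [local instance] LieRing.ofAssociativeRing

open LieBialgebra

namespace FormalFun

variable {K : Type*} [Field K] [CharZero K] {𝔥 : Type*} [LieRing 𝔥] [LieAlgebra K 𝔥]
  [LieBialgebra K 𝔥]

theorem eval_sub (f g : FormalFun K 𝔥) : (f - g).eval = f.eval - g.eval := rfl

variable (K 𝔥) in
/-- The evaluation of functions at the neutral element of `H*`. -/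
noncomputable def evalOne : FormalFun K 𝔥 →ₐ[K] K where
  toFun f := f.eval 1
  map_one' := by rw [eval_one, Bialgebra.counit_one]
  map_mul' f g := by
    rw [eval_mul, Bialgebra.comul_one, Algebra.TensorProduct.one_def]
    simp
  map_zero' := rfl
  map_add' _ _ := rfl
  commutes' c := by
    rw [eval_algebraMap, Bialgebra.counit_one, mul_one]
    rfl

theorem evalOne_apply (f : FormalFun K 𝔥) : evalOne K 𝔥 f = f.eval 1 := rfl

theorem evalOne_leftDer (ξ : Module.Dual K 𝔥) (f : FormalFun K 𝔥) :
    evalOne K 𝔥 (leftDer ξ f) = -f.eval (UniversalEnvelopingAlgebra.ι K ξ) := by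
  rw [evalOne_apply, leftDer_apply, mul_one]

theorem evalOne_rightDer (ξ : Module.Dual K 𝔥) (f : FormalFun K 𝔥) :
    evalOne K 𝔥 (rightDer ξ f) = f.eval (UniversalEnvelopingAlgebra.ι K ξ) := by
  rw [evalOne_apply, rightDer_apply, one_mul]

theorem eq_zero_of_mem_of_leftDer_mem (W : Submodule K (FormalFun K 𝔥))
    (h1 : ∀ f ∈ W, evalOne K 𝔥 f = 0) (hL : ∀ ξ, ∀ f ∈ W, leftDer ξ f ∈ W)
    {f : FormalFun K 𝔥} (hf : f ∈ W) : f = 0 := by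
  let annihilated : Submodule K (UniversalEnvelopingAlgebra K (Module.Dual K 𝔥)) :=
    ⨅ f ∈ W, LinearMap.ker f.eval
  have mem_annihilated : ∀ y, y ∈ annihilated := by
    refine UEnv.mem_of_ι_mul_mem annihilated ?_ fun ξ y hy => ?_
    · simp only [annihilated, Submodule.mem_iInf]
      exact h1
    · simp only [annihilated, Submodule.mem_iInf, LinearMap.mem_ker] at hy ⊢
      intro f hf
      simpa only [leftDer_apply, neg_eq_zero] using hy _ (hL ξ f hf)
  ext y
  have hy := mem_annihilated y
  simp only [annihilated, Submodule.mem_iInf] at hy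
  exact hy f hf

theorem eq_zero_of_leftDer_mem_span {X : Type*} (F : X → FormalFun K 𝔥)
    (h1 : ∀ x, evalOne K 𝔥 (F x) = 0)
    (hL : ∀ ξ x, leftDer ξ (F x) ∈ Submodule.span K (Set.range F)) (x : X) : F x = 0 := by
  have span_le_ker : Submodule.span K (Set.range F) ≤ LinearMap.ker (evalOne K 𝔥).toLinearMap :=
    Submodule.span_le.2 (Set.range_subset_iff.2 h1)
  have span_le_comap : ∀ ξ, Submodule.span K (Set.range F) ≤ (Submodule.span K (Set.range F)).comap
      ((leftDer ξ : Derivation K _ _) : FormalFun K 𝔥 →ₗ[K] FormalFun K 𝔥) :=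
    fun ξ => Submodule.span_le.2 (Set.range_subset_iff.2 fun x => Submodule.mem_comap.2 (hL ξ x))
  exact eq_zero_of_mem_of_leftDer_mem _ (fun f hf => span_le_ker hf)
    (fun ξ f hf => span_le_comap ξ hf) (Submodule.subset_span ⟨x, rfl⟩)

theorem eq_zero_of_leftDer_eq_add {X Y : Type*} (F : X → Y → FormalFun K 𝔥)
    (a : Module.Dual K 𝔥 → X → X) (b : Module.Dual K 𝔥 → Y → Y)
    (h1 : ∀ x y, evalOne K 𝔥 (F x y) = 0)
    (hL : ∀ ξ x y, leftDer ξ (F x y) = F (a ξ x) y + F x (b ξ y)) (x : X) (y : Y) :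
    F x y = 0 :=
  eq_zero_of_leftDer_mem_span (fun p : X × Y => F p.1 p.2) (fun p => h1 p.1 p.2)
    (fun ξ p => by
      rw [hL]
      exact add_mem (Submodule.subset_span ⟨(a ξ p.1, p.2), rfl⟩)
        (Submodule.subset_span ⟨(p.1, b ξ p.2), rfl⟩)) (x, y)

theorem eq_zero_of_leftDer_eq_add_add {X : Type*} (F : X → X → X → FormalFun K 𝔥)
    (a : Module.Dual K 𝔥 → X → X) (h1 : ∀ x y z, evalOne K 𝔥 (F x y z) = 0)
    (hL : ∀ ξ x y z, leftDer ξ (F x y z) = F (a ξ x) y z + F x (a ξ y) z + F x y (a ξ z))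
    (x y z : X) : F x y z = 0 :=
  eq_zero_of_leftDer_mem_span (fun p : X × X × X => F p.1 p.2.1 p.2.2) (fun _ => h1 _ _ _)
    (fun ξ p => by
      rw [hL]
      exact add_mem (add_mem (Submodule.subset_span ⟨(a ξ p.1, p.2.1, p.2.2), rfl⟩)
        (Submodule.subset_span ⟨(p.1, a ξ p.2.1, p.2.2), rfl⟩))
        (Submodule.subset_span ⟨(p.1, p.2.1, a ξ p.2.2), rfl⟩)) (x, y, z)

variable (K 𝔥) in
/-- The derivation `L_ξ`, as a bilinear function of `ξ` and of the function it acts on. -/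
noncomputable def leftDerBilin :
    Module.Dual K 𝔥 →ₗ[K] FormalFun K 𝔥 →ₗ[K] FormalFun K 𝔥 :=
  LinearMap.mk₂ K (fun ξ f => leftDer ξ f)
    (fun ξ η f => by
      ext y
      simp only [leftDer_apply, map_add, add_mul, eval_add, LinearMap.add_apply, neg_add])
    (fun c ξ f => by
      ext y
      simp only [leftDer_apply, map_smul, smul_mul_assoc, eval_smul, LinearMap.smul_apply,
        smul_neg])
    (fun ξ => map_add (leftDer ξ)) (fun c ξ f => (leftDer ξ).map_smul c f)

theorem leftDer_lie (ξ η : Module.Dual K 𝔥) (f : FormalFun K 𝔥) :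
    leftDer ⁅ξ, η⁆ f = leftDer ξ (leftDer η f) - leftDer η (leftDer ξ f) := by
  ext y
  simp only [leftDer_apply, LieHom.map_lie, LieRing.of_associative_ring_bracket, eval_sub,
    LinearMap.sub_apply, sub_mul, map_sub, mul_assoc]
  ring

theorem leftDer_rightDer (ξ η : Module.Dual K 𝔥) (f : FormalFun K 𝔥) :
    leftDer ξ (rightDer η f) = rightDer η (leftDer ξ f) := by
  ext y
  simp only [leftDer_apply, rightDer_apply, mul_assoc]

theorem eval_adInvCoeff (φ : Module.Dual K (Double K 𝔥)) (v : Double K 𝔥)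
    (y : UniversalEnvelopingAlgebra K (Module.Dual K 𝔥)) :
    (adInvCoeff φ v).eval y = φ ((adInv K 𝔥 y).unop v) := rfl

theorem adInv_ι (ξ : Module.Dual K 𝔥) (v : Double K 𝔥) :
    (adInv K 𝔥 (UniversalEnvelopingAlgebra.ι K ξ)).unop v = -⁅Double.inr K 𝔥 ξ, v⁆ := by
  rw [adInv, UniversalEnvelopingAlgebra.lift_ι_apply]
  rfl

theorem leftDer_adInvCoeff (ξ : Module.Dual K 𝔥) (φ : Module.Dual K (Double K 𝔥))
    (v : Double K 𝔥) :
    leftDer ξ (adInvCoeff φ v) = adInvCoeff φ ⁅Double.inr K 𝔥 ξ, v⁆ := by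
  ext y
  rw [leftDer_apply, eval_adInvCoeff, eval_adInvCoeff, map_mul, MulOpposite.unop_mul,
    Module.End.mul_apply, adInv_ι, map_neg, map_neg, neg_neg]

theorem evalOne_adInvCoeff (φ : Module.Dual K (Double K 𝔥)) (v : Double K 𝔥) :
    evalOne K 𝔥 (adInvCoeff φ v) = φ v := by
  rw [evalOne_apply, eval_adInvCoeff, map_one]
  rfl

theorem adInvCoeff_add (φ : Module.Dual K (Double K 𝔥)) (v w : Double K 𝔥) :
    adInvCoeff φ (v + w) = adInvCoeff φ v + adInvCoeff φ w := by
  ext y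
  simp [eval_adInvCoeff]

theorem adInvCoeff_smul (φ : Module.Dual K (Double K 𝔥)) (c : K) (v : Double K 𝔥) :
    adInvCoeff φ (c • v) = c • adInvCoeff φ v := by
  ext y
  simp [eval_adInvCoeff]

section Finite

variable [FiniteDimensional K 𝔥]

variable (K 𝔥) in
/-- The function-valued form `omega` on the double, as a bilinear map. -/
noncomputable def omegaDouble : Double K 𝔥 →ₗ[K] Double K 𝔥 →ₗ[K] FormalFun K 𝔥 :=
  LinearMap.mk₂ K omega
    (fun u u' v => by simp only [omega, adInvCoeff_add, add_mul, Finset.sum_add_distrib])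
    (fun c u v => by simp only [omega, adInvCoeff_smul, smul_mul_assoc, Finset.smul_sum])
    (fun u v v' => by simp only [omega, adInvCoeff_add, mul_add, Finset.sum_add_distrib])
    (fun c u v => by simp only [omega, adInvCoeff_smul, mul_smul_comm, Finset.smul_sum])

theorem omegaDouble_apply (u v : Double K 𝔥) : omegaDouble K 𝔥 u v = omega u v := rfl

theorem leftDer_omegaDouble (ξ : Module.Dual K 𝔥) (u v : Double K 𝔥) :
    leftDer ξ (omegaDouble K 𝔥 u v) = omegaDouble K 𝔥 ⁅Double.inr K 𝔥 ξ, u⁆ v +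
      omegaDouble K 𝔥 u ⁅Double.inr K 𝔥 ξ, v⁆ := by
  simp only [omegaDouble_apply, omega, map_sum, Derivation.leibniz, leftDer_adInvCoeff,
    smul_eq_mul, ← Finset.sum_add_distrib]
  refine Finset.sum_congr rfl fun s _ => ?_
  ring

theorem evalOne_omegaDouble (u v : Double K 𝔥) :
    evalOne K 𝔥 (omegaDouble K 𝔥 u v) = Double.snd K 𝔥 v (Double.fst K 𝔥 u) := by
  simp only [omegaDouble_apply, omega, map_sum, map_mul, evalOne_adInvCoeff]
  exact sum_coord_smul_map_basis (Module.finBasis K 𝔥) (Double.snd K 𝔥 v) (Double.fst K 𝔥 u)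

theorem omegaDouble_add_swap (u v : Double K 𝔥) :
    omegaDouble K 𝔥 u v + omegaDouble K 𝔥 v u =
      algebraMap K (FormalFun K 𝔥) (Double.pairing K 𝔥 u v) := by
  rw [← sub_eq_zero]
  refine eq_zero_of_leftDer_eq_add (fun u v => omegaDouble K 𝔥 u v + omegaDouble K 𝔥 v u -
      algebraMap K (FormalFun K 𝔥) (Double.pairing K 𝔥 u v))
    (fun ξ u => ⁅Double.inr K 𝔥 ξ, u⁆) (fun ξ u => ⁅Double.inr K 𝔥 ξ, u⁆) ?_ ?_ u v
  · intro u v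
    simp only [map_sub, map_add, evalOne_omegaDouble, AlgHom.commutes, Double.pairing_apply,
      Algebra.algebraMap_self, RingHom.id_apply]
    ring
  · intro ξ u v
    have invariance := congrArg (algebraMap K (FormalFun K 𝔥))
      (Double.pairing_lie_add_pairing_lie (Double.inr K 𝔥 ξ) u v)
    rw [map_add, map_zero] at invariance
    simp only [map_sub, map_add, leftDer_omegaDouble, Derivation.map_algebraMap]
    linear_combination invariance

theorem omegaDouble_inr_left (ξ : Module.Dual K 𝔥) (v : Double K 𝔥) :
    omegaDouble K 𝔥 (Double.inr K 𝔥 ξ) v = 0 := by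
  refine eq_zero_of_leftDer_eq_add (fun ξ v => omegaDouble K 𝔥 (Double.inr K 𝔥 ξ) v)
    (fun η ξ => ⁅η, ξ⁆) (fun ξ u => ⁅Double.inr K 𝔥 ξ, u⁆) ?_ ?_ ξ v
  · intro ξ v
    simp [evalOne_omegaDouble]
  · intro η ξ v
    rw [leftDer_omegaDouble, ← Double.inr_lie]

theorem omegaDouble_inl_inr (u : 𝔥) (ξ : Module.Dual K 𝔥) :
    omegaDouble K 𝔥 (Double.inl K 𝔥 u) (Double.inr K 𝔥 ξ) =
      algebraMap K (FormalFun K 𝔥) (ξ u) := by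
  have := omegaDouble_add_swap (Double.inl K 𝔥 u) (Double.inr K 𝔥 ξ)
  rw [omegaDouble_inr_left, add_zero] at this
  rw [this, Double.pairing_apply]
  simp

/-- The function-valued linear form `ω_x(-, v)` on `𝔥`. -/
noncomputable def omegaForm (v : Double K 𝔥) : 𝔥 →ₗ[K] FormalFun K 𝔥 :=
  (omegaDouble K 𝔥).flip v ∘ₗ Double.inl K 𝔥

theorem omegaForm_apply (v : Double K 𝔥) (y : 𝔥) :
    omegaForm v y = omegaDouble K 𝔥 (Double.inl K 𝔥 y) v := rfl

theorem leftDer_omegaForm (ξ : Module.Dual K 𝔥) (v : Double K 𝔥) (u : 𝔥) :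
    leftDer ξ (omegaForm v u) = omegaForm ⁅Double.inr K 𝔥 ξ, v⁆ u - omegaForm v (coact ξ u) := by
  simp only [omegaForm_apply, leftDer_omegaDouble, Double.inr_lie_inl, map_add, map_neg,
    LinearMap.add_apply, LinearMap.neg_apply, omegaDouble_inr_left, add_zero]
  ring

theorem leftDer_comp_omegaForm (ξ : Module.Dual K 𝔥) (v : Double K 𝔥) :
    ((leftDer ξ : Derivation K (FormalFun K 𝔥) (FormalFun K 𝔥)) :
        FormalFun K 𝔥 →ₗ[K] FormalFun K 𝔥) ∘ₗ omegaForm v =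
      omegaForm ⁅Double.inr K 𝔥 ξ, v⁆ - omegaForm v ∘ₗ coact ξ :=
  LinearMap.ext fun u => leftDer_omegaForm ξ v u

variable (K 𝔥) in
/-- The restriction of the function-valued form `omega` to `𝔥`. -/
noncomputable def omegaLie : 𝔥 →ₗ[K] 𝔥 →ₗ[K] FormalFun K 𝔥 :=
  (omegaDouble K 𝔥).compl₁₂ (Double.inl K 𝔥) (Double.inl K 𝔥)

theorem omegaLie_apply (u v : 𝔥) : omegaLie K 𝔥 u v = omegaForm (Double.inl K 𝔥 v) u := rfl

theorem omegaForm_inl (v : 𝔥) : omegaForm (Double.inl K 𝔥 v) = (omegaLie K 𝔥).flip v := rfl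

theorem omegaLie_skew (u v : 𝔥) : omegaLie K 𝔥 u v = -omegaLie K 𝔥 v u := by
  rw [← add_eq_zero_iff_eq_neg]
  refine (omegaDouble_add_swap _ _).trans ?_
  simp [Double.pairing_apply]

theorem evalOne_omegaLie (u v : 𝔥) : evalOne K 𝔥 (omegaLie K 𝔥 u v) = 0 := by
  simp [omegaLie_apply, omegaForm_apply, evalOne_omegaDouble]

theorem leftDer_omegaLie (ξ : Module.Dual K 𝔥) (u v : 𝔥) :
    leftDer ξ (omegaLie K 𝔥 u v) = -omegaLie K 𝔥 (coact ξ u) v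
      - omegaLie K 𝔥 u (coact ξ v) + algebraMap K (FormalFun K 𝔥) (ξ ⁅v, u⁆) := by
  simp only [omegaLie_apply, leftDer_omegaForm]
  simp only [omegaForm_apply, Double.inr_lie_inl, map_add, map_neg, omegaDouble_inl_inr,
    compAd_apply]
  ring

/-- The function `x ↦ ⟨[ω_x(-, u), ω_x(-, v)], w⟩`, with the bracket of `𝔥*`. -/
noncomputable def omegaCobracket (u v w : Double K 𝔥) : FormalFun K 𝔥 :=
  pairInto (omegaForm u) (omegaForm v) (δ (K := K) (Double.fst K 𝔥 w))

theorem leftDer_omegaCobracket (ξ : Module.Dual K 𝔥) (u v w : Double K 𝔥) :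
    leftDer ξ (omegaCobracket u v w) = omegaCobracket ⁅Double.inr K 𝔥 ξ, u⁆ v w +
      omegaCobracket u ⁅Double.inr K 𝔥 ξ, v⁆ w + omegaCobracket u v ⁅Double.inr K 𝔥 ξ, w⁆ := by
  simp only [omegaCobracket]
  rw [derivation_pairInto, leftDer_comp_omegaForm, leftDer_comp_omegaForm, Double.fst_inr_lie,
    map_neg, δ_coact]
  simp only [map_sub, map_add, map_neg, LinearMap.sub_apply, pairInto_comp_left,
    pairInto_comp_right, LinearMap.comp_apply]
  ring

theorem evalOne_omegaCobracket (u v w : Double K 𝔥) :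
    evalOne K 𝔥 (omegaCobracket u v w) =
      Double.snd K 𝔥 v (contract (Double.snd K 𝔥 u) (δ (K := K) (Double.fst K 𝔥 w))) := by
  have evalOne_omegaForm : ∀ v : Double K 𝔥,
      (evalOne K 𝔥).toLinearMap ∘ₗ omegaForm v = Double.snd K 𝔥 v := fun v =>
    LinearMap.ext fun y => by simp [omegaForm_apply, evalOne_omegaDouble]
  rw [omegaCobracket, map_pairInto, evalOne_omegaForm, evalOne_omegaForm, apply_contract_δ,
    dual_lie_apply, pair_eq_pairInto]

theorem cyclic_omegaDouble_lie (u v w : Double K 𝔥) :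
    omegaDouble K 𝔥 ⁅u, v⁆ w + omegaDouble K 𝔥 ⁅v, w⁆ u + omegaDouble K 𝔥 ⁅w, u⁆ v =
      omegaCobracket u v w + omegaCobracket v w u + omegaCobracket w u v +
        algebraMap K (FormalFun K 𝔥) (Double.pairing K 𝔥 ⁅u, v⁆ w) := by
  rw [← sub_eq_zero]
  refine eq_zero_of_leftDer_eq_add_add (fun u v w =>
    omegaDouble K 𝔥 ⁅u, v⁆ w + omegaDouble K 𝔥 ⁅v, w⁆ u + omegaDouble K 𝔥 ⁅w, u⁆ v -
      (omegaCobracket u v w + omegaCobracket v w u + omegaCobracket w u v +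
        algebraMap K (FormalFun K 𝔥) (Double.pairing K 𝔥 ⁅u, v⁆ w)))
    (fun ξ u => ⁅Double.inr K 𝔥 ξ, u⁆) ?_ ?_ u v w
  · intro u v w
    simp only [map_sub, map_add, evalOne_omegaDouble, AlgHom.commutes, evalOne_omegaCobracket,
      Algebra.algebraMap_self, RingHom.id_apply]
    exact sub_eq_zero.2 (Double.cyclic_snd_fst_lie u v w)
  · intro ξ u v w
    have invariance := congrArg (algebraMap K (FormalFun K 𝔥))
      (Double.pairing_lie_add_pairing_lie (Double.inr K 𝔥 ξ) ⁅u, v⁆ w)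
    simp only [leibniz_lie (Double.inr K 𝔥 ξ), map_add, LinearMap.add_apply, map_zero]
      at invariance
    simp only [map_sub, map_add, leftDer_omegaDouble, Derivation.map_algebraMap,
      leftDer_omegaCobracket, leibniz_lie (Double.inr K 𝔥 ξ), LinearMap.add_apply]
    linear_combination invariance

theorem cyclic_omegaLie_lie (u v w : 𝔥) :
    omegaLie K 𝔥 ⁅u, v⁆ w + omegaLie K 𝔥 ⁅v, w⁆ u + omegaLie K 𝔥 ⁅w, u⁆ v =
      pairInto ((omegaLie K 𝔥).flip u) ((omegaLie K 𝔥).flip v) (δ (K := K) w) +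
        pairInto ((omegaLie K 𝔥).flip v) ((omegaLie K 𝔥).flip w) (δ (K := K) u) +
          pairInto ((omegaLie K 𝔥).flip w) ((omegaLie K 𝔥).flip u) (δ (K := K) v) := by
  have h := cyclic_omegaDouble_lie (Double.inl K 𝔥 u) (Double.inl K 𝔥 v) (Double.inl K 𝔥 w)
  rw [← Double.inl_lie, ← Double.inl_lie, ← Double.inl_lie, Double.pairing_apply] at h
  simp only [Double.snd_inl, LinearMap.zero_apply, add_zero, map_zero] at h
  exact h

/-- The derivative `L_φ f` of `f` along a function-valued element `φ ∈ 𝔥* ⊗ K[[H*]]`, viewed as a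
linear map `𝔥 → K[[H*]]`. -/
noncomputable def leftDerAlong (φ : 𝔥 →ₗ[K] FormalFun K 𝔥) (f : FormalFun K 𝔥) : FormalFun K 𝔥 :=
  ∑ s, φ (Module.finBasis K 𝔥 s) * leftDer ((Module.finBasis K 𝔥).coord s) f

theorem leftDerAlong_eq_sum {ι : Type*} [Fintype ι] (b : Module.Basis ι K 𝔥)
    (φ : 𝔥 →ₗ[K] FormalFun K 𝔥) (f : FormalFun K 𝔥) :
    leftDerAlong φ f = ∑ s, φ (b s) * leftDer (b.coord s) f :=
  sum_map_basis_coord (Module.finBasis K 𝔥) b LinearMap.id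
    ((LinearMap.mul K (FormalFun K 𝔥)).compl₁₂ φ ((leftDerBilin K 𝔥).flip f))

theorem leftDer_leftDerAlong (ξ : Module.Dual K 𝔥) (φ : 𝔥 →ₗ[K] FormalFun K 𝔥)
    (f : FormalFun K 𝔥) :
    leftDer ξ (leftDerAlong φ f) = leftDerAlong
      (((leftDer ξ : Derivation K (FormalFun K 𝔥) (FormalFun K 𝔥)) :
        FormalFun K 𝔥 →ₗ[K] FormalFun K 𝔥) ∘ₗ φ + φ ∘ₗ coact ξ) f +
      leftDerAlong φ (leftDer ξ f) := by
  have transpose : ∑ s, φ (coact ξ (Module.finBasis K 𝔥 s)) *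
        leftDer ((Module.finBasis K 𝔥).coord s) f =
      ∑ s, φ (Module.finBasis K 𝔥 s) * leftDer ⁅ξ, (Module.finBasis K 𝔥).coord s⁆ f := by
    simp only [← comp_coact]
    exact sum_map_basis_coord (Module.finBasis K 𝔥) (Module.finBasis K 𝔥) (coact ξ)
      ((LinearMap.mul K (FormalFun K 𝔥)).compl₁₂ φ ((leftDerBilin K 𝔥).flip f))
  simp only [leftDer_lie, mul_sub, Finset.sum_sub_distrib] at transpose
  simp only [leftDerAlong, map_sum, Derivation.leibniz, smul_eq_mul, LinearMap.add_apply,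
    LinearMap.comp_apply, Derivation.coeFn_coe, add_mul, Finset.sum_add_distrib,
    mul_comm (leftDer _ f)]
  linear_combination -transpose

theorem dress_apply (a : Double K 𝔥) (f : FormalFun K 𝔥) :
    dress a f = -∑ s, adInvCoeff (Module.Dual.eval K 𝔥 (Module.finBasis K 𝔥 s) ∘ₗ
      Double.snd K 𝔥) a * rightDer ((Module.finBasis K 𝔥).coord s) f := by
  rw [dress, Derivation.neg_apply, ← Derivation.coeFnAddMonoidHom_apply, map_sum,
    Finset.sum_apply]
  rfl

theorem leftDer_dress (ξ : Module.Dual K 𝔥) (a : Double K 𝔥) (f : FormalFun K 𝔥) :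
    leftDer ξ (dress a f) = dress ⁅Double.inr K 𝔥 ξ, a⁆ f + dress a (leftDer ξ f) := by
  simp only [dress_apply, map_neg, map_sum, Derivation.leibniz, smul_eq_mul, leftDer_adInvCoeff,
    leftDer_rightDer, Finset.sum_add_distrib, mul_comm (rightDer _ f)]
  ring

theorem dress_eq_leftDerAlong (a : Double K 𝔥) (f : FormalFun K 𝔥) :
    dress a f = leftDerAlong (omegaForm a) f := by
  rw [← sub_eq_zero]
  refine eq_zero_of_leftDer_eq_add (fun a f => dress a f - leftDerAlong (omegaForm a) f)
    (fun ξ u => ⁅Double.inr K 𝔥 ξ, u⁆) (fun ξ f => leftDer ξ f) ?_ ?_ a f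
  · intro a f
    simp only [dress_apply, leftDerAlong, map_sub, map_neg, map_sum, map_mul, evalOne_adInvCoeff,
      evalOne_rightDer, evalOne_leftDer, omegaForm_apply, evalOne_omegaDouble]
    simp
  · intro ξ a f
    rw [map_sub, leftDer_dress, leftDer_leftDerAlong, leftDer_comp_omegaForm, sub_add_cancel]
    ring

theorem leftDerAlong_omegaLie (φ : 𝔥 →ₗ[K] FormalFun K 𝔥) (u v : 𝔥) :
    leftDerAlong φ (omegaLie K 𝔥 u v) = φ ⁅v, u⁆ -
      pairInto φ ((omegaLie K 𝔥).flip v) (δ (K := K) u) +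
      pairInto φ ((omegaLie K 𝔥).flip u) (δ (K := K) v) := by
  have summand : ∀ s, φ (Module.finBasis K 𝔥 s) *
      leftDer ((Module.finBasis K 𝔥).coord s) (omegaLie K 𝔥 u v) =
      (Module.finBasis K 𝔥).coord s ⁅v, u⁆ • φ (Module.finBasis K 𝔥 s) -
      φ (Module.finBasis K 𝔥 s) *
        (omegaLie K 𝔥).flip v (contract ((Module.finBasis K 𝔥).coord s) (δ (K := K) u)) +
      φ (Module.finBasis K 𝔥 s) *
        (omegaLie K 𝔥).flip u (contract ((Module.finBasis K 𝔥).coord s) (δ (K := K) v)) := by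
    intro s
    rw [leftDer_omegaLie, omegaLie_skew u, Algebra.smul_def, coact_apply, coact_apply]
    simp only [LinearMap.flip_apply]
    ring
  simp only [leftDerAlong, summand, Finset.sum_add_distrib, Finset.sum_sub_distrib,
    sum_mul_contract, sum_coord_smul_map_basis]

theorem dress_omegaLie (a u v : 𝔥) :
    dress (Double.inl K 𝔥 a) (omegaLie K 𝔥 u v) = omegaLie K 𝔥 ⁅a, u⁆ v + omegaLie K 𝔥 u ⁅a, v⁆ -
      pairInto ((omegaLie K 𝔥).flip u) ((omegaLie K 𝔥).flip v) (δ (K := K) a) := by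
  have cyclic := cyclic_omegaLie_lie (K := K) a u v
  have along := leftDerAlong_omegaLie ((omegaLie K 𝔥).flip a) u v
  rw [pairInto_δ_swap _ _ u, LinearMap.flip_apply, ← lie_skew v u, map_neg,
    LinearMap.neg_apply] at along
  rw [dress_eq_leftDerAlong, omegaForm_inl, omegaLie_skew u ⁅a, v⁆, ← lie_skew a v, map_neg,
    LinearMap.neg_apply]
  linear_combination along - cyclic

end Finite

end FormalFun

end FormalFunctions

section LinearPencil

open Polynomial

variable {R : Type*} [Ring R]

/-- The polynomial `x + z X`, whose coefficients are not required to commute: the coefficients of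
its `n`-th power are the terms of `(x + t z) ^ n` sorted by their degree in `t`. -/
noncomputable def linearPencil (x z : R) : R[X] := C x + C z * X

theorem eval_linearPencil_pow {K : Type*} [CommRing K] [Algebra K R] (x z : R) (t : K) (n : ℕ) :
    (linearPencil x z ^ n).eval (algebraMap K R t) = (x + t • z) ^ n := by
  have eval_pow := map_pow (eval₂RingHom' (RingHom.id R) (algebraMap K R t)
    fun a => (Algebra.commutes t a).symm) (linearPencil x z) n
  simpa only [linearPencil, eval₂RingHom', RingHom.coe_mk, MonoidHom.coe_mk, OneHom.coe_mk,
    eval₂_id, eval_add, eval_C, eval_C_mul, eval_X, ← Algebra.commutes t z,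
    ← Algebra.smul_def] using eval_pow

theorem coeff_zero_linearPencil_pow (x z : R) (n : ℕ) : (linearPencil x z ^ n).coeff 0 = x ^ n := by
  rw [← constantCoeff_apply, map_pow, linearPencil, constantCoeff_apply]
  simp

theorem coeff_one_linearPencil_pow_succ (x z : R) (n : ℕ) :
    (linearPencil x z ^ (n + 1)).coeff 1 =
      x * (linearPencil x z ^ n).coeff 1 + z * x ^ n := by
  calc (linearPencil x z ^ (n + 1)).coeff 1
      = ((C x + C z * X) * linearPencil x z ^ n).coeff 1 := by rw [pow_succ', linearPencil]
    _ = x * (linearPencil x z ^ n).coeff 1 + z * x ^ n := by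
      rw [add_mul, coeff_add, coeff_C_mul, mul_assoc, coeff_C_mul, coeff_X_mul,
        coeff_zero_linearPencil_pow]

theorem exists_polynomial_eval_eq_apply_add_smul_pow {K : Type*} [CommRing K] [Algebra K R]
    (f : R →ₗ[K] K) (x z : R) (n : ℕ) :
    ∃ p : K[X], (∀ t, p.eval t = f ((x + t • z) ^ n)) ∧
      ∀ k, p.coeff k = f ((linearPencil x z ^ n).coeff k) := by
  refine ⟨∑ k ∈ (linearPencil x z ^ n).support, monomial k (f ((linearPencil x z ^ n).coeff k)),
    fun t => ?_, fun k => ?_⟩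
  · rw [← eval_linearPencil_pow, eval_finsetSum, eval_eq_sum, Polynomial.sum, map_sum]
    refine Finset.sum_congr rfl fun k _ => ?_
    rw [eval_monomial, ← map_pow, ← Algebra.commutes, ← Algebra.smul_def, map_smul, smul_eq_mul,
      mul_comm]
  · simp only [finsetSum_coeff, coeff_monomial, Finset.sum_ite_eq', mem_support_iff]
    split_ifs with hk
    · rfl
    · rw [notMem_support_iff.1 hk, map_zero]

theorem apply_coeff_linearPencil_pow_eq_zero {K : Type*} [CommRing K] [IsDomain K] [Infinite K]
    [Algebra K R] (f : R →ₗ[K] K) {x z : R} {n : ℕ} (hf : ∀ t : K, f ((x + t • z) ^ n) = 0)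
    (k : ℕ) : f ((linearPencil x z ^ n).coeff k) = 0 := by
  obtain ⟨p, eval_p, coeff_p⟩ := exists_polynomial_eval_eq_apply_add_smul_pow f x z n
  have p_eq_zero : p = 0 := Polynomial.funext fun t => by rw [eval_p, hf, eval_zero]
  rw [← coeff_p, p_eq_zero, coeff_zero]

end LinearPencil

section PowersSpan

attribute [local instance] LieRing.ofAssociativeRing

open UniversalEnvelopingAlgebra

namespace UEnv

variable (K : Type*) [Field K] {L : Type*} [LieRing L] [LieAlgebra K L]

/-- The span of the products `z x ^ k` with `z ∈ L` and `k < n`. -/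
def lowerPowSpan (x : L) (n : ℕ) : Submodule K (UniversalEnvelopingAlgebra K L) :=
  Submodule.span K {y | ∃ (z : L) (k : ℕ), k < n ∧ y = ι K z * ι K x ^ k}

variable {K}

theorem ι_mul_ι_pow_mem_lowerPowSpan (x z : L) {k n : ℕ} (hk : k < n) :
    ι K z * ι K x ^ k ∈ lowerPowSpan K x n :=
  Submodule.subset_span ⟨z, k, hk, rfl⟩

theorem ι_mul_mem_lowerPowSpan_succ {x : L} {n : ℕ} {y : UniversalEnvelopingAlgebra K L}
    (hy : y ∈ lowerPowSpan K x n) : ι K x * y ∈ lowerPowSpan K x (n + 1) := by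
  suffices lowerPowSpan K x n ≤
      (lowerPowSpan K x (n + 1)).comap (LinearMap.mulLeft K (ι K x)) from this hy
  refine Submodule.span_le.2 ?_
  rintro _ ⟨z, k, hk, rfl⟩
  have commute_past : ι K x * (ι K z * ι K x ^ k) =
      ι K ⁅x, z⁆ * ι K x ^ k + ι K z * ι K x ^ (k + 1) := by
    rw [LieHom.map_lie, LieRing.of_associative_ring_bracket, pow_succ']
    noncomm_ring
  change ι K x * (ι K z * ι K x ^ k) ∈ lowerPowSpan K x (n + 1)
  rw [commute_past]
  exact add_mem (ι_mul_ι_pow_mem_lowerPowSpan _ _ (by omega))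
    (ι_mul_ι_pow_mem_lowerPowSpan _ _ (by omega))

theorem coeff_one_linearPencil_pow_sub_mem_lowerPowSpan (x z : L) (n : ℕ) :
    (linearPencil (ι K x) (ι K z) ^ (n + 1)).coeff 1 - ((n : K) + 1) • (ι K z * ι K x ^ n) ∈
      lowerPowSpan K x n := by
  induction n with
  | zero => simp [-ι_apply, linearPencil]
  | succ n ih =>
    have recursion : (linearPencil (ι K x) (ι K z) ^ (n + 1 + 1)).coeff 1 -
        (((n + 1 : ℕ) : K) + 1) • (ι K z * ι K x ^ (n + 1)) =
        ι K x * ((linearPencil (ι K x) (ι K z) ^ (n + 1)).coeff 1 -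
          ((n : K) + 1) • (ι K z * ι K x ^ n)) + ((n : K) + 1) • (ι K ⁅x, z⁆ * ι K x ^ n) := by
      rw [coeff_one_linearPencil_pow_succ _ _ (n + 1), pow_succ' (ι K x) n, LieHom.map_lie,
        LieRing.of_associative_ring_bracket]
      simp only [mul_sub, sub_mul, mul_smul_comm, smul_sub, mul_assoc]
      push_cast
      module
    rw [recursion]
    exact add_mem (ι_mul_mem_lowerPowSpan_succ ih)
      (Submodule.smul_mem _ _ (ι_mul_ι_pow_mem_lowerPowSpan _ _ n.lt_succ_self))

variable [CharZero K]

theorem apply_ι_mul_ι_pow_eq_zero {f : UniversalEnvelopingAlgebra K L →ₗ[K] K}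
    (hf : ∀ (x : L) (n : ℕ), f (ι K x ^ n) = 0) (z x : L) (n : ℕ) : f (ι K z * ι K x ^ n) = 0 := by
  induction n using Nat.strong_induction_on generalizing z with
  | _ n ih =>
    have lower_vanish : lowerPowSpan K x n ≤ LinearMap.ker f := by
      refine Submodule.span_le.2 ?_
      rintro _ ⟨z', k, hk, rfl⟩
      exact ih k hk z'
    have coeff_vanish : f ((linearPencil (ι K x) (ι K z) ^ (n + 1)).coeff 1) = 0 :=
      apply_coeff_linearPencil_pow_eq_zero f
        (fun t => by rw [← map_smul, ← map_add, hf]) 1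
    have leading := lower_vanish (coeff_one_linearPencil_pow_sub_mem_lowerPowSpan x z n)
    rw [LinearMap.mem_ker, map_sub, coeff_vanish, map_smul, zero_sub, neg_eq_zero,
      smul_eq_zero] at leading
    exact leading.resolve_left n.cast_add_one_ne_zero

theorem eq_zero_of_forall_apply_ι_pow_eq_zero (f : UniversalEnvelopingAlgebra K L →ₗ[K] K)
    (hf : ∀ (x : L) (n : ℕ), f (ι K x ^ n) = 0) : f = 0 := by
  let annihilator : Submodule K (UniversalEnvelopingAlgebra K L) :=
    ⨅ (g : UniversalEnvelopingAlgebra K L →ₗ[K] K) (_ : ∀ x n, g (ι K x ^ n) = 0), LinearMap.ker g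
  have mem_annihilator : ∀ y, y ∈ annihilator := by
    refine mem_of_ι_mul_mem annihilator ?_ fun z y hy => ?_
    · simp only [annihilator, Submodule.mem_iInf, LinearMap.mem_ker]
      exact fun g hg => by simpa only [pow_zero] using hg 0 0
    · simp only [annihilator, Submodule.mem_iInf, LinearMap.mem_ker] at hy ⊢
      exact fun g hg => hy (g ∘ₗ LinearMap.mulLeft K (ι K z)) (apply_ι_mul_ι_pow_eq_zero hg z)
  ext y
  have hy := mem_annihilator y
  simp only [annihilator, Submodule.mem_iInf] at hy
  exact hy f hf

end UEnv

end PowersSpan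

namespace FormalFun

open LieBialgebra UniversalEnvelopingAlgebra

variable {K : Type*} [Field K] [CharZero K] {𝔥 : Type*} [LieRing 𝔥] [LieAlgebra K 𝔥]
  [LieBialgebra K 𝔥]

theorem eval_mul_ι_pow (ξ : Module.Dual K 𝔥) (f g : FormalFun K 𝔥) (n : ℕ) :
    (f * g).eval (ι K ξ ^ n) = ∑ m ∈ Finset.HasAntidiagonal.antidiagonal n,
      (n.choose m.1 : K) * (f.eval (ι K ξ ^ m.1) * g.eval (ι K ξ ^ m.2)) := by
  have commute_factors : Commute (ι K ξ ⊗ₜ[K] (1 : UniversalEnvelopingAlgebra K (Module.Dual K 𝔥)))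
      ((1 : UniversalEnvelopingAlgebra K (Module.Dual K 𝔥)) ⊗ₜ[K] ι K ξ) := by
    simp [Commute, SemiconjBy, -ι_apply]
  rw [eval_mul, Bialgebra.comul_pow, UEnv.comul_ι, commute_factors.add_pow']
  simp only [Algebra.TensorProduct.tmul_pow, one_pow, Algebra.TensorProduct.tmul_mul_tmul, mul_one,
    one_mul, map_sum]
  refine Finset.sum_congr rfl fun m _ => ?_
  rw [map_nsmul, map_nsmul, TensorProduct.map_tmul, LinearMap.mul'_apply, nsmul_eq_mul]

/-- The restriction of functions to the one-parameter subgroup `t ↦ exp(t ξ)`, expanded as power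
series in `t`. -/
noncomputable def line (ξ : Module.Dual K 𝔥) : FormalFun K 𝔥 →+* PowerSeries K where
  toFun f := PowerSeries.mk fun n => (n.factorial : K)⁻¹ * f.eval (ι K ξ ^ n)
  map_zero' := by
    ext n
    simp
  map_add' f g := by
    ext n
    simp [mul_add]
  map_one' := by
    ext n
    rw [PowerSeries.coeff_mk, eval_one, Bialgebra.counit_pow, UEnv.counit_ι, PowerSeries.coeff_one]
    rcases n with _ | n <;> simp
  map_mul' f g := by
    ext n
    rw [PowerSeries.coeff_mk, PowerSeries.coeff_mul, eval_mul_ι_pow, Finset.mul_sum]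
    refine Finset.sum_congr rfl fun m hm => ?_
    rw [Finset.HasAntidiagonal.mem_antidiagonal] at hm
    subst hm
    rw [PowerSeries.coeff_mk, PowerSeries.coeff_mk, Nat.cast_add_choose]
    have factorial_ne_zero : ((m.1 + m.2).factorial : K) ≠ 0 := by
      exact_mod_cast Nat.factorial_ne_zero _
    field_simp

theorem coeff_line (ξ : Module.Dual K 𝔥) (f : FormalFun K 𝔥) (n : ℕ) :
    PowerSeries.coeff n (line ξ f) = (n.factorial : K)⁻¹ * f.eval (ι K ξ ^ n) :=
  PowerSeries.coeff_mk n fun n => (n.factorial : K)⁻¹ * f.eval (ι K ξ ^ n)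

theorem line_ne_zero {ξ : Module.Dual K 𝔥} {f : FormalFun K 𝔥} {n : ℕ}
    (h : f.eval (ι K ξ ^ n) ≠ 0) : line ξ f ≠ 0 := by
  intro line_eq_zero
  have coeff_eq := coeff_line ξ f n
  rw [line_eq_zero, map_zero] at coeff_eq
  exact mul_ne_zero (inv_ne_zero (by exact_mod_cast Nat.factorial_ne_zero n)) h coeff_eq.symm

theorem exists_eval_ι_pow_ne_zero {f : FormalFun K 𝔥} (hf : f ≠ 0) :
    ∃ (ξ : Module.Dual K 𝔥) (n : ℕ), f.eval (ι K ξ ^ n) ≠ 0 := by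
  by_contra! h
  exact hf (ext' fun y =>
    LinearMap.congr_fun (UEnv.eq_zero_of_forall_apply_ι_pow_eq_zero f.eval h) y)

theorem exists_polynomial_eval_eq_eval_ι_pow (f : FormalFun K 𝔥) (ξ η : Module.Dual K 𝔥) (n : ℕ) :
    ∃ p : Polynomial K, ∀ t : K, p.eval t = f.eval (ι K (ξ + t • η) ^ n) := by
  obtain ⟨p, eval_p, -⟩ :=
    exists_polynomial_eval_eq_apply_add_smul_pow f.eval (ι K ξ) (ι K η) n
  exact ⟨p, fun t => by rw [eval_p, map_add, map_smul]⟩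

theorem exists_line_ne_zero_and_line_ne_zero {f g : FormalFun K 𝔥} (hf : f ≠ 0) (hg : g ≠ 0) :
    ∃ ξ : Module.Dual K 𝔥, line ξ f ≠ 0 ∧ line ξ g ≠ 0 := by
  obtain ⟨ξ, n, hξ⟩ := exists_eval_ι_pow_ne_zero hf
  obtain ⟨η, m, hη⟩ := exists_eval_ι_pow_ne_zero hg
  obtain ⟨p, eval_p⟩ := exists_polynomial_eval_eq_eval_ι_pow f ξ (η - ξ) n
  obtain ⟨q, eval_q⟩ := exists_polynomial_eval_eq_eval_ι_pow g ξ (η - ξ) m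
  have p_ne_zero : p ≠ 0 := by
    rintro rfl
    exact hξ (by simpa only [zero_smul, add_zero, Polynomial.eval_zero] using (eval_p 0).symm)
  have q_ne_zero : q ≠ 0 := by
    rintro rfl
    exact hη (by simpa only [one_smul, add_sub_cancel, Polynomial.eval_zero] using (eval_q 1).symm)
  obtain ⟨t, ht⟩ : ∃ t, (p * q).eval t ≠ 0 := by
    by_contra! h
    exact mul_ne_zero p_ne_zero q_ne_zero
      (Polynomial.funext fun t => by rw [h t, Polynomial.eval_zero])
  rw [Polynomial.eval_mul, eval_p, eval_q] at ht
  exact ⟨_, line_ne_zero (left_ne_zero_of_mul ht), line_ne_zero (right_ne_zero_of_mul ht)⟩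

instance instNoZeroDivisors : NoZeroDivisors (FormalFun K 𝔥) where
  eq_zero_or_eq_zero_of_mul_eq_zero := by
    intro f g hfg
    by_contra! hne
    obtain ⟨ξ, hf, hg⟩ := exists_line_ne_zero_and_line_ne_zero hne.1 hne.2
    exact mul_ne_zero hf hg (by rw [← map_mul, hfg, map_zero])

theorem constantCoeff_line (ξ : Module.Dual K 𝔥) (f : FormalFun K 𝔥) :
    PowerSeries.constantCoeff (line ξ f) = evalOne K 𝔥 f := by
  rw [← PowerSeries.coeff_zero_eq_constantCoeff_apply, coeff_line, pow_zero, Nat.factorial_zero,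
    Nat.cast_one, inv_one, one_mul, evalOne_apply]

theorem coeff_one_line (ξ : Module.Dual K 𝔥) (f : FormalFun K 𝔥) :
    PowerSeries.coeff 1 (line ξ f) = -evalOne K 𝔥 (leftDer ξ f) := by
  rw [coeff_line, pow_one, Nat.factorial_one, Nat.cast_one, inv_one, one_mul, evalOne_leftDer,
    neg_neg]

end FormalFun

theorem det_ne_zero_of_det_coeff_one_ne_zero {R n : Type*} [CommRing R] [Fintype n] [DecidableEq n]
    {A : Matrix n n (PowerSeries R)} (h0 : ∀ s t, PowerSeries.constantCoeff (A s t) = 0)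
    (h1 : (A.map (PowerSeries.coeff 1)).det ≠ 0) : A.det ≠ 0 := by
  choose B hB using fun s t => PowerSeries.X_dvd_iff.2 (h0 s t)
  have A_eq : A = (PowerSeries.X : PowerSeries R) • Matrix.of B := by
    ext1 s t
    exact hB s t
  have coeff_one_A : A.map (PowerSeries.coeff 1) =
      (PowerSeries.constantCoeff (R := R)).mapMatrix (Matrix.of B) := by
    ext s t
    rw [Matrix.map_apply, hB, PowerSeries.coeff_succ_X_mul,
      PowerSeries.coeff_zero_eq_constantCoeff_apply]
    rfl
  rw [coeff_one_A, ← RingHom.map_det] at h1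
  intro det_eq_zero
  rw [A_eq, Matrix.det_smul] at det_eq_zero
  refine h1 ?_
  rw [← PowerSeries.coeff_zero_eq_constantCoeff_apply,
    ← PowerSeries.coeff_X_pow_mul _ (Fintype.card n) 0, det_eq_zero, map_zero]

namespace IsSplitting

open LieBialgebra FormalFun

variable {K : Type*} [Field K] [CharZero K] {𝔩 𝔤 : Type*} [LieRing 𝔩] [LieAlgebra K 𝔩]
  [LieBialgebra K 𝔩] [LieRing 𝔤] [LieAlgebra K 𝔤] [LieBialgebra K 𝔤] {i : 𝔩 →ₗ⁅K⁆ 𝔤}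
  {𝔲 : Submodule K 𝔤} (h : IsSplitting i 𝔲)

theorem evalOne_res (f : FormalFun K 𝔤) : evalOne K 𝔩 (h.res f) = evalOne K 𝔤 f := by
  change f.eval (UEnv.map h.dualIncl 1) = f.eval 1
  rw [map_one]

theorem leftDer_res (ξ : Module.Dual K 𝔩) (f : FormalFun K 𝔤) :
    leftDer ξ (h.res f) = h.res (leftDer (h.dualIncl ξ) f) := by
  ext y
  change -f.eval (UEnv.map h.dualIncl (UniversalEnvelopingAlgebra.ι K ξ * y)) =
    -f.eval (UniversalEnvelopingAlgebra.ι K (h.dualIncl ξ) * UEnv.map h.dualIncl y)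
  rw [map_mul, UEnv.map_ι]

theorem dualIncl_apply (ξ : Module.Dual K 𝔩) (x : 𝔤) : h.dualIncl ξ x = ξ (h.proj x) := rfl

variable [FiniteDimensional K 𝔤]

theorem omegaMatrix_apply (s t : Fin (Module.finrank K 𝔲)) :
    h.omegaMatrix s t =
      h.res (omegaLie K 𝔤 (Module.finBasis K 𝔲 s : 𝔤) (Module.finBasis K 𝔲 t : 𝔤)) := rfl

theorem evalOne_leftDer_res_omegaLie (ξ : Module.Dual K 𝔩) (u v : 𝔤) :
    evalOne K 𝔩 (leftDer ξ (h.res (omegaLie K 𝔤 u v))) = -ξ (h.proj ⁅u, v⁆) := by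
  rw [leftDer_res, evalOne_res, leftDer_omegaLie, map_add, map_sub, map_neg, evalOne_omegaLie,
    evalOne_omegaLie, AlgHom.commutes, dualIncl_apply, ← lie_skew, map_neg, map_neg]
  simp

theorem detP_ne_zero (hnd : h.Nondegenerate) : h.detP ≠ 0 := by
  obtain ⟨ξ, hξ⟩ := hnd
  have coeff_one_eq : (h.omegaMatrix.map (line ξ)).map (PowerSeries.coeff 1) =
      LinearMap.toMatrix₂ (Module.finBasis K 𝔲) (Module.finBasis K 𝔲) (h.omegaZero ξ) := by
    ext s t
    rw [Matrix.map_apply, Matrix.map_apply, LinearMap.toMatrix₂_apply, omegaZero_apply,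
      coeff_one_line, omegaMatrix_apply, evalOne_leftDer_res_omegaLie, neg_neg]
  have line_det_ne_zero : (h.omegaMatrix.map (line ξ)).det ≠ 0 := by
    refine det_ne_zero_of_det_coeff_one_ne_zero (fun s t => ?_) ?_
    · rw [Matrix.map_apply, constantCoeff_line, omegaMatrix_apply, evalOne_res, evalOne_omegaLie]
    · rw [coeff_one_eq]
      exact (LinearMap.BilinForm.nondegenerate_iff_det_ne_zero (Module.finBasis K 𝔲)).mp hξ
  intro det_eq_zero
  refine line_det_ne_zero ((RingHom.map_det (line ξ) h.omegaMatrix).symm.trans ?_)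
  exact (congrArg (line ξ) det_eq_zero).trans (map_zero _)

end IsSplitting

section AwayDerivations

theorem away_leibniz_ext {R B : Type*} [CommRing R] [CommRing B] {P : R}
    (θ : Localization.Away P →+* B) {d d' : Localization.Away P →+ B}
    (hd : ∀ x y, d (x * y) = θ x * d y + θ y * d x)
    (hd' : ∀ x y, d' (x * y) = θ x * d' y + θ y * d' x)
    (h : ∀ r, d (algebraMap R (Localization.Away P) r) =
      d' (algebraMap R (Localization.Away P) r)) : d = d' := by
  ext z
  obtain ⟨n, r, hr⟩ := IsLocalization.Away.surj P z
  have isUnit_pow : IsUnit (θ (algebraMap R (Localization.Away P) (P ^ n))) := by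
    rw [map_pow, map_pow]
    exact ((IsLocalization.Away.algebraMap_isUnit P).map θ).pow n
  have leibniz := hd z (algebraMap R (Localization.Away P) (P ^ n))
  have leibniz' := hd' z (algebraMap R (Localization.Away P) (P ^ n))
  rw [map_pow, hr, ← map_pow] at leibniz leibniz'
  rw [← h, leibniz, h] at leibniz'
  exact isUnit_pow.mul_left_cancel (add_left_cancel leibniz')

variable {K : Type*} [Field K] {R : Type*} [CommRing R] [Algebra K R]

theorem derivation_away_ext {P : R}
    {D D' : Derivation K (Localization.Away P) (Localization.Away P)}
    (h : ∀ r, D (algebraMap R (Localization.Away P) r) =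
      D' (algebraMap R (Localization.Away P) r)) : D = D' :=
  DFunLike.ext _ _ (DFunLike.congr_fun (F := Localization.Away P →+ _)
    (away_leibniz_ext (RingHom.id _) (d := D.toLinearMap.toAddMonoidHom)
      (d' := D'.toLinearMap.toAddMonoidHom) D.leibniz D'.leibniz h))

theorem awayDer_add (D D' : Derivation K R R) (P : R) :
    awayDer (D + D') P = awayDer D P + awayDer D' P :=
  derivation_away_ext fun r => by
    simp only [awayDer_algebraMap, Derivation.add_apply, map_add]

theorem awayDer_smul (c : K) (D : Derivation K R R) (P : R) :
    awayDer (c • D) P = c • awayDer D P :=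
  derivation_away_ext fun r => by
    simp only [awayDer_algebraMap, Derivation.smul_apply, algebraMap.coe_smul]

variable {S : Type*} [CommRing S] [Algebra K S] (φ : R →ₐ[K] S) (P : R) (Q : S) (hQ : φ P ∣ Q)

theorem awayHom_algebraMap (f : R) :
    awayHom φ P Q hQ (algebraMap R (Localization.Away P) f) =
      algebraMap S (Localization.Away Q) (φ f) :=
  IsLocalization.Away.lift_eq (S := Localization.Away P) P
    (g := ((IsScalarTower.toAlgHom K S (Localization.Away Q)).comp φ).toRingHom)
    (isUnit_of_dvd_unit (map_dvd (algebraMap S (Localization.Away Q)) hQ)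
      (IsLocalization.Away.algebraMap_isUnit Q)) f

theorem awayHom_awayDer {D : Derivation K R R} {D' : Derivation K S S}
    (h : ∀ f, φ (D f) = D' (φ f)) (z : Localization.Away P) :
    awayHom φ P Q hQ (awayDer D P z) = awayDer D' Q (awayHom φ P Q hQ z) := by
  let θ := awayHom φ P Q hQ
  refine DFunLike.congr_fun (away_leibniz_ext (θ : Localization.Away P →+* Localization.Away Q)
    (d := (θ : _ →+ _).comp (awayDer D P).toLinearMap.toAddMonoidHom)
    (d' := (awayDer D' Q).toLinearMap.toAddMonoidHom.comp (θ : _ →+ _)) ?_ ?_ fun r => ?_) z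
  · intro x y
    change θ (awayDer D P (x * y)) = θ x * θ (awayDer D P y) + θ y * θ (awayDer D P x)
    simp only [Derivation.leibniz, smul_eq_mul, map_add, map_mul]
  · intro x y
    change awayDer D' Q (θ (x * y)) = θ x * awayDer D' Q (θ y) + θ y * awayDer D' Q (θ x)
    rw [map_mul, Derivation.leibniz, smul_eq_mul, smul_eq_mul]
  · change θ (awayDer D P (algebraMap _ _ r)) = awayDer D' Q (θ (algebraMap _ _ r))
    rw [awayDer_algebraMap, awayHom_algebraMap, awayHom_algebraMap, awayDer_algebraMap, h]

theorem awayHom_awayDer_eq_sum {ι : Type*} {s : Finset ι} {c : ι → S} {D : Derivation K R R}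
    {D' : ι → Derivation K R R} (h : ∀ f, φ (D f) = ∑ t ∈ s, c t * φ (D' t f))
    (z : Localization.Away P) :
    awayHom φ P Q hQ (awayDer D P z) = ∑ t ∈ s,
      algebraMap S (Localization.Away Q) (c t) * awayHom φ P Q hQ (awayDer (D' t) P z) := by
  let θ := awayHom φ P Q hQ
  let d' := ∑ t ∈ s, LinearMap.mulLeft K (algebraMap S (Localization.Away Q) (c t)) ∘ₗ
    θ.toLinearMap ∘ₗ (awayDer (D' t) P).toLinearMap
  have d'_apply : ∀ z, d' z = ∑ t ∈ s, algebraMap S _ (c t) * θ (awayDer (D' t) P z) :=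
    fun z => LinearMap.sum_apply _ _ _
  refine (DFunLike.congr_fun (away_leibniz_ext (θ : Localization.Away P →+* Localization.Away Q)
    (d := (θ : _ →+ _).comp (awayDer D P).toLinearMap.toAddMonoidHom)
    (d' := d'.toAddMonoidHom) ?_ ?_ fun r => ?_) z).trans (d'_apply z)
  · intro x y
    change θ (awayDer D P (x * y)) = θ x * θ (awayDer D P y) + θ y * θ (awayDer D P x)
    simp only [Derivation.leibniz, smul_eq_mul, map_add, map_mul]
  · intro x y
    change d' (x * y) = θ x * d' y + θ y * d' x
    simp only [d'_apply, Derivation.leibniz, smul_eq_mul, map_add, map_mul, mul_add,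
      Finset.sum_add_distrib, Finset.mul_sum, mul_left_comm]
  · change θ (awayDer D P (algebraMap _ _ r)) = d' (algebraMap _ _ r)
    rw [awayDer_algebraMap, awayHom_algebraMap, h, map_sum, d'_apply]
    simp only [awayDer_algebraMap, θ, awayHom_algebraMap, map_mul]

end AwayDerivations

namespace IsSplitting

open LieBialgebra FormalFun

variable {K : Type*} [Field K] {𝔩 𝔤 : Type*} [LieRing 𝔩] [LieAlgebra K 𝔩]
  [LieBialgebra K 𝔩] [LieRing 𝔤] [LieAlgebra K 𝔤] [LieBialgebra K 𝔤] {i : 𝔩 →ₗ⁅K⁆ 𝔤}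
  {𝔲 : Submodule K 𝔤} (h : IsSplitting i 𝔲)

/-- The decomposition of `𝔤` as the direct sum of `𝔩` and `𝔲`. -/
noncomputable def prodEquiv : (𝔩 × 𝔲) ≃ₗ[K] 𝔤 :=
  (LinearEquiv.prodCongr (LinearEquiv.ofInjective (i : 𝔩 →ₗ[K] 𝔤) h.inclusion.injective)
    (LinearEquiv.refl K 𝔲)).trans (Submodule.prodEquivOfIsCompl _ 𝔲 h.isCompl)

theorem prodEquiv_apply (p : 𝔩 × 𝔲) : h.prodEquiv p = i p.1 + p.2 := rfl

theorem prodEquiv_symm_incl (a : 𝔩) : h.prodEquiv.symm (i a) = (a, 0) := by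
  rw [LinearEquiv.symm_apply_eq, prodEquiv_apply]
  simp

theorem prodEquiv_symm_coe (u : 𝔲) : h.prodEquiv.symm u = (0, u) := by
  rw [LinearEquiv.symm_apply_eq, prodEquiv_apply]
  simp

section AdaptedBasis

variable [FiniteDimensional K 𝔩] [FiniteDimensional K 𝔤]

/-- The basis of `𝔤` made up of the chosen bases of `𝔩` and of `𝔲`. -/
noncomputable def adaptedBasis :
    Module.Basis (Fin (Module.finrank K 𝔩) ⊕ Fin (Module.finrank K 𝔲)) K 𝔤 :=
  ((Module.finBasis K 𝔩).prod (Module.finBasis K 𝔲)).map h.prodEquiv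

theorem adaptedBasis_inl (s : Fin (Module.finrank K 𝔩)) :
    h.adaptedBasis (Sum.inl s) = i (Module.finBasis K 𝔩 s) := by
  simp [adaptedBasis, prodEquiv_apply]

theorem adaptedBasis_inr (s : Fin (Module.finrank K 𝔲)) :
    h.adaptedBasis (Sum.inr s) = Module.finBasis K 𝔲 s := by
  simp [adaptedBasis, prodEquiv_apply]

/-- The coordinates with respect to the chosen basis of `𝔲`, extended by zero on `𝔩`. -/
noncomputable def uCoord (s : Fin (Module.finrank K 𝔲)) : Module.Dual K 𝔤 :=
  h.adaptedBasis.coord (Sum.inr s)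

theorem uCoord_incl (s : Fin (Module.finrank K 𝔲)) (a : 𝔩) : h.uCoord s (i a) = 0 := by
  simp [uCoord, adaptedBasis, prodEquiv_symm_incl]

theorem uCoord_coe (s : Fin (Module.finrank K 𝔲)) (u : 𝔲) :
    h.uCoord s u = (Module.finBasis K 𝔲).coord s u := by
  simp [uCoord, adaptedBasis, prodEquiv_symm_coe]

end AdaptedBasis

variable [CharZero K]

theorem dualIncl_incl (ξ : Module.Dual K 𝔩) (a : 𝔩) : h.dualIncl ξ (i a) = ξ a := by
  rw [dualIncl_apply, h.proj_incl]

theorem dualIncl_of_mem (ξ : Module.Dual K 𝔩) {u : 𝔤} (hu : u ∈ 𝔲) : h.dualIncl ξ u = 0 := by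
  rw [dualIncl_apply, h.proj_of_mem hu, map_zero]

theorem coact_dualIncl_incl (ξ : Module.Dual K 𝔩) (a : 𝔩) :
    coact (h.dualIncl ξ) (i a) = i (coact ξ a) := by
  rw [coact_apply, coact_apply, h.inclusion.map_δ]
  generalize δ (K := K) a = t
  induction t with
  | zero => simp
  | tmul x y => simp [h.dualIncl_incl]
  | add s t hs ht => simp only [map_add, hs, ht]

theorem coact_dualIncl_mem (ξ : Module.Dual K 𝔩) {u : 𝔤} (hu : u ∈ 𝔲) :
    coact (h.dualIncl ξ) u ∈ 𝔲 := by
  have contract_mem : ∀ p q : Submodule K 𝔤, p = 𝔲 ∨ q = 𝔲 →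
      LinearMap.range (TensorProduct.mapIncl p q) ≤
        Submodule.comap (contract (h.dualIncl ξ)) 𝔲 := by
    rintro p q hpq _ ⟨t, rfl⟩
    rw [Submodule.mem_comap]
    induction t with
    | zero => simp
    | tmul a b =>
      rcases hpq with rfl | rfl
      · simp [TensorProduct.mapIncl, h.dualIncl_of_mem _ a.2]
      · simpa [TensorProduct.mapIncl] using Submodule.smul_mem _ _ b.2
    | add s t hs ht =>
      rw [map_add, map_add]
      exact Submodule.add_mem _ hs ht
  exact (sup_le (sup_le (contract_mem _ _ (.inr rfl)) (contract_mem _ _ (.inl rfl)))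
    (contract_mem _ _ (.inl rfl))) (h.δ_mem u hu)

section AdaptedBasis

variable [FiniteDimensional K 𝔩] [FiniteDimensional K 𝔤]

theorem coord_adaptedBasis_inl (s : Fin (Module.finrank K 𝔩)) :
    h.adaptedBasis.coord (Sum.inl s) = h.dualIncl ((Module.finBasis K 𝔩).coord s) := by
  apply h.adaptedBasis.ext
  rintro (t | t)
  · rw [adaptedBasis_inl, dualIncl_incl]
    simp [adaptedBasis, prodEquiv_symm_incl]
  · rw [adaptedBasis_inr, h.dualIncl_of_mem _ (Module.finBasis K 𝔲 t).2]
    simp [adaptedBasis, prodEquiv_symm_coe]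

end AdaptedBasis

section Restriction

variable [FiniteDimensional K 𝔤]

theorem leftDer_res_omegaLie (ξ : Module.Dual K 𝔩) (u v : 𝔤) :
    leftDer ξ (h.res (omegaLie K 𝔤 u v)) =
      h.res (omegaLie K 𝔤 (-coact (h.dualIncl ξ) u) v) +
      h.res (omegaLie K 𝔤 u (-coact (h.dualIncl ξ) v)) +
        algebraMap K (FormalFun K 𝔩) (h.dualIncl ξ ⁅v, u⁆) := by
  rw [leftDer_res, leftDer_omegaLie, map_add, map_sub, map_neg, AlgHom.commutes]
  simp only [map_neg, LinearMap.neg_apply]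
  ring

theorem res_omegaLie_incl_of_mem (a : 𝔩) {u : 𝔤} (hu : u ∈ 𝔲) :
    h.res (omegaLie K 𝔤 (i a) u) = 0 := by
  refine eq_zero_of_leftDer_eq_add (fun (a : 𝔩) (u : 𝔲) => h.res (omegaLie K 𝔤 (i a) u))
    (fun ξ a => -coact ξ a) (fun ξ u => ⟨-coact (h.dualIncl ξ) u,
      𝔲.neg_mem (h.coact_dualIncl_mem ξ u.2)⟩) ?_ ?_ a ⟨u, hu⟩
  · intro a u
    rw [evalOne_res, evalOne_omegaLie]
  · intro ξ a u
    rw [leftDer_res_omegaLie, coact_dualIncl_incl, ← lie_skew, h.dualIncl_of_mem ξ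
      (𝔲.neg_mem (h.lie_mem a u u.2)), map_zero, add_zero, map_neg i]

theorem res_omegaLie_of_mem_incl {u : 𝔤} (hu : u ∈ 𝔲) (a : 𝔩) :
    h.res (omegaLie K 𝔤 u (i a)) = 0 := by
  rw [omegaLie_skew, map_neg, h.res_omegaLie_incl_of_mem a hu, neg_zero]

variable [FiniteDimensional K 𝔩]

theorem res_omegaLie_incl (a b : 𝔩) :
    h.res (omegaLie K 𝔤 (i a) (i b)) = omegaLie K 𝔩 a b := by
  rw [← sub_eq_zero]
  refine eq_zero_of_leftDer_eq_add
    (fun (a b : 𝔩) => h.res (omegaLie K 𝔤 (i a) (i b)) - omegaLie K 𝔩 a b)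
    (fun ξ a => -coact ξ a) (fun ξ a => -coact ξ a) ?_ ?_ a b
  · intro a u
    rw [map_sub, evalOne_res, evalOne_omegaLie, evalOne_omegaLie, sub_zero]
  · intro ξ a b
    rw [map_sub, leftDer_res_omegaLie, coact_dualIncl_incl, coact_dualIncl_incl,
      leftDer_omegaLie, ← LieHom.map_lie, dualIncl_incl]
    simp only [map_neg, LinearMap.neg_apply]
    ring

theorem res_dress (a : 𝔤) (f : FormalFun K 𝔤) :
    h.res (dress (Double.inl K 𝔤 a) f) =
      ∑ s, h.res (omegaLie K 𝔤 (i (Module.finBasis K 𝔩 s)) a) *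
          leftDer ((Module.finBasis K 𝔩).coord s) (h.res f) +
        ∑ s, h.res (omegaLie K 𝔤 (Module.finBasis K 𝔲 s) a) *
          h.res (leftDer (h.uCoord s) f) := by
  rw [dress_eq_leftDerAlong, omegaForm_inl, leftDerAlong_eq_sum h.adaptedBasis,
    Fintype.sum_sum_type, map_add, map_sum, map_sum]
  simp only [map_mul, LinearMap.flip_apply, adaptedBasis_inl, adaptedBasis_inr,
    coord_adaptedBasis_inl, leftDer_res, uCoord]

theorem res_dress_incl (a : 𝔩) (f : FormalFun K 𝔤) :
    h.res (dress (Double.inl K 𝔤 (i a)) f) = dress (Double.inl K 𝔩 a) (h.res f) := by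
  rw [res_dress, dress_eq_leftDerAlong, omegaForm_inl, leftDerAlong_eq_sum (Module.finBasis K 𝔩)]
  simp only [h.res_omegaLie_of_mem_incl (Submodule.coe_mem _), zero_mul, Finset.sum_const_zero,
    add_zero, res_omegaLie_incl, LinearMap.flip_apply]

theorem res_dress_of_mem {u : 𝔤} (hu : u ∈ 𝔲) (f : FormalFun K 𝔤) :
    h.res (dress (Double.inl K 𝔤 u) f) =
      ∑ s, h.res (omegaLie K 𝔤 (Module.finBasis K 𝔲 s) u) * h.res (leftDer (h.uCoord s) f) := by
  rw [res_dress]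
  simp only [h.res_omegaLie_incl_of_mem _ hu, zero_mul, Finset.sum_const_zero, zero_add]

theorem dress_res_omegaLie (a : 𝔩) {u v : 𝔤} (hu : u ∈ 𝔲) :
    dress (Double.inl K 𝔩 a) (h.res (omegaLie K 𝔤 u v)) =
      h.res (omegaLie K 𝔤 ⁅i a, u⁆ v) + h.res (omegaLie K 𝔤 u ⁅i a, v⁆) := by
  rw [← res_dress_incl, dress_omegaLie, map_sub, map_add, map_pairInto, sub_eq_self,
    h.inclusion.map_δ]
  generalize δ (K := K) a = t
  induction t with
  | zero => simp
  | tmul x y => simp [h.res_omegaLie_incl_of_mem _ hu]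
  | add s t hs ht => simp only [map_add, hs, ht, add_zero]

end Restriction

end IsSplitting

section Contractions

section Modules

variable {K V W A : Type*} [CommRing K] [AddCommGroup V] [Module K V] [AddCommGroup W]
  [Module K W] [CommRing A] [Algebra K A]

variable (A) in
/-- The `A`-valued form with constant value `ξ`. -/
noncomputable def constForm (ξ : Module.Dual K V) : V →ₗ[K] A := Algebra.linearMap K A ∘ₗ ξ

/-- The evaluation of an `A`-valued form on a vector with coefficients in `A`. -/
noncomputable def formEval (φ : V →ₗ[K] A) : V ⊗[K] A →ₗ[K] A :=
  TensorProduct.lift (LinearMap.mul K A ∘ₗ φ)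

/-- The contraction of the second factor with an `A`-valued form. -/
noncomputable def contractSnd (φ : V →ₗ[K] A) : (W ⊗[K] V) ⊗[K] A →ₗ[K] W ⊗[K] A :=
  (formEval φ).lTensor W ∘ₗ (TensorProduct.assoc K W V A).toLinearMap

/-- The contraction of the first factor with an `A`-valued form. -/
noncomputable def contractFst (φ : V →ₗ[K] A) : (V ⊗[K] W) ⊗[K] A →ₗ[K] W ⊗[K] A :=
  contractSnd φ ∘ₗ (TensorProduct.comm K V W).toLinearMap.rTensor A

/-- The evaluation of two `A`-valued forms on a tensor with coefficients in `A`. -/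
noncomputable def formEval₂ (φ ψ : V →ₗ[K] A) : (V ⊗[K] V) ⊗[K] A →ₗ[K] A :=
  formEval φ ∘ₗ contractSnd ψ

/-- The evaluation of three `A`-valued forms on a tensor with coefficients in `A`. -/
noncomputable def formEval₃ (φ ψ χ : V →ₗ[K] A) : ((V ⊗[K] V) ⊗[K] V) ⊗[K] A →ₗ[K] A :=
  formEval₂ φ ψ ∘ₗ contractSnd χ

@[simp] theorem constForm_apply (ξ : Module.Dual K V) (x : V) :
    constForm A ξ x = algebraMap K A (ξ x) := rfl

@[simp] theorem formEval_tmul (φ : V →ₗ[K] A) (x : V) (f : A) :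
    formEval φ (x ⊗ₜ[K] f) = φ x * f := rfl

@[simp] theorem contractSnd_tmul (φ : V →ₗ[K] A) (x : W) (y : V) (f : A) :
    contractSnd φ ((x ⊗ₜ[K] y) ⊗ₜ[K] f) = x ⊗ₜ[K] (φ y * f) := rfl

@[simp] theorem contractFst_tmul (φ : V →ₗ[K] A) (x : V) (y : W) (f : A) :
    contractFst φ ((x ⊗ₜ[K] y) ⊗ₜ[K] f) = y ⊗ₜ[K] (φ x * f) := rfl

@[simp] theorem formEval₂_tmul (φ ψ : V →ₗ[K] A) (x y : V) (f : A) :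
    formEval₂ φ ψ ((x ⊗ₜ[K] y) ⊗ₜ[K] f) = φ x * (ψ y * f) := rfl

@[simp] theorem formEval₃_tmul (φ ψ χ : V →ₗ[K] A) (x y z : V) (f : A) :
    formEval₃ φ ψ χ (((x ⊗ₜ[K] y) ⊗ₜ[K] z) ⊗ₜ[K] f) = φ x * (ψ y * (χ z * f)) := rfl

theorem map₂_add_left {M N P M' N' P' : Type*} [AddCommGroup M] [Module K M] [AddCommGroup N]
    [Module K N] [AddCommGroup P] [Module K P] [AddCommGroup M'] [Module K M'] [AddCommGroup N']
    [Module K N'] [AddCommGroup P'] [Module K P'] (f g : M →ₗ[K] N →ₗ[K] P)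
    (q : M' →ₗ[K] N' →ₗ[K] P') :
    TensorProduct.map₂ (f + g) q = TensorProduct.map₂ f q + TensorProduct.map₂ g q :=
  TensorProduct.ext' fun x x' => TensorProduct.ext' fun y y' => by
    simp [TensorProduct.add_tmul]

theorem formEval₂_eq_contractSnd (φ ψ : V →ₗ[K] A) (s : (V ⊗[K] V) ⊗[K] A) :
    formEval₂ φ ψ s = formEval φ (contractSnd ψ s) := rfl

theorem formEval₂_eq_contractFst (φ ψ : V →ₗ[K] A) (s : (V ⊗[K] V) ⊗[K] A) :
    formEval₂ φ ψ s = formEval ψ (contractFst φ s) := by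
  refine LinearMap.congr_fun (TensorProduct.ext_threefold (g := formEval₂ φ ψ)
    (h := formEval ψ ∘ₗ contractFst φ) fun x y f => ?_) s
  rw [LinearMap.comp_apply, contractFst_tmul, formEval_tmul, formEval₂_tmul, mul_left_comm]

theorem formEval₂_lTensor (D : Derivation K A A) (φ ψ : V →ₗ[K] A) (s : (V ⊗[K] V) ⊗[K] A) :
    formEval₂ φ ψ ((D : A →ₗ[K] A).lTensor (V ⊗[K] V) s) =
      D (formEval₂ φ ψ s) - formEval₂ ((D : A →ₗ[K] A) ∘ₗ φ) ψ s -
        formEval₂ φ ((D : A →ₗ[K] A) ∘ₗ ψ) s := by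
  refine LinearMap.congr_fun (TensorProduct.ext_threefold
    (g := formEval₂ φ ψ ∘ₗ (D : A →ₗ[K] A).lTensor (V ⊗[K] V))
    (h := (D : A →ₗ[K] A) ∘ₗ formEval₂ φ ψ - formEval₂ ((D : A →ₗ[K] A) ∘ₗ φ) ψ -
      formEval₂ φ ((D : A →ₗ[K] A) ∘ₗ ψ)) fun x y f => ?_) s
  simp only [LinearMap.comp_apply, LinearMap.lTensor_tmul, formEval₂_tmul, LinearMap.sub_apply,
    Derivation.coeFn_coe, Derivation.leibniz, smul_eq_mul]
  ring

theorem contractSnd_add (φ φ' : V →ₗ[K] A) (s : (W ⊗[K] V) ⊗[K] A) :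
    contractSnd (φ + φ') s = contractSnd φ s + contractSnd φ' s := by
  refine LinearMap.congr_fun (TensorProduct.ext_threefold (g := contractSnd (φ + φ'))
    (h := contractSnd φ + contractSnd φ') fun x y f => ?_) s
  simp [add_mul, TensorProduct.tmul_add]

theorem contractSnd_smul (a : A) (φ : V →ₗ[K] A) (s : (W ⊗[K] V) ⊗[K] A) :
    contractSnd (a • φ) s = (LinearMap.mulLeft K a).lTensor W (contractSnd φ s) := by
  refine LinearMap.congr_fun (TensorProduct.ext_threefold (g := contractSnd (a • φ))
    (h := (LinearMap.mulLeft K a).lTensor W ∘ₗ contractSnd φ) fun x y f => ?_) s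
  simp [mul_assoc]

theorem contractSnd_constForm (ξ : Module.Dual K V) (s : (W ⊗[K] V) ⊗[K] A) :
    contractSnd (constForm A ξ) s = TensorProduct.rid K (W ⊗[K] A)
      (ξ.lTensor (W ⊗[K] A) (TensorProduct.rightComm K W V A s)) := by
  refine LinearMap.congr_fun (TensorProduct.ext_threefold (g := contractSnd (constForm A ξ))
    (h := (TensorProduct.rid K (W ⊗[K] A)).toLinearMap ∘ₗ ξ.lTensor (W ⊗[K] A) ∘ₗ
      (TensorProduct.rightComm K W V A).toLinearMap) fun x y f => ?_) s
  simp [← Algebra.smul_def]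

variable {ι : Type*} (b : Module.Basis ι K V) {Φ : Set (V →ₗ[K] A)}

theorem eq_zero_of_contractSnd_constForm {s : (W ⊗[K] V) ⊗[K] A}
    (hs : ∀ p, contractSnd (constForm A (b.coord p)) s = 0) : s = 0 := by
  classical
  apply (TensorProduct.rightComm K W V A).injective
  apply (TensorProduct.equivFinsuppOfBasisRight b).injective
  ext p
  rw [map_zero, map_zero, TensorProduct.equivFinsuppOfBasisRight_apply, ← contractSnd_constForm, hs]
  rfl

variable (hΦ : ∀ p, constForm A (b.coord p) ∈ Submodule.span A Φ)
include hΦ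

theorem eq_zero_of_contractSnd {s : (W ⊗[K] V) ⊗[K] A} (hs : ∀ φ ∈ Φ, contractSnd φ s = 0) :
    s = 0 := by
  suffices ∀ φ ∈ Submodule.span A Φ, contractSnd φ s = 0 from
    eq_zero_of_contractSnd_constForm b fun p => this _ (hΦ p)
  intro φ hφ
  induction hφ using Submodule.span_induction with
  | mem φ hφ => exact hs φ hφ
  | zero => simpa using contractSnd_smul (0 : A) 0 s
  | add φ φ' _ _ hφ hφ' => rw [contractSnd_add, hφ, hφ', add_zero]
  | smul a φ _ hφ => rw [contractSnd_smul, hφ, map_zero]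

theorem eq_zero_of_formEval {s : V ⊗[K] A} (hs : ∀ φ ∈ Φ, formEval φ s = 0) : s = 0 := by
  apply ((TensorProduct.lid K V).symm.rTensor A).injective
  rw [map_zero]
  refine eq_zero_of_contractSnd b hΦ fun φ hφ => ?_
  trans (TensorProduct.lid K A).symm (formEval φ s)
  · refine LinearMap.congr_fun (TensorProduct.ext'
      (g := contractSnd φ ∘ₗ (TensorProduct.lid K V).symm.toLinearMap.rTensor A)
      (h := (TensorProduct.lid K A).symm.toLinearMap ∘ₗ formEval φ) fun x f => ?_) s
    simp
  · rw [hs φ hφ, map_zero]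

theorem eq_zero_of_formEval₂ {s : (V ⊗[K] V) ⊗[K] A}
    (hs : ∀ φ ∈ Φ, ∀ ψ ∈ Φ, formEval₂ φ ψ s = 0) : s = 0 :=
  eq_zero_of_contractSnd b hΦ fun ψ hψ => eq_zero_of_formEval b hΦ fun φ hφ => hs φ hφ ψ hψ

theorem eq_zero_of_formEval₃ {s : ((V ⊗[K] V) ⊗[K] V) ⊗[K] A}
    (hs : ∀ φ ∈ Φ, ∀ ψ ∈ Φ, ∀ χ ∈ Φ, formEval₃ φ ψ χ s = 0) : s = 0 :=
  eq_zero_of_contractSnd b hΦ fun χ hχ => eq_zero_of_formEval₂ b hΦ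
    fun φ hφ ψ hψ => hs φ hφ ψ hψ χ hχ

end Modules

section LieAlgebras

variable {K V A : Type*} [Field K] [LieRing V] [LieAlgebra K V] [CommRing A] [Algebra K A]

theorem formEval₂_rTensor_toEnd (a : V) (φ ψ : V →ₗ[K] A) (s : (V ⊗[K] V) ⊗[K] A) :
    formEval₂ φ ψ ((LieModule.toEnd K V (V ⊗[K] V) a).rTensor A s) =
      formEval₂ (φ ∘ₗ LieModule.toEnd K V V a) ψ s +
        formEval₂ φ (ψ ∘ₗ LieModule.toEnd K V V a) s := by
  refine LinearMap.congr_fun (TensorProduct.ext_threefold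
    (g := formEval₂ φ ψ ∘ₗ (LieModule.toEnd K V (V ⊗[K] V) a).rTensor A)
    (h := formEval₂ (φ ∘ₗ LieModule.toEnd K V V a) ψ +
        formEval₂ φ (ψ ∘ₗ LieModule.toEnd K V V a)) fun x y f => ?_) s
  simp [TensorProduct.LieModule.lie_tmul_right, TensorProduct.add_tmul]

theorem formEval₃_cyc (φ ψ χ : V →ₗ[K] A) (t : ((V ⊗[K] V) ⊗[K] V) ⊗[K] A) :
    formEval₃ φ ψ χ ((cyc K V).rTensor A t) = formEval₃ χ φ ψ t := by
  refine LinearMap.congr_fun (TensorProduct.ext_fourfold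
    (g := formEval₃ φ ψ χ ∘ₗ (cyc K V).rTensor A) (h := formEval₃ χ φ ψ) fun x y z f => ?_) t
  simp only [LinearMap.comp_apply, LinearMap.rTensor_tmul, cyc, LinearEquiv.coe_coe,
    TensorProduct.assoc_tmul, TensorProduct.comm_tmul, formEval₃_tmul]
  ring

theorem formEval₃_Alt (φ ψ χ : V →ₗ[K] A) (t : ((V ⊗[K] V) ⊗[K] V) ⊗[K] A) :
    formEval₃ φ ψ χ ((Alt K V).rTensor A t) =
      formEval₃ φ ψ χ t + formEval₃ χ φ ψ t + formEval₃ ψ χ φ t := by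
  rw [Alt, LinearMap.rTensor_add, LinearMap.rTensor_add, LinearMap.rTensor_comp,
    LinearMap.add_apply, LinearMap.add_apply, map_add, map_add, LinearMap.rTensor_id,
    LinearMap.id_apply, LinearMap.comp_apply, formEval₃_cyc, formEval₃_cyc, formEval₃_cyc]

theorem formEval₃_insertThird (e : V) (D : A →ₗ[K] A) (φ ψ χ : V →ₗ[K] A)
    (s : (V ⊗[K] V) ⊗[K] A) :
    formEval₃ φ ψ χ (insertThird e D s) = χ e * formEval₂ φ ψ (D.lTensor (V ⊗[K] V) s) := by
  refine LinearMap.congr_fun (TensorProduct.ext_threefold (g := formEval₃ φ ψ χ ∘ₗ insertThird e D)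
    (h := LinearMap.mulLeft K (χ e) ∘ₗ formEval₂ φ ψ ∘ₗ D.lTensor (V ⊗[K] V)) fun x y f => ?_) s
  change φ x * (ψ y * (χ e * D f)) = χ e * (φ x * (ψ y * D f))
  ring

theorem formEval₃_rTensor_δ [LieBialgebra K V] (φ ψ χ : V →ₗ[K] A) (s : (V ⊗[K] V) ⊗[K] A) :
    formEval₃ φ ψ χ (((LieBialgebra.δ (K := K) (𝔤 := V)).rTensor V).rTensor A s) =
      formEval (pairInto φ ψ ∘ₗ LieBialgebra.δ (K := K)) (contractSnd χ s) := by
  refine LinearMap.congr_fun (TensorProduct.ext_threefold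
    (g := formEval₃ φ ψ χ ∘ₗ ((LieBialgebra.δ (K := K) (𝔤 := V)).rTensor V).rTensor A)
    (h := formEval (pairInto φ ψ ∘ₗ LieBialgebra.δ (K := K)) ∘ₗ contractSnd χ) fun x y f => ?_) s
  simp only [LinearMap.comp_apply, LinearMap.rTensor_tmul, contractSnd_tmul, formEval_tmul]
  generalize LieBialgebra.δ (K := K) x = z
  induction z with
  | zero => simp
  | tmul z w => simp [mul_assoc]
  | add z w hz hw => simp only [TensorProduct.add_tmul, map_add, add_mul, hz, hw]

/-- The bracket of `V ⊗ A`. -/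
noncomputable def lieScalars : V ⊗[K] A →ₗ[K] V ⊗[K] A →ₗ[K] V ⊗[K] A :=
  TensorProduct.map₂ (LieModule.toEnd K V V : V →ₗ[K] V →ₗ[K] V) (LinearMap.mul K A)

@[simp] theorem lieScalars_tmul (x y : V) (f g : A) :
    lieScalars (K := K) (x ⊗ₜ[K] f) (y ⊗ₜ[K] g) = ⁅x, y⁆ ⊗ₜ[K] (f * g) := rfl

theorem bilin_ext_threefold {X B : Type*} [AddCommGroup X] [Module K X] [CommRing B] [Algebra K B]
    {F G : (V ⊗[K] V) ⊗[K] A →ₗ[K] (V ⊗[K] V) ⊗[K] B →ₗ[K] X}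
    (h : ∀ x y f x' y' g, F ((x ⊗ₜ[K] y) ⊗ₜ[K] f) ((x' ⊗ₜ[K] y') ⊗ₜ[K] g) =
      G ((x ⊗ₜ[K] y) ⊗ₜ[K] f) ((x' ⊗ₜ[K] y') ⊗ₜ[K] g)) : F = G :=
  TensorProduct.ext_threefold fun x y f => TensorProduct.ext_threefold fun x' y' g =>
    h x y f x' y' g

theorem formEval₃_lie₁₂₁₃ (φ ψ χ : V →ₗ[K] A) (s t : (V ⊗[K] V) ⊗[K] A) :
    formEval₃ φ ψ χ (TensorProduct.map₂ (lie₁₂₁₃ K V) (LinearMap.mul K A) s t) =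
      formEval φ (lieScalars (contractSnd ψ s) (contractSnd χ t)) := by
  refine LinearMap.congr_fun₂ (bilin_ext_threefold
    (F := (TensorProduct.map₂ (lie₁₂₁₃ K V) (LinearMap.mul K A)).compr₂ (formEval₃ φ ψ χ))
    (G := (lieScalars.compl₁₂ (contractSnd ψ) (contractSnd χ)).compr₂ (formEval φ))
    fun x y f x' y' g => ?_) s t
  change φ ⁅x, x'⁆ * (ψ y * (χ y' * (f * g))) = φ ⁅x, x'⁆ * (ψ y * f * (χ y' * g))
  ring

theorem formEval₃_lie₁₂₂₃ (φ ψ χ : V →ₗ[K] A) (s t : (V ⊗[K] V) ⊗[K] A) :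
    formEval₃ φ ψ χ (TensorProduct.map₂ (lie₁₂₂₃ K V) (LinearMap.mul K A) s t) =
      formEval ψ (lieScalars (contractFst φ s) (contractSnd χ t)) := by
  refine LinearMap.congr_fun₂ (bilin_ext_threefold
    (F := (TensorProduct.map₂ (lie₁₂₂₃ K V) (LinearMap.mul K A)).compr₂ (formEval₃ φ ψ χ))
    (G := (lieScalars.compl₁₂ (contractFst φ) (contractSnd χ)).compr₂ (formEval ψ))
    fun x y f x' y' g => ?_) s t
  change φ x * (ψ ⁅y, x'⁆ * (χ y' * (f * g))) = ψ ⁅y, x'⁆ * (φ x * f * (χ y' * g))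
  ring

theorem formEval₃_lie₁₃₂₃ (φ ψ χ : V →ₗ[K] A) (s t : (V ⊗[K] V) ⊗[K] A) :
    formEval₃ φ ψ χ (TensorProduct.map₂ (lie₁₃₂₃ K V) (LinearMap.mul K A) s t) =
      formEval χ (lieScalars (contractFst φ s) (contractFst ψ t)) := by
  refine LinearMap.congr_fun₂ (bilin_ext_threefold
    (F := (TensorProduct.map₂ (lie₁₃₂₃ K V) (LinearMap.mul K A)).compr₂ (formEval₃ φ ψ χ))
    (G := (lieScalars.compl₁₂ (contractFst φ) (contractFst ψ)).compr₂ (formEval χ))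
    fun x y f x' y' g => ?_) s t
  change φ x * (ψ x' * (χ ⁅y, y'⁆ * (f * g))) = χ ⁅y, y'⁆ * (φ x * f * (ψ x' * g))
  ring

theorem formEval₃_CYB (φ ψ χ : V →ₗ[K] A) (s : (V ⊗[K] V) ⊗[K] A) :
    formEval₃ φ ψ χ (CYB s) =
      formEval φ (lieScalars (contractSnd ψ s) (contractSnd χ s)) +
        formEval ψ (lieScalars (contractFst φ s) (contractSnd χ s)) +
          formEval χ (lieScalars (contractFst φ s) (contractFst ψ s)) := by
  rw [CYB, map₂_add_left, map₂_add_left, LinearMap.add_apply, LinearMap.add_apply,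
    LinearMap.add_apply, LinearMap.add_apply, map_add, map_add, formEval₃_lie₁₂₁₃,
    formEval₃_lie₁₂₂₃, formEval₃_lie₁₃₂₃]

end LieAlgebras

end Contractions

section DynamicalYangBaxter

open LieBialgebra FormalFun

theorem pairInto_constForm_δ {K 𝔥 A : Type*} [Field K] [LieRing 𝔥] [LieAlgebra K 𝔥]
    [LieBialgebra K 𝔥] [CommRing A] [Algebra K A] (ξ : Module.Dual K 𝔥) (φ : 𝔥 →ₗ[K] A) (x : 𝔥) :
    pairInto (constForm A ξ) φ (δ (K := K) x) = φ (coact ξ x) := by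
  rw [coact_apply]
  generalize δ (K := K) x = t
  induction t with
  | zero => simp
  | tmul x y => simp [contract, Algebra.smul_def, pairInto_tmul]
  | add s t hs ht => simp only [map_add, hs, ht]

variable {K : Type*} [Field K] [CharZero K] {𝔥 V : Type*} [LieRing 𝔥] [LieAlgebra K 𝔥]
  [LieBialgebra K 𝔥] (P : FormalFun K 𝔥)

/-- The left translations of `K[[H*]][1/P]`, as a bilinear map `(ξ, z) ↦ L_ξ z`. -/
noncomputable def awayLeftDer :
    Module.Dual K 𝔥 →ₗ[K] Localization.Away P →ₗ[K] Localization.Away P where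
  toFun ξ := awayDer (leftDer ξ) P
  map_add' ξ η := by
    rw [← Derivation.coe_add_linearMap, ← awayDer_add]
    congr 2
    ext1 f
    exact LinearMap.map_add₂ (leftDerBilin K 𝔥) ξ η f
  map_smul' c ξ := by
    rw [RingHom.id_apply, ← Derivation.coe_smul_linearMap, ← awayDer_smul]
    congr 2
    ext1 f
    exact LinearMap.map_smul₂ (leftDerBilin K 𝔥) c ξ f

theorem awayLeftDer_apply (ξ : Module.Dual K 𝔥) (z : Localization.Away P) :
    awayLeftDer P ξ z = awayDer (leftDer ξ) P z := rfl

variable [FiniteDimensional K 𝔥]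

theorem sum_awayDer_leftDer (ξ : Module.Dual K 𝔥) (z : Localization.Away P) :
    ∑ k, algebraMap K (Localization.Away P) (ξ (Module.finBasis K 𝔥 k)) *
      awayDer (leftDer ((Module.finBasis K 𝔥).coord k)) P z = awayDer (leftDer ξ) P z := by
  simp only [← Algebra.smul_def, ← awayLeftDer_apply, ← LinearMap.map_smul₂,
    ← LinearMap.sum_apply, ← map_sum, Module.Basis.sum_dual_apply_smul_coord]

variable [LieRing V] [LieAlgebra K V] (j : 𝔥 →ₗ⁅K⁆ V)

theorem formEval₃_dL [LieBialgebra K V] (φ ψ χ : V →ₗ[K] Localization.Away P)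
    (s : (V ⊗[K] V) ⊗[K] Localization.Away P) :
    formEval₃ φ ψ χ (dL j P s) = -∑ k, χ (j (Module.finBasis K 𝔥 k)) * formEval₂ φ ψ
      ((awayDer (leftDer ((Module.finBasis K 𝔥).coord k)) P :
        Localization.Away P →ₗ[K] Localization.Away P).lTensor _ s) := by
  rw [dL, map_neg, map_sum]
  simp only [formEval₃_insertThird]

variable {P} in
/-- The left hand side `CYB(ρ) + Alt(d^L ρ) + Alt((δ ⊗ id) ρ)` of the dynamical Yang-Baxter
equation. -/
noncomputable def dynamicalYangBaxter [LieBialgebra K V]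
    (ρ : (V ⊗[K] V) ⊗[K] Localization.Away P) : ((V ⊗[K] V) ⊗[K] V) ⊗[K] Localization.Away P :=
  CYB ρ + (Alt K V).rTensor (Localization.Away P) (dL j P ρ) +
    (Alt K V ∘ₗ (δ (K := K)).rTensor V).rTensor (Localization.Away P) ρ

end DynamicalYangBaxter

namespace IsSplitting

open LieBialgebra FormalFun

variable {K : Type*} [Field K] [CharZero K] {𝔩 𝔤 : Type*} [LieRing 𝔩] [LieAlgebra K 𝔩]
  [LieBialgebra K 𝔩] [LieRing 𝔤] [LieAlgebra K 𝔤] [LieBialgebra K 𝔤] {i : 𝔩 →ₗ⁅K⁆ 𝔤}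
  {𝔲 : Submodule K 𝔤} (h : IsSplitting i 𝔲)

theorem constForm_dualIncl_of_mem {A : Type*} [CommRing A] [Algebra K A] (ξ : Module.Dual K 𝔩)
    {u : 𝔤} (hu : u ∈ 𝔲) : constForm A (h.dualIncl ξ) u = 0 := by
  rw [constForm_apply, h.dualIncl_of_mem ξ hu, map_zero]

variable [FiniteDimensional K 𝔤]

section ResForm

variable (Q : FormalFun K 𝔩)

/-- The restriction `K[[G*]] → K[[L*]][1/Q]`. -/
noncomputable def resAway : FormalFun K 𝔤 →ₐ[K] Localization.Away Q :=
  (IsScalarTower.toAlgHom K (FormalFun K 𝔩) (Localization.Away Q)).comp h.res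

/-- The form `ω_x(-, v)`, `x ∈ L*`, with values in `K[[L*]][1/Q]`. -/
noncomputable def resForm (v : 𝔤) : 𝔤 →ₗ[K] Localization.Away Q :=
  (h.resAway Q).toLinearMap ∘ₗ (omegaLie K 𝔤).flip v

theorem resForm_apply (v x : 𝔤) :
    h.resForm Q v x = algebraMap _ (Localization.Away Q) (h.res (omegaLie K 𝔤 x v)) := rfl

theorem resForm_skew (u v : 𝔤) : h.resForm Q u v = -h.resForm Q v u := by
  rw [resForm_apply, resForm_apply, omegaLie_skew, map_neg, map_neg]

theorem resForm_incl {u : 𝔤} (hu : u ∈ 𝔲) (a : 𝔩) : h.resForm Q u (i a) = 0 := by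
  rw [resForm_apply, h.res_omegaLie_incl_of_mem a hu, map_zero]

theorem cyclic_resForm_lie (u v w : 𝔤) :
    h.resForm Q w ⁅u, v⁆ + h.resForm Q u ⁅v, w⁆ + h.resForm Q v ⁅w, u⁆ =
      pairInto (h.resForm Q u) (h.resForm Q v) (δ (K := K) w) +
        pairInto (h.resForm Q v) (h.resForm Q w) (δ (K := K) u) +
          pairInto (h.resForm Q w) (h.resForm Q u) (δ (K := K) v) := by
  have cyclic := congrArg (h.resAway Q) (cyclic_omegaLie_lie u v w)
  simp only [map_add, map_pairInto] at cyclic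
  exact cyclic

theorem awayDer_leftDer_resForm (ξ : Module.Dual K 𝔩) (u v : 𝔤) :
    awayDer (leftDer ξ) Q (h.resForm Q v u) =
      -h.resForm Q v (coact (h.dualIncl ξ) u) + h.resForm Q u (coact (h.dualIncl ξ) v) +
        algebraMap K (Localization.Away Q) (h.dualIncl ξ ⁅v, u⁆) := by
  rw [h.resForm_skew Q u, resForm_apply, awayDer_algebraMap, leftDer_res_omegaLie, map_add,
    map_add, ← IsScalarTower.algebraMap_apply]
  simp only [map_neg, LinearMap.neg_apply, resForm_apply]

theorem awayDer_dress_resForm [FiniteDimensional K 𝔩] (a : 𝔩) {u v : 𝔤} (hu : u ∈ 𝔲) :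
    awayDer (dress (Double.inl K 𝔩 a)) Q (h.resForm Q v u) =
      h.resForm Q v ⁅i a, u⁆ - h.resForm Q u ⁅i a, v⁆ := by
  rw [h.resForm_skew Q u, resForm_apply, awayDer_algebraMap, h.dress_res_omegaLie a hu, map_add,
    sub_neg_eq_add]
  rfl

end ResForm

section Sigma

variable {Q : FormalFun K 𝔩} (hd : h.detP ∣ Q)

/-- The homomorphism `K[[L*]][1/P_𝔩^𝔤] → K[[L*]][1/Q]`. -/
noncomputable def detHom : Localization.Away h.detP →ₐ[K] Localization.Away Q :=
  awayHom (AlgHom.id K _) h.detP Q hd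

/-- The coefficients of `σ_𝔩^𝔤` in `K[[L*]][1/Q]`. -/
noncomputable def sigmaCoeff :
    Matrix (Fin (Module.finrank K 𝔲)) (Fin (Module.finrank K 𝔲)) (Localization.Away Q) :=
  h.sigmaMatrix.map (h.detHom hd)

theorem sigmaMatrix_mul :
    h.sigmaMatrix * (h.omegaMatrix.map
      (algebraMap (FormalFun K 𝔩) (Localization.Away h.detP))).transpose = 1 := by
  refine Matrix.nonsing_inv_mul _ ?_
  rw [Matrix.det_transpose, ← RingHom.mapMatrix_apply, ← RingHom.map_det]
  exact IsLocalization.Away.algebraMap_isUnit h.detP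

theorem sigmaCoeff_mul :
    h.sigmaCoeff hd * (h.omegaMatrix.map
      (algebraMap (FormalFun K 𝔩) (Localization.Away Q))).transpose = 1 := by
  have map_omegaMatrix :
      h.omegaMatrix.map (algebraMap (FormalFun K 𝔩) (Localization.Away Q)) =
        (h.omegaMatrix.map (algebraMap (FormalFun K 𝔩) (Localization.Away h.detP))).map
          (h.detHom hd) := by
    ext s t
    exact (awayHom_algebraMap (AlgHom.id K _) h.detP Q hd _).symm
  rw [map_omegaMatrix, sigmaCoeff, ← Matrix.transpose_map, ← Matrix.map_mul, sigmaMatrix_mul,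
    Matrix.map_one _ (map_zero _) (map_one _)]

theorem omegaMatrix_transpose : h.omegaMatrix.transpose = -h.omegaMatrix := by
  ext1 s t
  rw [Matrix.transpose_apply, Matrix.neg_apply, omegaMatrix_apply, omegaMatrix_apply,
    omegaLie_skew, map_neg]

theorem sigmaCoeff_transpose : (h.sigmaCoeff hd).transpose = -h.sigmaCoeff hd := by
  let Ω := h.omegaMatrix.map (algebraMap (FormalFun K 𝔩) (Localization.Away Q))
  have transpose_eq : Ω.transpose = -Ω := by
    rw [← Matrix.transpose_map, omegaMatrix_transpose]
    ext1 s t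
    exact map_neg (algebraMap (FormalFun K 𝔩) (Localization.Away Q)) _
  have left_inv : h.sigmaCoeff hd * Ω.transpose = 1 := h.sigmaCoeff_mul hd
  have right_inv : Ω.transpose * -(h.sigmaCoeff hd).transpose = 1 := by
    rw [transpose_eq, neg_mul_neg, ← Matrix.transpose_transpose Ω, ← Matrix.transpose_mul,
      left_inv, Matrix.transpose_one]
  exact neg_eq_iff_eq_neg.mp (left_inv_eq_right_inv left_inv right_inv).symm

theorem sigmaCoeff_swap (s t : Fin (Module.finrank K 𝔲)) :
    h.sigmaCoeff hd t s = -h.sigmaCoeff hd s t :=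
  congrFun₂ (h.sigmaCoeff_transpose hd) s t

/-- The element `σ_𝔩^𝔤` with coefficients in `K[[L*]][1/Q]`. -/
noncomputable def sigmaAway : (𝔤 ⊗[K] 𝔤) ⊗[K] Localization.Away Q :=
  ∑ s, ∑ t, ((Module.finBasis K 𝔲 s : 𝔤) ⊗ₜ[K] (Module.finBasis K 𝔲 t : 𝔤)) ⊗ₜ[K]
    h.sigmaCoeff hd s t

theorem sigmaAway_antisymm :
    (TensorProduct.comm K 𝔤 𝔤).toLinearMap.rTensor (Localization.Away Q) (h.sigmaAway hd) =
      -h.sigmaAway hd := by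
  simp only [sigmaAway, map_sum, LinearMap.rTensor_tmul, LinearEquiv.coe_coe,
    TensorProduct.comm_tmul]
  rw [Finset.sum_comm]
  simp only [← Finset.sum_neg_distrib, ← TensorProduct.tmul_neg, ← sigmaCoeff_swap]

theorem contractFst_sigmaAway (φ : 𝔤 →ₗ[K] Localization.Away Q) :
    contractFst φ (h.sigmaAway hd) = ∑ t, (Module.finBasis K 𝔲 t : 𝔤) ⊗ₜ[K]
      ∑ s, φ (Module.finBasis K 𝔲 s : 𝔤) * h.sigmaCoeff hd s t := by
  simp only [sigmaAway, map_sum, contractFst_tmul, TensorProduct.tmul_sum]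
  exact Finset.sum_comm

/-- The form `φ` and the vector `v` correspond to each other under `σ_𝔩^𝔤`. -/
def IsSharp (φ : 𝔤 →ₗ[K] Localization.Away Q) (v : 𝔤) : Prop :=
  contractFst φ (h.sigmaAway hd) = v ⊗ₜ[K] 1

theorem IsSharp.def {h : IsSplitting i 𝔲} {hd : h.detP ∣ Q} {φ : 𝔤 →ₗ[K] Localization.Away Q}
    {v : 𝔤} (hφ : h.IsSharp hd φ v) : contractFst φ (h.sigmaAway hd) = v ⊗ₜ[K] 1 := hφ

theorem isSharp_of_eq_zero {φ : 𝔤 →ₗ[K] Localization.Away Q} (hφ : ∀ u ∈ 𝔲, φ u = 0) :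
    h.IsSharp hd φ 0 := by
  rw [IsSharp, contractFst_sigmaAway]
  simp [hφ]

theorem isSharp_constForm (ξ : Module.Dual K 𝔩) :
    h.IsSharp hd (constForm _ (h.dualIncl ξ)) 0 :=
  h.isSharp_of_eq_zero hd fun _ hu => h.constForm_dualIncl_of_mem ξ hu

variable [FiniteDimensional K 𝔩]

theorem constForm_uCoord (s : Fin (Module.finrank K 𝔲)) :
    constForm (Localization.Away Q) (h.uCoord s) =
      ∑ t, h.sigmaCoeff hd s t • h.resForm Q (Module.finBasis K 𝔲 t : 𝔤) := by
  apply h.adaptedBasis.ext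
  rintro (m | m)
  · rw [adaptedBasis_inl, constForm_apply, uCoord_incl, map_zero, LinearMap.sum_apply]
    simp only [LinearMap.smul_apply, h.resForm_incl Q (Submodule.coe_mem _), smul_zero,
      Finset.sum_const_zero]
  · have inverse := congrFun₂ (h.sigmaCoeff_mul hd) s m
    rw [Matrix.mul_apply] at inverse
    simp only [Matrix.transpose_apply, Matrix.map_apply, omegaMatrix_apply] at inverse
    rw [adaptedBasis_inr, constForm_apply, uCoord_coe, LinearMap.sum_apply]
    simp only [LinearMap.smul_apply, smul_eq_mul, resForm_apply, inverse]
    simp [Finsupp.single_apply, Matrix.one_apply, eq_comm (a := m)]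

theorem isSharp_resForm {u : 𝔤} (hu : u ∈ 𝔲) : h.IsSharp hd (h.resForm Q u) u := by
  have coeff_eq (t : Fin (Module.finrank K 𝔲)) :
      ∑ s, h.resForm Q u (Module.finBasis K 𝔲 s : 𝔤) * h.sigmaCoeff hd s t =
        algebraMap K _ (h.uCoord t u) := by
    rw [← constForm_apply, h.constForm_uCoord hd, LinearMap.sum_apply]
    refine Finset.sum_congr rfl fun s _ => ?_
    rw [h.resForm_skew Q u, h.sigmaCoeff_swap hd t s, neg_mul_neg, mul_comm]
    rfl
  rw [IsSharp, contractFst_sigmaAway]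
  simp only [coeff_eq, Algebra.algebraMap_eq_smul_one, ← TensorProduct.smul_tmul,
    ← TensorProduct.sum_tmul]
  lift u to 𝔲 using hu
  simp only [uCoord_coe, Module.Basis.coord_apply, ← Submodule.coe_smul, ← Submodule.coe_sum,
    Module.Basis.sum_repr]

variable (Q) in
/-- The forms on `𝔤` against which tensors are tested: `ω_x(-, u)` for `u ∈ 𝔲`, and the elements of
`𝔩*`. -/
def testForms : Set (𝔤 →ₗ[K] Localization.Away Q) :=
  h.resForm Q '' 𝔲 ∪ Set.range fun ξ => constForm _ (h.dualIncl ξ)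

include hd in
theorem constForm_coord_mem_span_testForms
    (p : Fin (Module.finrank K 𝔩) ⊕ Fin (Module.finrank K 𝔲)) :
    constForm _ (h.adaptedBasis.coord p) ∈
      Submodule.span (Localization.Away Q) (h.testForms Q) := by
  rcases p with s | s
  · rw [coord_adaptedBasis_inl]
    exact Submodule.subset_span (.inr ⟨_, rfl⟩)
  · change constForm _ (h.uCoord s) ∈ _
    rw [h.constForm_uCoord hd]
    exact Submodule.sum_mem _ fun t _ =>
      Submodule.smul_mem _ _ (Submodule.subset_span (.inl ⟨_, Submodule.coe_mem _, rfl⟩))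

theorem exists_isSharp {φ : 𝔤 →ₗ[K] Localization.Away Q} (hφ : φ ∈ h.testForms Q) :
    ∃ v ∈ 𝔲, h.IsSharp hd φ v := by
  rcases hφ with ⟨u, hu, rfl⟩ | ⟨ξ, rfl⟩
  · exact ⟨u, hu, h.isSharp_resForm hd hu⟩
  · exact ⟨0, 𝔲.zero_mem, h.isSharp_constForm hd ξ⟩

end Sigma

end IsSplitting

namespace IsSplitting

open LieBialgebra FormalFun

variable {K : Type*} [Field K] [CharZero K] {𝔩 𝔤 : Type*} [LieRing 𝔩] [LieAlgebra K 𝔩]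
  [LieBialgebra K 𝔩] [LieRing 𝔤] [LieAlgebra K 𝔤] [LieBialgebra K 𝔤] {i : 𝔩 →ₗ⁅K⁆ 𝔤}
  {𝔲 : Submodule K 𝔤} {h : IsSplitting i 𝔲} [FiniteDimensional K 𝔤] {Q : FormalFun K 𝔩}
  {hd : h.detP ∣ Q}

namespace IsSharp

variable {φ ψ χ : 𝔤 →ₗ[K] Localization.Away Q} {u v w : 𝔤}

theorem contractSnd_eq (hφ : h.IsSharp hd φ v) :
    contractSnd φ (h.sigmaAway hd) = -(v ⊗ₜ[K] 1) := by
  rw [← hφ.def, contractFst, LinearMap.comp_apply, sigmaAway_antisymm, map_neg, neg_neg]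

theorem formEval₂_left (hφ : h.IsSharp hd φ v) (ψ : 𝔤 →ₗ[K] Localization.Away Q) :
    formEval₂ φ ψ (h.sigmaAway hd) = ψ v := by
  rw [formEval₂_eq_contractFst, hφ.def, formEval_tmul, mul_one]

theorem formEval₂_right (hφ : h.IsSharp hd φ v) (ψ : 𝔤 →ₗ[K] Localization.Away Q) :
    formEval₂ ψ φ (h.sigmaAway hd) = -ψ v := by
  rw [formEval₂_eq_contractSnd, hφ.contractSnd_eq, map_neg, formEval_tmul, mul_one]

theorem formEval₂_lTensor (hφ : h.IsSharp hd φ u) (hψ : h.IsSharp hd ψ v)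
    (D : Derivation K (Localization.Away Q) (Localization.Away Q)) :
    formEval₂ φ ψ ((D : Localization.Away Q →ₗ[K] Localization.Away Q).lTensor _
      (h.sigmaAway hd)) = D (φ v) := by
  have skew : ψ u = -φ v := by rw [← hφ.formEval₂_left, hψ.formEval₂_right]
  rw [_root_.formEval₂_lTensor, hψ.formEval₂_right, hψ.formEval₂_right, hφ.formEval₂_left,
    LinearMap.comp_apply, LinearMap.comp_apply, skew, Derivation.coeFn_coe, map_neg]
  ring

theorem formEval₃_CYB (hφ : h.IsSharp hd φ u) (hψ : h.IsSharp hd ψ v) (hχ : h.IsSharp hd χ w) :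
    formEval₃ φ ψ χ (CYB (h.sigmaAway hd)) = φ ⁅v, w⁆ + ψ ⁅w, u⁆ + χ ⁅u, v⁆ := by
  rw [_root_.formEval₃_CYB, hφ.def, hψ.def, hψ.contractSnd_eq, hχ.contractSnd_eq]
  simp only [map_neg, LinearMap.neg_apply, lieScalars_tmul, formEval_tmul, mul_one, neg_neg]
  rw [← lie_skew w u, map_neg]

theorem formEval₃_rTensor_δ (hχ : h.IsSharp hd χ w) (φ ψ : 𝔤 →ₗ[K] Localization.Away Q) :
    formEval₃ φ ψ χ (((δ (K := K) (𝔤 := 𝔤)).rTensor 𝔤).rTensor _ (h.sigmaAway hd)) =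
      -pairInto φ ψ (δ (K := K) w) := by
  rw [_root_.formEval₃_rTensor_δ, hχ.contractSnd_eq, map_neg, formEval_tmul, mul_one]
  rfl

variable [FiniteDimensional K 𝔩]

theorem formEval₃_dL (hφ : h.IsSharp hd φ u) (hψ : h.IsSharp hd ψ v)
    (χ : 𝔤 →ₗ[K] Localization.Away Q) :
    formEval₃ φ ψ χ (dL i Q (h.sigmaAway hd)) = -∑ k, χ (i (Module.finBasis K 𝔩 k)) *
      awayDer (leftDer ((Module.finBasis K 𝔩).coord k)) Q (φ v) := by
  simp only [_root_.formEval₃_dL, hφ.formEval₂_lTensor hψ]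

theorem formEval₃_dL_resForm (hφ : h.IsSharp hd φ u) (hψ : h.IsSharp hd ψ v) (hw : w ∈ 𝔲) :
    formEval₃ φ ψ (h.resForm Q w) (dL i Q (h.sigmaAway hd)) = 0 := by
  simp only [hφ.formEval₃_dL hψ, h.resForm_incl Q hw, zero_mul, Finset.sum_const_zero, neg_zero]

theorem formEval₃_dL_constForm (hφ : h.IsSharp hd φ u) (hψ : h.IsSharp hd ψ v)
    (ξ : Module.Dual K 𝔩) :
    formEval₃ φ ψ (constForm _ (h.dualIncl ξ)) (dL i Q (h.sigmaAway hd)) =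
      -awayDer (leftDer ξ) Q (φ v) := by
  simp only [hφ.formEval₃_dL hψ, constForm_apply, dualIncl_incl, sum_awayDer_leftDer]

theorem formEval₃_dL_eq_zero (hφ : h.IsSharp hd φ u) (hψ : h.IsSharp hd ψ v) (hφv : φ v = 0)
    (χ : 𝔤 →ₗ[K] Localization.Away Q) :
    formEval₃ φ ψ χ (dL i Q (h.sigmaAway hd)) = 0 := by
  simp only [hφ.formEval₃_dL hψ, hφv, map_zero, mul_zero, Finset.sum_const_zero, neg_zero]

theorem formEval₃_dynamicalYangBaxter (hφ : h.IsSharp hd φ u) (hψ : h.IsSharp hd ψ v)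
    (hχ : h.IsSharp hd χ w) :
    formEval₃ φ ψ χ (dynamicalYangBaxter i (h.sigmaAway hd)) =
      φ ⁅v, w⁆ + ψ ⁅w, u⁆ + χ ⁅u, v⁆ +
        (formEval₃ φ ψ χ (dL i Q (h.sigmaAway hd)) + formEval₃ χ φ ψ (dL i Q (h.sigmaAway hd)) +
          formEval₃ ψ χ φ (dL i Q (h.sigmaAway hd))) -
        (pairInto φ ψ (δ (K := K) w) + pairInto χ φ (δ (K := K) v) +
          pairInto ψ χ (δ (K := K) u)) := by
  rw [dynamicalYangBaxter, map_add, map_add, hφ.formEval₃_CYB hψ hχ, LinearMap.rTensor_comp,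
    LinearMap.comp_apply, formEval₃_Alt, formEval₃_Alt, hχ.formEval₃_rTensor_δ,
    hφ.formEval₃_rTensor_δ, hψ.formEval₃_rTensor_δ]
  ring

theorem formEval₃_dynamicalYangBaxter_rotate (hφ : h.IsSharp hd φ u) (hψ : h.IsSharp hd ψ v)
    (hχ : h.IsSharp hd χ w) :
    formEval₃ φ ψ χ (dynamicalYangBaxter i (h.sigmaAway hd)) =
      formEval₃ ψ χ φ (dynamicalYangBaxter i (h.sigmaAway hd)) := by
  rw [hφ.formEval₃_dynamicalYangBaxter hψ hχ, hψ.formEval₃_dynamicalYangBaxter hχ hφ]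
  ring

end IsSharp

section YangBaxter

variable [FiniteDimensional K 𝔩] (hd)

theorem formEval₃_resForm_resForm_constForm_dynamicalYangBaxter {u v : 𝔤} (hu : u ∈ 𝔲)
    (hv : v ∈ 𝔲) (ξ : Module.Dual K 𝔩) :
    formEval₃ (h.resForm Q u) (h.resForm Q v) (constForm _ (h.dualIncl ξ))
      (dynamicalYangBaxter i (h.sigmaAway hd)) = 0 := by
  have sharp_u := h.isSharp_resForm hd hu
  have sharp_v := h.isSharp_resForm hd hv
  have sharp_ξ := h.isSharp_constForm hd ξ
  rw [sharp_u.formEval₃_dynamicalYangBaxter sharp_v sharp_ξ,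
    sharp_u.formEval₃_dL_constForm sharp_v, sharp_ξ.formEval₃_dL_resForm sharp_u hv,
    sharp_v.formEval₃_dL_resForm sharp_ξ hu, awayDer_leftDer_resForm, pairInto_δ_swap _ _ u,
    pairInto_constForm_δ, pairInto_constForm_δ, constForm_apply]
  simp only [lie_zero, zero_lie, map_zero]
  ring

theorem formEval₃_constForm_constForm_dynamicalYangBaxter (ξ η : Module.Dual K 𝔩)
    {φ : 𝔤 →ₗ[K] Localization.Away Q} (hφ : φ ∈ h.testForms Q) :
    formEval₃ (constForm _ (h.dualIncl ξ)) (constForm _ (h.dualIncl η)) φ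
      (dynamicalYangBaxter i (h.sigmaAway hd)) = 0 := by
  have sharp_ξ := h.isSharp_constForm hd ξ
  have sharp_η := h.isSharp_constForm hd η
  obtain ⟨w, hw, sharp_φ⟩ := h.exists_isSharp hd hφ
  rw [sharp_ξ.formEval₃_dynamicalYangBaxter sharp_η sharp_φ,
    sharp_ξ.formEval₃_dL_eq_zero sharp_η (map_zero _),
    sharp_φ.formEval₃_dL_eq_zero sharp_ξ (map_zero _),
    sharp_η.formEval₃_dL_eq_zero sharp_φ (h.constForm_dualIncl_of_mem η hw),
    pairInto_constForm_δ, h.constForm_dualIncl_of_mem η (h.coact_dualIncl_mem ξ hw)]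
  simp

theorem formEval₃_resForm_dynamicalYangBaxter {u v w : 𝔤} (hu : u ∈ 𝔲) (hv : v ∈ 𝔲)
    (hw : w ∈ 𝔲) :
    formEval₃ (h.resForm Q u) (h.resForm Q v) (h.resForm Q w)
      (dynamicalYangBaxter i (h.sigmaAway hd)) = 0 := by
  have sharp_u := h.isSharp_resForm hd hu
  have sharp_v := h.isSharp_resForm hd hv
  have sharp_w := h.isSharp_resForm hd hw
  rw [sharp_u.formEval₃_dynamicalYangBaxter sharp_v sharp_w,
    sharp_u.formEval₃_dL_resForm sharp_v hw, sharp_w.formEval₃_dL_resForm sharp_u hv,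
    sharp_v.formEval₃_dL_resForm sharp_w hu]
  linear_combination h.cyclic_resForm_lie Q u v w

variable (h)

theorem dynamicalYangBaxter_sigmaAway : dynamicalYangBaxter i (h.sigmaAway hd) = 0 := by
  refine eq_zero_of_formEval₃ h.adaptedBasis (h.constForm_coord_mem_span_testForms hd)
    fun φ hφ ψ hψ χ hχ => ?_
  obtain ⟨u, _, sharp_φ⟩ := h.exists_isSharp hd hφ
  obtain ⟨v, _, sharp_ψ⟩ := h.exists_isSharp hd hψ
  obtain ⟨w, _, sharp_χ⟩ := h.exists_isSharp hd hχ
  have rotate := sharp_φ.formEval₃_dynamicalYangBaxter_rotate sharp_ψ sharp_χ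
  have rotate' := rotate.trans (sharp_ψ.formEval₃_dynamicalYangBaxter_rotate sharp_χ sharp_φ)
  clear sharp_φ sharp_ψ sharp_χ
  rcases hφ with ⟨u, hu, rfl⟩ | ⟨ξ, rfl⟩ <;> rcases hψ with ⟨v, hv, rfl⟩ | ⟨η, rfl⟩ <;>
    rcases hχ with ⟨w, hw, rfl⟩ | ⟨ζ, rfl⟩
  · exact formEval₃_resForm_dynamicalYangBaxter hd hu hv hw
  · exact formEval₃_resForm_resForm_constForm_dynamicalYangBaxter hd hu hv ζ
  · exact rotate'.trans (formEval₃_resForm_resForm_constForm_dynamicalYangBaxter hd hw hu η)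
  · exact rotate.trans
      (formEval₃_constForm_constForm_dynamicalYangBaxter hd η ζ (.inl ⟨u, hu, rfl⟩))
  · exact rotate.trans (formEval₃_resForm_resForm_constForm_dynamicalYangBaxter hd hv hw ξ)
  · exact rotate'.trans
      (formEval₃_constForm_constForm_dynamicalYangBaxter hd ζ ξ (.inl ⟨v, hv, rfl⟩))
  · exact formEval₃_constForm_constForm_dynamicalYangBaxter hd ξ η (.inl ⟨w, hw, rfl⟩)
  · exact formEval₃_constForm_constForm_dynamicalYangBaxter hd ξ η (.inr ⟨ζ, rfl⟩)

theorem sigmaAway_equivariant (a : 𝔩) :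
    (awayDer (dress (Double.inl K 𝔩 a)) Q :
        Localization.Away Q →ₗ[K] Localization.Away Q).lTensor (𝔤 ⊗[K] 𝔤) (h.sigmaAway hd) +
      (LieModule.toEnd K 𝔤 (𝔤 ⊗[K] 𝔤) (i a)).rTensor (Localization.Away Q) (h.sigmaAway hd)
      = 0 := by
  have eval_eq {φ ψ : 𝔤 →ₗ[K] Localization.Away Q} {u v : 𝔤} (hφ : h.IsSharp hd φ u)
      (hψ : h.IsSharp hd ψ v) (lie_eq : awayDer (dress (Double.inl K 𝔩 a)) Q (φ v) =
        φ ⁅i a, v⁆ - ψ ⁅i a, u⁆) : formEval₂ φ ψ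
      ((awayDer (dress (Double.inl K 𝔩 a)) Q :
        Localization.Away Q →ₗ[K] Localization.Away Q).lTensor (𝔤 ⊗[K] 𝔤) (h.sigmaAway hd) +
      (LieModule.toEnd K 𝔤 (𝔤 ⊗[K] 𝔤) (i a)).rTensor (Localization.Away Q) (h.sigmaAway hd))
      = 0 := by
    rw [map_add, hφ.formEval₂_lTensor hψ, formEval₂_rTensor_toEnd, hψ.formEval₂_right,
      hφ.formEval₂_left, lie_eq]
    simp
  refine eq_zero_of_formEval₂ h.adaptedBasis (h.constForm_coord_mem_span_testForms hd) ?_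
  rintro _ (⟨u, hu, rfl⟩ | ⟨ξ, rfl⟩) ψ hψ
  · rcases hψ with ⟨v, hv, rfl⟩ | ⟨η, rfl⟩
    · refine eval_eq (h.isSharp_resForm hd hu) (h.isSharp_resForm hd hv) ?_
      rw [h.awayDer_dress_resForm Q a hv]
    · refine eval_eq (h.isSharp_resForm hd hu) (h.isSharp_constForm hd η) ?_
      simp only [h.constForm_dualIncl_of_mem η (h.lie_mem a u hu), lie_zero, map_zero, sub_zero]
  · obtain ⟨v, hv, sharp_ψ⟩ := h.exists_isSharp hd hψ
    refine eval_eq (h.isSharp_constForm hd ξ) sharp_ψ ?_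
    simp only [h.constForm_dualIncl_of_mem ξ hv, h.constForm_dualIncl_of_mem ξ (h.lie_mem a v hv),
      lie_zero, map_zero, sub_zero]

end YangBaxter

end IsSplitting

section Functoriality

open LieBialgebra

theorem rTensor_lTensor_comm {K M N A B : Type*} [CommRing K] [AddCommGroup M] [Module K M]
    [AddCommGroup N] [Module K N] [AddCommGroup A] [Module K A] [AddCommGroup B] [Module K B]
    (F : M →ₗ[K] N) (θ : A →ₗ[K] B) (s : M ⊗[K] A) :
    F.rTensor B (θ.lTensor M s) = θ.lTensor N (F.rTensor A s) := by
  rw [← LinearMap.comp_apply, ← LinearMap.comp_apply, LinearMap.rTensor_comp_lTensor,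
    LinearMap.lTensor_comp_rTensor]

variable {K : Type*} [Field K] {V W : Type*} [LieRing V] [LieAlgebra K V] [LieRing W]
  [LieAlgebra K W] {A B : Type*} [CommRing A] [Algebra K A] [CommRing B] [Algebra K B]

theorem CYB_lTensor (θ : A →ₐ[K] B) (s : (V ⊗[K] V) ⊗[K] A) :
    CYB (θ.toLinearMap.lTensor (V ⊗[K] V) s) =
      θ.toLinearMap.lTensor ((V ⊗[K] V) ⊗[K] V) (CYB s) := by
  refine LinearMap.congr_fun₂ (bilin_ext_threefold
    (F := (TensorProduct.map₂ (lie₁₂₁₃ K V + lie₁₂₂₃ K V + lie₁₃₂₃ K V)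
      (LinearMap.mul K B)).compl₁₂ (θ.toLinearMap.lTensor (V ⊗[K] V))
        (θ.toLinearMap.lTensor (V ⊗[K] V)))
    (G := (TensorProduct.map₂ (lie₁₂₁₃ K V + lie₁₂₂₃ K V + lie₁₃₂₃ K V)
      (LinearMap.mul K A)).compr₂ (θ.toLinearMap.lTensor ((V ⊗[K] V) ⊗[K] V)))
    fun x y f x' y' g => ?_) s s
  simp

section Map

variable (j : V →ₗ⁅K⁆ W)

/-- The map `V ⊗ V → W ⊗ W` induced by `j`. -/
noncomputable def tensorMap₂ : V ⊗[K] V →ₗ[K] W ⊗[K] W :=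
  TensorProduct.map (j : V →ₗ[K] W) (j : V →ₗ[K] W)

/-- The map `V ⊗ V ⊗ V → W ⊗ W ⊗ W` induced by `j`. -/
noncomputable def tensorMap₃ : (V ⊗[K] V) ⊗[K] V →ₗ[K] (W ⊗[K] W) ⊗[K] W :=
  TensorProduct.map (tensorMap₂ j) (j : V →ₗ[K] W)

@[simp] theorem tensorMap₂_tmul (x y : V) : tensorMap₂ j (x ⊗ₜ[K] y) = j x ⊗ₜ[K] j y := rfl

@[simp] theorem tensorMap₃_tmul (t : V ⊗[K] V) (z : V) :
    tensorMap₃ j (t ⊗ₜ[K] z) = tensorMap₂ j t ⊗ₜ[K] j z := rfl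

theorem comm_comp_tensorMap₂ : (TensorProduct.comm K W W).toLinearMap ∘ₗ tensorMap₂ j =
    tensorMap₂ j ∘ₗ (TensorProduct.comm K V V).toLinearMap :=
  TensorProduct.ext' fun _ _ => rfl

theorem toEnd_comp_tensorMap₂ (a : V) :
    (LieModule.toEnd K W (W ⊗[K] W) (j a) : W ⊗[K] W →ₗ[K] W ⊗[K] W) ∘ₗ tensorMap₂ j =
      tensorMap₂ j ∘ₗ LieModule.toEnd K V (V ⊗[K] V) a :=
  TensorProduct.ext' fun x y => by simp [TensorProduct.LieModule.lie_tmul_right]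

theorem Alt_comp_tensorMap₃ : Alt K W ∘ₗ tensorMap₃ j = tensorMap₃ j ∘ₗ Alt K V :=
  TensorProduct.ext_threefold fun x y z => by simp [Alt, cyc]

theorem CYB_rTensor_tensorMap₂ (s : (V ⊗[K] V) ⊗[K] A) :
    CYB ((tensorMap₂ j).rTensor A s) = (tensorMap₃ j).rTensor A (CYB s) := by
  refine LinearMap.congr_fun₂ (bilin_ext_threefold
    (F := (TensorProduct.map₂ (lie₁₂₁₃ K W + lie₁₂₂₃ K W + lie₁₃₂₃ K W)
      (LinearMap.mul K A)).compl₁₂ ((tensorMap₂ j).rTensor A) ((tensorMap₂ j).rTensor A))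
    (G := (TensorProduct.map₂ (lie₁₂₁₃ K V + lie₁₂₂₃ K V + lie₁₃₂₃ K V)
      (LinearMap.mul K A)).compr₂ ((tensorMap₃ j).rTensor A))
    fun x y f x' y' g => ?_) s s
  change ((⁅j x, j x'⁆ ⊗ₜ[K] j y) ⊗ₜ[K] j y' + (j x ⊗ₜ[K] ⁅j y, j x'⁆) ⊗ₜ[K] j y' +
      (j x ⊗ₜ[K] j x') ⊗ₜ[K] ⁅j y, j y'⁆) ⊗ₜ[K] (f * g) =
    (tensorMap₃ j).rTensor A (((⁅x, x'⁆ ⊗ₜ[K] y) ⊗ₜ[K] y' + (x ⊗ₜ[K] ⁅y, x'⁆) ⊗ₜ[K] y' +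
      (x ⊗ₜ[K] x') ⊗ₜ[K] ⁅y, y'⁆) ⊗ₜ[K] (f * g))
  simp only [LinearMap.rTensor_tmul, map_add, tensorMap₃_tmul, tensorMap₂_tmul, LieHom.map_lie]

theorem insertThird_rTensor_tensorMap₂ (e : V) (D : A →ₗ[K] A) (s : (V ⊗[K] V) ⊗[K] A) :
    insertThird (j e) D ((tensorMap₂ j).rTensor A s) =
      (tensorMap₃ j).rTensor A (insertThird e D s) :=
  LinearMap.congr_fun (TensorProduct.ext_threefold
    (g := insertThird (j e) D ∘ₗ (tensorMap₂ j).rTensor A)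
    (h := (tensorMap₃ j).rTensor A ∘ₗ insertThird e D) fun _ _ _ => rfl) s

theorem rTensor_δ_comp_tensorMap₂ [LieBialgebra K V] [LieBialgebra K W]
    (hj : ∀ x, δ (K := K) (j x) = tensorMap₂ j (δ (K := K) x)) :
    (δ (K := K) (𝔤 := W)).rTensor W ∘ₗ tensorMap₂ j =
      tensorMap₃ j ∘ₗ (δ (K := K) (𝔤 := V)).rTensor V :=
  TensorProduct.ext' fun x y => by
    simp only [LinearMap.comp_apply, tensorMap₂_tmul, LinearMap.rTensor_tmul, hj,
      tensorMap₃_tmul]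

end Map

/-- `(ρ, σ) ↦ [ρ^{1,2}, σ^{1,3} + σ^{2,3}]`, whose cyclic sum gives the mixed terms of
`CYB (ρ + σ)` when `ρ` and `σ` are antisymmetric. -/
noncomputable def crossBracket : (V ⊗[K] V) ⊗[K] A →ₗ[K] (V ⊗[K] V) ⊗[K] A →ₗ[K]
    ((V ⊗[K] V) ⊗[K] V) ⊗[K] A :=
  TensorProduct.map₂ (lie₁₂₁₃ K V + lie₁₂₂₃ K V) (LinearMap.mul K A)

@[simp] theorem crossBracket_tmul_tmul (a b x y : V) (f g : A) :
    crossBracket (K := K) ((a ⊗ₜ[K] b) ⊗ₜ[K] g) ((x ⊗ₜ[K] y) ⊗ₜ[K] f) =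
      ((⁅a, x⁆ ⊗ₜ[K] b) ⊗ₜ[K] y + (a ⊗ₜ[K] ⁅b, x⁆) ⊗ₜ[K] y) ⊗ₜ[K] (g * f) := rfl

theorem crossBracket_tmul (ρ : (V ⊗[K] V) ⊗[K] A) (x y : V) (f : A) :
    crossBracket ρ ((x ⊗ₜ[K] y) ⊗ₜ[K] f) = -insertThird y (LinearMap.mulLeft K f)
      ((LieModule.toEnd K V (V ⊗[K] V) x).rTensor A ρ) := by
  refine LinearMap.congr_fun (TensorProduct.ext_threefold
    (g := crossBracket.flip ((x ⊗ₜ[K] y) ⊗ₜ[K] f))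
    (h := -(insertThird y (LinearMap.mulLeft K f) ∘ₗ
      (LieModule.toEnd K V (V ⊗[K] V) x).rTensor A)) fun a b g => ?_) ρ
  change ((⁅a, x⁆ ⊗ₜ[K] b) ⊗ₜ[K] y + (a ⊗ₜ[K] ⁅b, x⁆) ⊗ₜ[K] y) ⊗ₜ[K] (g * f) =
    -((⁅x, a ⊗ₜ[K] b⁆ ⊗ₜ[K] y) ⊗ₜ[K] (f * g))
  rw [TensorProduct.LieModule.lie_tmul_right, ← lie_skew x a, ← lie_skew x b]
  simp only [TensorProduct.neg_tmul, TensorProduct.tmul_neg, ← neg_add, neg_neg,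
    TensorProduct.add_tmul, mul_comm g f]

theorem cyc_crossBracket (ρ σ : (V ⊗[K] V) ⊗[K] A) :
    (cyc K V).rTensor A (crossBracket ((TensorProduct.comm K V V).toLinearMap.rTensor A ρ) σ) =
      TensorProduct.map₂ (lie₁₃₂₃ K V) (LinearMap.mul K A) ρ
        ((TensorProduct.comm K V V).toLinearMap.rTensor A σ) -
      TensorProduct.map₂ (lie₁₂₁₃ K V) (LinearMap.mul K A) σ ρ := by
  refine LinearMap.congr_fun₂ (bilin_ext_threefold
    (F := (crossBracket ∘ₗ (TensorProduct.comm K V V).toLinearMap.rTensor A).compr₂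
      ((cyc K V).rTensor A))
    (G := (TensorProduct.map₂ (lie₁₃₂₃ K V) (LinearMap.mul K A)).compl₂
      ((TensorProduct.comm K V V).toLinearMap.rTensor A) -
      (TensorProduct.map₂ (lie₁₂₁₃ K V) (LinearMap.mul K A)).flip) fun a b g x y f => ?_) ρ σ
  change (cyc K V).rTensor A (crossBracket ((b ⊗ₜ[K] a) ⊗ₜ[K] g) ((x ⊗ₜ[K] y) ⊗ₜ[K] f)) =
    (a ⊗ₜ[K] y) ⊗ₜ[K] ⁅b, x⁆ ⊗ₜ[K] (g * f) - (⁅x, a⁆ ⊗ₜ[K] y) ⊗ₜ[K] b ⊗ₜ[K] (f * g)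
  simp only [crossBracket_tmul_tmul, map_add, LinearMap.rTensor_tmul, cyc, LinearMap.comp_apply,
    LinearEquiv.coe_coe, TensorProduct.assoc_tmul, TensorProduct.comm_tmul, TensorProduct.add_tmul]
  rw [← lie_skew x a]
  simp only [TensorProduct.neg_tmul, mul_comm f g, sub_neg_eq_add]

theorem cyc_cyc_crossBracket (ρ σ : (V ⊗[K] V) ⊗[K] A) :
    (cyc K V).rTensor A ((cyc K V).rTensor A
        (crossBracket ρ ((TensorProduct.comm K V V).toLinearMap.rTensor A σ))) =
      -(TensorProduct.map₂ (lie₁₂₂₃ K V) (LinearMap.mul K A) σ ρ +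
        TensorProduct.map₂ (lie₁₃₂₃ K V) (LinearMap.mul K A) σ ρ) := by
  refine LinearMap.congr_fun₂ (bilin_ext_threefold
    (F := (crossBracket.flip ∘ₗ (TensorProduct.comm K V V).toLinearMap.rTensor A).compr₂
      ((cyc K V).rTensor A ∘ₗ (cyc K V).rTensor A))
    (G := -(TensorProduct.map₂ (lie₁₂₂₃ K V) (LinearMap.mul K A) +
      TensorProduct.map₂ (lie₁₃₂₃ K V) (LinearMap.mul K A))) fun x y f a b g => ?_) σ ρ
  change (cyc K V).rTensor A ((cyc K V).rTensor A
      (crossBracket ((a ⊗ₜ[K] b) ⊗ₜ[K] g) ((y ⊗ₜ[K] x) ⊗ₜ[K] f))) =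
    -((x ⊗ₜ[K] ⁅y, a⁆) ⊗ₜ[K] b ⊗ₜ[K] (f * g) + (x ⊗ₜ[K] a) ⊗ₜ[K] ⁅y, b⁆ ⊗ₜ[K] (f * g))
  simp only [crossBracket_tmul_tmul, map_add, LinearMap.rTensor_tmul, cyc, LinearMap.comp_apply,
    LinearEquiv.coe_coe, TensorProduct.assoc_tmul, TensorProduct.comm_tmul, TensorProduct.add_tmul]
  rw [← lie_skew y a, ← lie_skew y b]
  simp only [TensorProduct.neg_tmul, TensorProduct.tmul_neg, mul_comm f g, neg_add, neg_neg]

theorem CYB_add_of_antisymm {ρ σ : (V ⊗[K] V) ⊗[K] A}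
    (hρ : (TensorProduct.comm K V V).toLinearMap.rTensor A ρ = -ρ)
    (hσ : (TensorProduct.comm K V V).toLinearMap.rTensor A σ = -σ) :
    CYB (ρ + σ) = CYB ρ + CYB σ + (Alt K V).rTensor A (crossBracket ρ σ) := by
  have cyc_eq := cyc_crossBracket ρ σ
  have cyc_cyc_eq := cyc_cyc_crossBracket ρ σ
  simp only [hρ, hσ, map_neg, LinearMap.neg_apply] at cyc_eq cyc_cyc_eq
  have crossBracket_eq : crossBracket ρ σ =
      TensorProduct.map₂ (lie₁₂₁₃ K V) (LinearMap.mul K A) ρ σ +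
        TensorProduct.map₂ (lie₁₂₂₃ K V) (LinearMap.mul K A) ρ σ := by
    rw [crossBracket, map₂_add_left, LinearMap.add_apply, LinearMap.add_apply]
  rw [Alt, LinearMap.rTensor_add, LinearMap.rTensor_add, LinearMap.rTensor_comp,
    LinearMap.rTensor_id, LinearMap.add_apply, LinearMap.add_apply, LinearMap.id_apply,
    LinearMap.comp_apply, neg_inj.mp cyc_cyc_eq, neg_eq_iff_eq_neg.mp cyc_eq, crossBracket_eq]
  simp only [CYB, map₂_add_left, map_add, LinearMap.add_apply]
  abel

section Dynamical

open FormalFun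

variable [CharZero K] {𝔥 : Type*} [LieRing 𝔥] [LieAlgebra K 𝔥] [LieBialgebra K 𝔥]
  [LieBialgebra K V] [FiniteDimensional K 𝔥] (i : 𝔥 →ₗ⁅K⁆ V) {P : FormalFun K 𝔥}

theorem dynamicalYangBaxter_add_of_antisymm {ρ σ : (V ⊗[K] V) ⊗[K] Localization.Away P}
    (hρ : (TensorProduct.comm K V V).toLinearMap.rTensor _ ρ = -ρ)
    (hσ : (TensorProduct.comm K V V).toLinearMap.rTensor _ σ = -σ) :
    dynamicalYangBaxter i (ρ + σ) = dynamicalYangBaxter i ρ + dynamicalYangBaxter i σ +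
      (Alt K V).rTensor _ (crossBracket ρ σ) := by
  have dL_add : dL i P (ρ + σ) = dL i P ρ + dL i P σ := by
    simp only [dL, map_add, Finset.sum_add_distrib, neg_add]
  rw [dynamicalYangBaxter, CYB_add_of_antisymm hρ hσ, dL_add, map_add, map_add,
    dynamicalYangBaxter, dynamicalYangBaxter]
  abel

variable [LieBialgebra K W] {j : V →ₗ⁅K⁆ W}

theorem dynamicalYangBaxter_rTensor_tensorMap₂
    (hj : ∀ x, δ (K := K) (j x) = tensorMap₂ j (δ (K := K) x))
    (s : (V ⊗[K] V) ⊗[K] Localization.Away P) :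
    dynamicalYangBaxter (j.comp i) ((tensorMap₂ j).rTensor _ s) =
      (tensorMap₃ j).rTensor _ (dynamicalYangBaxter i s) := by
  have dL_eq : dL (j.comp i) P ((tensorMap₂ j).rTensor _ s) =
      (tensorMap₃ j).rTensor _ (dL i P s) := by
    rw [dL, dL, map_neg, map_sum]
    simp only [LieHom.comp_apply, insertThird_rTensor_tensorMap₂]
  simp only [dynamicalYangBaxter, CYB_rTensor_tensorMap₂, dL_eq, map_add,
    ← LinearMap.rTensor_comp_apply, LinearMap.comp_assoc, rTensor_δ_comp_tensorMap₂ j hj]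
  simp only [← LinearMap.comp_assoc, Alt_comp_tensorMap₃]

end Dynamical

end Functoriality

section InsertLeftDer

open FormalFun

variable {K : Type*} [Field K] [CharZero K] {𝔤 V : Type*} [LieRing 𝔤] [LieAlgebra K 𝔤]
  [LieBialgebra K 𝔤] [LieRing V] [LieAlgebra K V] {P : FormalFun K 𝔤}

/-- The bilinear map sending `(e, η)` to the image of `ρ` under `a ⊗ b ⊗ f ↦ a ⊗ b ⊗ e ⊗ L_η f`;
`d^L ρ` is minus the trace of this map. -/
noncomputable def insertLeftDer (ρ : (V ⊗[K] V) ⊗[K] Localization.Away P) :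
    V →ₗ[K] Module.Dual K 𝔤 →ₗ[K] ((V ⊗[K] V) ⊗[K] V) ⊗[K] Localization.Away P :=
  ((TensorProduct.mapBilinear (.id K) (V ⊗[K] V) (Localization.Away P) ((V ⊗[K] V) ⊗[K] V)
    (Localization.Away P)).compl₁₂ (TensorProduct.mk K (V ⊗[K] V) V).flip
      (awayLeftDer P)).compr₂ (LinearMap.applyₗ ρ)

theorem dL_eq_sum_insertLeftDer [FiniteDimensional K 𝔤] [LieBialgebra K V] (j : 𝔤 →ₗ⁅K⁆ V)
    (ρ : (V ⊗[K] V) ⊗[K] Localization.Away P) :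
    dL j P ρ = -∑ s, insertLeftDer ρ (j (Module.finBasis K 𝔤 s)) ((Module.finBasis K 𝔤).coord s) :=
  rfl

end InsertLeftDer

namespace IsSplitting

open LieBialgebra FormalFun

variable {K : Type*} [Field K] [CharZero K] {𝔩 𝔤 : Type*} [LieRing 𝔩] [LieAlgebra K 𝔩]
  [LieBialgebra K 𝔩] [LieRing 𝔤] [LieAlgebra K 𝔤] [LieBialgebra K 𝔤] {i : 𝔩 →ₗ⁅K⁆ 𝔤}
  {𝔲 : Submodule K 𝔤} (h : IsSplitting i 𝔲) {P : FormalFun K 𝔤} {Q : FormalFun K 𝔩}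
  (hQ : h.res P ∣ Q)

/-- The restriction to `L*` of tensors with coefficients in `K[[G*]][1/P]`, with any multiple of
`P_{|L*}` as denominator. -/
noncomputable def resTensor {M : Type*} [AddCommGroup M] [Module K M] :
    M ⊗[K] Localization.Away P →ₗ[K] M ⊗[K] Localization.Away Q :=
  (awayHom h.res P Q hQ).toLinearMap.lTensor M

theorem rTensor_resTensor {M N : Type*} [AddCommGroup M] [Module K M] [AddCommGroup N] [Module K N]
    (F : M →ₗ[K] N) (ρ : M ⊗[K] Localization.Away P) :
    F.rTensor _ (h.resTensor hQ ρ) = h.resTensor hQ (F.rTensor _ ρ) :=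
  rTensor_lTensor_comm F _ ρ

theorem resTensor_lTensor_awayDer {M : Type*} [AddCommGroup M] [Module K M]
    {D : Derivation K (FormalFun K 𝔤) (FormalFun K 𝔤)}
    {D' : Derivation K (FormalFun K 𝔩) (FormalFun K 𝔩)} (hD : ∀ f, h.res (D f) = D' (h.res f))
    (ρ : M ⊗[K] Localization.Away P) :
    h.resTensor hQ
        ((awayDer D P : Localization.Away P →ₗ[K] Localization.Away P).lTensor M ρ) =
      (awayDer D' Q : Localization.Away Q →ₗ[K] Localization.Away Q).lTensor M
        (h.resTensor hQ ρ) := by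
  rw [resTensor, ← LinearMap.lTensor_comp_apply, ← LinearMap.lTensor_comp_apply]
  congr 2
  exact LinearMap.ext (awayHom_awayDer h.res P Q hQ hD)

variable {𝔞 : Type*} [LieRing 𝔞] [LieAlgebra K 𝔞] (j : 𝔤 →ₗ⁅K⁆ 𝔞)

theorem resTensor_insertLeftDer_dualIncl (ρ : (𝔞 ⊗[K] 𝔞) ⊗[K] Localization.Away P) (e : 𝔞)
    (ξ : Module.Dual K 𝔩) :
    h.resTensor hQ (insertLeftDer ρ e (h.dualIncl ξ)) =
      insertLeftDer (h.resTensor hQ ρ) e ξ := by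
  refine LinearMap.congr_fun (TensorProduct.ext_threefold
    (g := h.resTensor hQ ∘ₗ insertThird e (awayLeftDer P (h.dualIncl ξ)))
    (h := insertThird e (awayLeftDer Q ξ) ∘ₗ h.resTensor hQ) fun x y f => ?_) ρ
  exact congrArg (((x ⊗ₜ[K] y) ⊗ₜ[K] e) ⊗ₜ[K] ·)
    (awayHom_awayDer h.res P Q hQ (fun f => (h.leftDer_res ξ f).symm) f)

variable [FiniteDimensional K 𝔤]

theorem sigmaIn_eq : h.sigmaIn j P =
    (tensorMap₂ j).rTensor _ (h.sigmaAway (dvd_mul_left h.detP (h.res P))) := by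
  rw [sigmaIn, sigma, sigmaAway]
  simp only [map_sum]
  rfl

variable [FiniteDimensional K 𝔩]

/-- The part of `d^L ρ` in the directions of `𝔲`, which the operator `d^L` of `𝔩` misses. -/
noncomputable def transverseDL (ρ : (𝔞 ⊗[K] 𝔞) ⊗[K] Localization.Away P) :
    ((𝔞 ⊗[K] 𝔞) ⊗[K] 𝔞) ⊗[K] Localization.Away P :=
  -∑ s, insertLeftDer ρ (j (Module.finBasis K 𝔲 s)) (h.uCoord s)

section DynamicalYangBaxter

variable [LieBialgebra K 𝔞]

theorem resTensor_dL (ρ : (𝔞 ⊗[K] 𝔞) ⊗[K] Localization.Away P) :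
    h.resTensor hQ (dL j P ρ) =
      dL (j.comp i) Q (h.resTensor hQ ρ) + h.resTensor hQ (h.transverseDL j ρ) := by
  have trace_eq := sum_map_basis_coord (Module.finBasis K 𝔤) h.adaptedBasis LinearMap.id
    (insertLeftDer ρ ∘ₗ (j : 𝔤 →ₗ[K] 𝔞))
  simp only [LinearMap.comp_apply, LinearMap.id_apply, LinearMap.comp_id, LieHom.coe_toLinearMap,
    Fintype.sum_sum_type, adaptedBasis_inl, adaptedBasis_inr, coord_adaptedBasis_inl]
    at trace_eq
  rw [dL_eq_sum_insertLeftDer, trace_eq, dL_eq_sum_insertLeftDer, transverseDL, neg_add, map_add,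
    map_neg, map_sum]
  simp only [resTensor_insertLeftDer_dualIncl, LieHom.comp_apply]
  rfl

theorem resTensor_dynamicalYangBaxter (ρ : (𝔞 ⊗[K] 𝔞) ⊗[K] Localization.Away P) :
    h.resTensor hQ (dynamicalYangBaxter j ρ) =
      dynamicalYangBaxter (j.comp i) (h.resTensor hQ ρ) +
        (Alt K 𝔞).rTensor _ (h.resTensor hQ (h.transverseDL j ρ)) := by
  have CYB_res : CYB (h.resTensor hQ ρ) = h.resTensor hQ (CYB ρ) := CYB_lTensor _ ρ
  rw [dynamicalYangBaxter, map_add, map_add, ← CYB_res, ← rTensor_resTensor, resTensor_dL,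
    ← rTensor_resTensor, dynamicalYangBaxter, map_add]
  abel

end DynamicalYangBaxter

variable (hd : h.detP ∣ Q)

theorem sum_sigmaCoeff_mul_awayHom_dress (t : Fin (Module.finrank K 𝔲)) (z : Localization.Away P) :
    ∑ s, h.sigmaCoeff hd s t * awayHom h.res P Q hQ
        (awayDer (dress (Double.inl K 𝔤 (Module.finBasis K 𝔲 s : 𝔤))) P z) =
      -awayHom h.res P Q hQ (awayDer (leftDer (h.uCoord t)) P z) := by
  have inverse (m : Fin (Module.finrank K 𝔲)) : ∑ s, h.sigmaCoeff hd s t *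
      algebraMap _ (Localization.Away Q) (h.res (omegaLie K 𝔤 (Module.finBasis K 𝔲 m : 𝔤)
        (Module.finBasis K 𝔲 s : 𝔤))) = -if t = m then 1 else 0 := by
    simp only [h.sigmaCoeff_swap hd t, neg_mul, Finset.sum_neg_distrib, ← omegaMatrix_apply]
    exact congrArg Neg.neg ((congrFun₂ (h.sigmaCoeff_mul hd) t m).trans Matrix.one_apply)
  simp only [awayHom_awayDer_eq_sum h.res P Q hQ
    (h.res_dress_of_mem (Module.finBasis K 𝔲 _).2), Finset.mul_sum]
  rw [Finset.sum_comm]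
  simp only [← mul_assoc, ← Finset.sum_mul, inverse, neg_mul, ite_mul, one_mul, zero_mul,
    Finset.sum_neg_distrib, Finset.sum_ite_eq, Finset.mem_univ, if_true]

theorem sum_insertThird_sigmaCoeff_dress (e : 𝔞)
    (t : Fin (Module.finrank K 𝔲)) (ρ : (𝔞 ⊗[K] 𝔞) ⊗[K] Localization.Away P) :
    ∑ s, insertThird e (LinearMap.mulLeft K (h.sigmaCoeff hd s t)) (h.resTensor hQ
        ((awayDer (dress (Double.inl K 𝔤 (Module.finBasis K 𝔲 s : 𝔤))) P :
          Localization.Away P →ₗ[K] Localization.Away P).lTensor _ ρ)) =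
      -h.resTensor hQ (insertLeftDer ρ e (h.uCoord t)) := by
  have sum_eq := LinearMap.congr_fun (TensorProduct.ext_threefold
    (g := ∑ s, insertThird e (LinearMap.mulLeft K (h.sigmaCoeff hd s t)) ∘ₗ h.resTensor hQ ∘ₗ
      (awayDer (dress (Double.inl K 𝔤 (Module.finBasis K 𝔲 s : 𝔤))) P :
        Localization.Away P →ₗ[K] Localization.Away P).lTensor _)
    (h := -(h.resTensor hQ ∘ₗ insertThird e (awayLeftDer P (h.uCoord t)))) fun x y f => ?_) ρ
  · rwa [LinearMap.sum_apply] at sum_eq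
  · rw [LinearMap.sum_apply]
    change ∑ s, ((x ⊗ₜ[K] y) ⊗ₜ[K] e) ⊗ₜ[K] (h.sigmaCoeff hd s t * awayHom h.res P Q hQ
        (awayDer (dress (Double.inl K 𝔤 (Module.finBasis K 𝔲 s : 𝔤))) P f)) =
      -(((x ⊗ₜ[K] y) ⊗ₜ[K] e) ⊗ₜ[K] awayHom h.res P Q hQ (awayDer (leftDer (h.uCoord t)) P f))
    rw [← TensorProduct.tmul_sum, sum_sigmaCoeff_mul_awayHom_dress, TensorProduct.tmul_neg]

theorem crossBracket_resTensor_sigmaAway {ρ : (𝔞 ⊗[K] 𝔞) ⊗[K] Localization.Away P}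
    (equivariant : ∀ a : 𝔤, (awayDer (dress (Double.inl K 𝔤 a)) P :
        Localization.Away P →ₗ[K] Localization.Away P).lTensor (𝔞 ⊗[K] 𝔞) ρ +
      (LieModule.toEnd K 𝔞 (𝔞 ⊗[K] 𝔞) (j a)).rTensor (Localization.Away P) ρ = 0) :
    crossBracket (h.resTensor hQ ρ) ((tensorMap₂ j).rTensor _ (h.sigmaAway hd)) =
      h.resTensor hQ (h.transverseDL j ρ) := by
  simp only [sigmaAway, map_sum, LinearMap.rTensor_tmul, tensorMap₂_tmul, crossBracket_tmul,
    rTensor_resTensor, eq_neg_of_add_eq_zero_right (equivariant _), map_neg, neg_neg,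
    transverseDL]
  rw [Finset.sum_comm]
  simp only [sum_insertThird_sigmaCoeff_dress, Finset.sum_neg_distrib]

section RMatrix

variable [LieBialgebra K 𝔞] {Z : (𝔞 ⊗[K] 𝔞) ⊗[K] 𝔞} {ρ : (𝔞 ⊗[K] 𝔞) ⊗[K] Localization.Away P}

theorem resTensor_add_sigmaAway_equivariant (hρ : IsPLDynamicalRMatrix j Z P ρ) (a : 𝔩) :
    (awayDer (dress (Double.inl K 𝔩 a)) Q :
        Localization.Away Q →ₗ[K] Localization.Away Q).lTensor (𝔞 ⊗[K] 𝔞)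
          (h.resTensor hQ ρ + (tensorMap₂ j).rTensor _ (h.sigmaAway hd)) +
      (LieModule.toEnd K 𝔞 (𝔞 ⊗[K] 𝔞) (j (i a))).rTensor (Localization.Away Q)
        (h.resTensor hQ ρ + (tensorMap₂ j).rTensor _ (h.sigmaAway hd)) = 0 := by
  have res_eq := congrArg (h.resTensor hQ) (hρ.equivariant (i a))
  have sigma_eq := congrArg ((tensorMap₂ j).rTensor (Localization.Away Q))
    (h.sigmaAway_equivariant hd a)
  rw [map_add, map_zero, h.resTensor_lTensor_awayDer hQ (h.res_dress_incl a),
    ← rTensor_resTensor] at res_eq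
  rw [map_add, map_zero, rTensor_lTensor_comm, ← LinearMap.rTensor_comp_apply,
    ← toEnd_comp_tensorMap₂, LinearMap.rTensor_comp_apply] at sigma_eq
  rw [map_add, map_add, add_add_add_comm, res_eq, sigma_eq, add_zero]

/-- The cross terms of the classical Yang-Baxter expression of the sum cancel the part of `d^L ρ`
in the directions of `𝔲`, by equivariance of `ρ` under the dressing action of `𝔲`. -/
theorem isPLDynamicalRMatrix_resTensor_add_sigmaAway
    (hj : ∀ x, δ (K := K) (j x) = tensorMap₂ j (δ (K := K) x)) (hQ0 : Q ≠ 0)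
    (hρ : IsPLDynamicalRMatrix j Z P ρ) :
    IsPLDynamicalRMatrix (j.comp i) Z Q
      (h.resTensor hQ ρ + (tensorMap₂ j).rTensor _ (h.sigmaAway hd)) := by
  have res_antisymm : (TensorProduct.comm K 𝔞 𝔞).toLinearMap.rTensor _ (h.resTensor hQ ρ) =
      -h.resTensor hQ ρ := by
    rw [rTensor_resTensor, hρ.antisymm, map_neg]
  have sigma_antisymm : (TensorProduct.comm K 𝔞 𝔞).toLinearMap.rTensor _
      ((tensorMap₂ j).rTensor _ (h.sigmaAway hd)) =
        -(tensorMap₂ j).rTensor _ (h.sigmaAway hd) := by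
    rw [← LinearMap.rTensor_comp_apply, comm_comp_tensorMap₂, LinearMap.rTensor_comp_apply,
      sigmaAway_antisymm, map_neg]
  refine ⟨hQ0, by rw [map_add, res_antisymm, sigma_antisymm, neg_add],
    h.resTensor_add_sigmaAway_equivariant hQ j hd hρ, ?_⟩
  calc dynamicalYangBaxter (j.comp i)
        (h.resTensor hQ ρ + (tensorMap₂ j).rTensor _ (h.sigmaAway hd))
      = dynamicalYangBaxter (j.comp i) (h.resTensor hQ ρ) +
          (Alt K 𝔞).rTensor _ (h.resTensor hQ (h.transverseDL j ρ)) := by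
        rw [dynamicalYangBaxter_add_of_antisymm _ res_antisymm sigma_antisymm,
          dynamicalYangBaxter_rTensor_tensorMap₂ i hj, h.dynamicalYangBaxter_sigmaAway hd, map_zero,
          add_zero, h.crossBracket_resTensor_sigmaAway hQ j hd hρ.equivariant]
    _ = h.resTensor hQ (dynamicalYangBaxter j ρ) := (h.resTensor_dynamicalYangBaxter hQ j ρ).symm
    _ = h.resTensor hQ (Z ⊗ₜ[K] 1) := congrArg _ hρ.dynamical_yang_baxter
    _ = Z ⊗ₜ[K] 1 := by
        rw [resTensor, LinearMap.lTensor_tmul, AlgHom.toLinearMap_apply, map_one]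

end RMatrix

end IsSplitting

theorem mainTheorem2_general {K : Type*} [Field K] [CharZero K]
    {𝔩 𝔤 𝔞 : Type*}
    [LieRing 𝔩] [LieAlgebra K 𝔩] [LieBialgebra K 𝔩] [FiniteDimensional K 𝔩]
    [LieRing 𝔤] [LieAlgebra K 𝔤] [LieBialgebra K 𝔤] [FiniteDimensional K 𝔤]
    [LieRing 𝔞] [LieAlgebra K 𝔞] [LieBialgebra K 𝔞]
    (i : 𝔩 →ₗ⁅K⁆ 𝔤) (𝔲 : Submodule K 𝔤) (h : IsSplitting i 𝔲) (hnd : h.Nondegenerate)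
    (j : 𝔤 →ₗ⁅K⁆ 𝔞)
    (hj : ∀ x, LieBialgebra.δ (K := K) (j x) = tensorMap₂ j (LieBialgebra.δ (K := K) x))
    (Z : (𝔞 ⊗[K] 𝔞) ⊗[K] 𝔞)
    (P : FormalFun K 𝔤) (hP : h.res P ≠ 0)
    (ρ : (𝔞 ⊗[K] 𝔞) ⊗[K] Localization.Away P) (hρ : IsPLDynamicalRMatrix j Z P ρ) :
    IsPLDynamicalRMatrix (j.comp i) Z (h.res P * h.detP)
      (h.restrict P ρ + h.sigmaIn j P) := by
  have denominator_ne_zero : h.res P * h.detP ≠ 0 := mul_ne_zero hP (h.detP_ne_zero hnd)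
  rw [h.sigmaIn_eq]
  exact h.isPLDynamicalRMatrix_resTensor_add_sigmaAway (dvd_mul_right _ _) j (dvd_mul_left _ _) hj
    denominator_ne_zero hρ

theorem mainTheorem2 {K : Type*} [Field K] [CharZero K]
    {𝔩 𝔤 𝔞 : Type*}
    [LieRing 𝔩] [LieAlgebra K 𝔩] [LieBialgebra K 𝔩] [FiniteDimensional K 𝔩]
    [LieRing 𝔤] [LieAlgebra K 𝔤] [LieBialgebra K 𝔤] [FiniteDimensional K 𝔤]
    [LieRing 𝔞] [LieAlgebra K 𝔞] [LieBialgebra K 𝔞]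
    (i : 𝔩 →ₗ⁅K⁆ 𝔤) (𝔲 : Submodule K 𝔤) (h : IsSplitting i 𝔲) (hnd : h.Nondegenerate)
    (j : 𝔤 →ₗ⁅K⁆ 𝔞) (hj : IsLieBialgebraInclusion j)
    (Z : (𝔞 ⊗[K] 𝔞) ⊗[K] 𝔞) (hZ : IsInvariantTrivector Z)
    (P : FormalFun K 𝔤) (hP : h.res P ≠ 0)
    (ρ : (𝔞 ⊗[K] 𝔞) ⊗[K] Localization.Away P) (hρ : IsPLDynamicalRMatrix j Z P ρ) :
    IsPLDynamicalRMatrix (j.comp i) Z (h.res P * h.detP)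
      (h.restrict P ρ + h.sigmaIn j P) :=
  mainTheorem2_general i 𝔲 h hnd j hj.map_δ Z P hP ρ hρ
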